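/- **Setting.** Let $F$ be a field of characteristic $0$, let $l\ge 1$ be odd, and let $q\in F$ be a primitive $l$-th root of unity. Let $m,n,r,k\ge 0$ be integers with $kl\le r$. Let $W=\mathfrak S_r$ be the symmetric group on $\{1,\dots,r\}$, with basic transpositions $s_i=(i,i+1)$ and length function $\ell$; products in $W$ are compositions of maps, $(ww')(j)=w(w'(j))$. A composition of $r$ is a finite sequence of non-negative integers with sum $r$. For a composition $\lambda$ of $r$ let $W_\lambda\le W$ be the standard Young (parabolic) subgroup stabilizing the blocks $\{1,\dots,\lambda_1\},\{\lambda_1+1,\dots,\lambda_1+\lambda_2\},\dots$. A subgroup is called parabolic if it is of this form. Write $K^x=x^{-1}Kx$. For parabolic $K$ and $P$, write $K\le_W P$ if for some $x\in W$ the group $K^x$ is parabolic and $K^x\le P$. Let $\mathcal D_K$ be the set of shortest representatives of the right cosets $Kd$ in $W$. *Hecke algebra and tensor superspace.* Let $\mathcal H$ be the Hecke algebra of $W$ over $F$, with basis $\{\mathcal T_w\}_{w\in W}$ and $\mathcal T_w\mathcal T_s=\mathcal T_{ws}$ if $\ell(ws)>\ell(w)$, $\mathcal T_w\mathcal T_s=(q-q^{-1})\mathcal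 T_w+\mathcal T_{ws}$ otherwise, for each basic transposition $s$; for a parabolic subgroup $K$ let $\mathcal H_K=\operatorname{span}_F\{\mathcal T_w: w\in K\}$. Let $V=V_F(m|n)$ have basis $v_1,\dots,v_{m+n}$, where $\hat a=0$ for $a\le m$ and $\hat a=1$ for $a>m$. For $\mathbf i=(i_1,\dots,i_r)$ put $v_{\mathbf i}=v_{i_1}\otimes\cdots\otimes v_{i_r}$ and $\mathbf i w=(i_{w(1)},\dots,i_{w(r)})$. Then $V^{\otimes r}$ is a right $\mathcal H$-module by $$v_{\mathbf i}\mathcal T_{s_j}=\begin{cases}(-1)^{\hat i_j\hat i_{j+1}}v_{\mathbf i s_j}, & i_j<i_{j+1},\\ q\,v_{\mathbf i}, & i_j=i_{j+1}\le m,\\ -q^{-1}v_{\mathbf i}, & i_j=i_{j+1}>m,\\ (-1)^{\hat i_j\hat i_{j+1}}v_{\mathbf i s_j}+(q-q^{-1})v_{\mathbf i}, & i_j>i_{j+1}.\end{cases}$$ *Relative norm.* For a parabolic subgroup $K$ and $f\in\operatorname{End}_F(V^{\otimes r})$, with maps written on the right, so that $(v)(xfy)=((vx)f)y$ for $x,y\in\mathcal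 H$, let $$N_{W,K}(f)=\sum_{w\in\mathcal D_K}\mathcal T_{w^{-1}}\,f\,\mathcal T_w .$$ *The ideals.* Let $\Lambda(m|n,r)$ be the set of compositions $\lambda$ of $r$ with $m+n$ parts, the first $m$ parts being even and the last $n$ odd. For such $\lambda$ let $W_{\lambda^{(0)}}$ (resp. $W_{\lambda^{(1)}}$) be the subgroup of $W_\lambda$ fixing every point of the odd (resp. even) blocks, and let $\mathbf i_\lambda=(1^{\lambda_1},2^{\lambda_2},\dots)$. For $\lambda,\mu\in\Lambda(m|n,r)$ let $\mathcal D_{\lambda\mu}^\circ$ be the set of all $d\in\mathcal D_{W_\lambda}\cap\mathcal D_{W_\mu}^{-1}$ with $W_{\lambda^{(0)}}^d\cap W_{\mu^{(1)}}=1=W_{\lambda^{(1)}}^d\cap W_{\mu^{(0)}}$. For such $d$ let $\nu$ be the composition of $r$ (unique up to zero parts) with $W_\nu=W_\lambda^d\cap W_\mu$, let $e_{\mu,\lambda d}\in\operatorname{End}_F(V^{\otimes r})$ map $v_{\mathbf i_\mu}$ to $v_{\mathbf i_\lambda d}$ and every other $v_{\mathbf i}$ to $0$, and put $N_{\mu\lambda}^d=N_{W,W_\nu}(e_{\mu,\lambda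 d})$. Let $P_\nu$ be the maximal $l$-parabolic subgroup of $W_\nu$, that is, the parabolic subgroup of the composition obtained from $\nu$ by replacing each part $a=sl+t$ ($0\le t<l$) by $(l^s,1^t)$. For a parabolic subgroup $P$ all of whose blocks have size $1$ or $l$, let $$I_F(P,r)=\operatorname{span}_F\{N_{\mu\lambda}^d:\ \lambda,\mu\in\Lambda(m|n,r),\ d\in\mathcal D_{\lambda\mu}^\circ,\ P_\nu\le_W P\}.$$ **Theorem 7.4.** Let $W_\theta$ be the parabolic subgroup of $W$ associated with the composition $\theta=(l^k,1^{r-kl})$, and let $\mathcal H_\theta=\mathcal H_{W_\theta}$. Then $$I_F(W_\theta,r)=N_{W,W_\theta}\bigl(\operatorname{End}_{\mathcal H_\theta}(V_F(m|n)^{\otimes r})\bigr).$$ -/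

import Mathlib

open scoped TensorProduct

namespace QSchurSuper

/-! ### The symmetric group on `r` letters

The letters `1, …, r` of the mathematical text are `0, …, r - 1 : Fin r` here; likewise the labels
`1, …, m + n` of the basis of the superspace are `0, …, m + n - 1 : Fin (m + n)`. -/

section Symmetric

variable {r : ℕ}

/-- The position `k`, for a generator label `k : Fin (r - 1)`. -/
def posL (k : Fin (r - 1)) : Fin r := ⟨k.1, by have := k.2; omega⟩

/-- The position `k + 1`, for a generator label `k : Fin (r - 1)`. -/
def posR (k : Fin (r - 1)) : Fin r := ⟨k.1 + 1, by have := k.2; omega⟩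

/-- The basic transposition `s_k = (k, k + 1)`. -/
def simpleRefl (k : Fin (r - 1)) : Equiv.Perm (Fin r) := Equiv.swap (posL k) (posR k)

/-- The product `s_{k₁} s_{k₂} ⋯` of a word in the basic transpositions. -/
def wordProd (ω : List (Fin (r - 1))) : Equiv.Perm (Fin r) := (ω.map simpleRefl).prod

theorem exists_word (w : Equiv.Perm (Fin r)) : ∃ ω : List (Fin (r - 1)), wordProd ω = w := by
  cases r with
  | zero => exact ⟨[], Subsingleton.elim _ _⟩
  | succ r =>
    have hw : w ∈ Submonoid.closure
        (Set.range fun i : Fin r => Equiv.swap i.castSucc i.succ) := by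
      rw [Equiv.Perm.mclosure_swap_castSucc_succ]; trivial
    induction hw using Submonoid.closure_induction with
    | mem x hx =>
      obtain ⟨i, rfl⟩ := hx
      exact ⟨[i], by simp [wordProd, simpleRefl]; rfl⟩
    | one => exact ⟨[], rfl⟩
    | mul x y _ _ hx hy =>
      obtain ⟨a, rfl⟩ := hx
      obtain ⟨b, rfl⟩ := hy
      exact ⟨a ++ b, by simp [wordProd]⟩

/-- The length function on the symmetric group with respect to the basic transpositions. -/
noncomputable def len (w : Equiv.Perm (Fin r)) : ℕ :=
  sInf {t | ∃ ω : List (Fin (r - 1)), wordProd ω = w ∧ ω.length = t}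

theorem exists_reduced_word (w : Equiv.Perm (Fin r)) :
    ∃ ω : List (Fin (r - 1)), wordProd ω = w ∧ ω.length = len w := by
  obtain ⟨ω, hω⟩ := exists_word w
  exact Nat.sInf_mem (s := {t | ∃ ω : List (Fin (r - 1)), wordProd ω = w ∧ ω.length = t})
    ⟨ω.length, ω, hω, rfl⟩

/-- A reduced expression of `w`. -/
noncomputable def reducedWord (w : Equiv.Perm (Fin r)) : List (Fin (r - 1)) :=
  Classical.choose (exists_reduced_word w)

/-- `K ^ x = x⁻¹ K x`. -/
def conjSub (K : Subgroup (Equiv.Perm (Fin r))) (x : Equiv.Perm (Fin r)) :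
    Subgroup (Equiv.Perm (Fin r)) :=
  K.map (MulAut.conj x⁻¹).toMonoidHom

/-- The set `𝒟_K` of distinguished (shortest) representatives of the right cosets `K d`. -/
def distinguished (K : Subgroup (Equiv.Perm (Fin r))) : Set (Equiv.Perm (Fin r)) :=
  {d | ∀ w ∈ K, len d ≤ len (w * d)}

end Symmetric

/-! ### Compositions and parabolic subgroups

A composition is a list of natural numbers (zero parts are allowed). -/

/-- The index of the block of the composition `L` that contains the position `j`: the positions
`0, …, L₀ - 1` lie in block `0`, the next `L₁` positions in block `1`, and so on. -/
def blockIdx : List ℕ → ℕ → ℕ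
  | [], _ => 0
  | a :: L, j => if j < a then 0 else blockIdx L (j - a) + 1

theorem blockIdx_lt : ∀ (L : List ℕ) (j : ℕ), j < L.sum → blockIdx L j < L.length
  | [], j, h => by simp at h
  | a :: L, j, h => by
    rw [blockIdx]
    split_ifs with hj
    · simp
    · have := blockIdx_lt L (j - a) (by simp at h; omega)
      simpa using this

/-- The parabolic (standard Young) subgroup `W_L` of a composition `L` of `r`: the permutations
that leave every block of `L` invariant. -/
def parabolic (r : ℕ) (L : List ℕ) : Subgroup (Equiv.Perm (Fin r)) where
  carrier := {w | ∀ j, blockIdx L (w j).1 = blockIdx L j.1}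
  one_mem' _ := rfl
  mul_mem' {a b} ha hb j := by rw [Equiv.Perm.mul_apply, ha, hb]
  inv_mem' {a} ha j := by
    have := ha (a⁻¹ j)
    simpa using this.symm

/-- A subgroup of the symmetric group is parabolic if it is `W_L` for a composition `L` of `r`. -/
def IsParabolic {r : ℕ} (K : Subgroup (Equiv.Perm (Fin r))) : Prop :=
  ∃ L : List ℕ, L.sum = r ∧ K = parabolic r L

/-- `K ≤_W Q`: some conjugate `K ^ x` is parabolic and contained in `Q`. -/
def ConjLE {r : ℕ} (K Q : Subgroup (Equiv.Perm (Fin r))) : Prop :=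
  ∃ x : Equiv.Perm (Fin r), conjSub K x ≤ Q ∧ IsParabolic (conjSub K x)

/-- The composition of `P_L = P_(L₀) × P_(L₁) × ⋯`: each part `a = s l + t` with `0 ≤ t < l` is
replaced by `l^s, 1^t`. -/
def maxLComp (l : ℕ) (L : List ℕ) : List ℕ :=
  L.flatMap fun a => List.replicate (a / l) l ++ List.replicate (a % l) 1

/-- The composition `(l^k, 1^(r - k l))`. -/
def theta (l k r : ℕ) : List ℕ := List.replicate k l ++ List.replicate (r - k * l) 1

/-! ### The Hecke algebra of the symmetric group -/

section Hecke

variable {F : Type*} [Field F]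

/-- The defining relations of the Hecke algebra of `𝔖_r` with parameter `q`: the quadratic relation
`T_s² = 1 + (q - q⁻¹) T_s`, and the braid relations. -/
inductive HeckeRel (q : Fˣ) (r : ℕ) :
    FreeAlgebra F (Fin (r - 1)) → FreeAlgebra F (Fin (r - 1)) → Prop
  | quad (k : Fin (r - 1)) :
      HeckeRel q r (FreeAlgebra.ι F k * FreeAlgebra.ι F k)
        (1 + ((q : F) - (q : F)⁻¹) • FreeAlgebra.ι F k)
  | comm (j k : Fin (r - 1)) (h : j.1 + 1 < k.1) :
      HeckeRel q r (FreeAlgebra.ι F j * FreeAlgebra.ι F k)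
        (FreeAlgebra.ι F k * FreeAlgebra.ι F j)
  | braid (j k : Fin (r - 1)) (h : j.1 + 1 = k.1) :
      HeckeRel q r (FreeAlgebra.ι F j * FreeAlgebra.ι F k * FreeAlgebra.ι F j)
        (FreeAlgebra.ι F k * FreeAlgebra.ι F j * FreeAlgebra.ι F k)

/-- The Hecke algebra of `𝔖_r` over `F` with parameter `q`. -/
abbrev Hecke (q : Fˣ) (r : ℕ) : Type _ := RingQuot (HeckeRel q r)

/-- The generator `T_{s_k}`. -/
noncomputable def heckeGen (q : Fˣ) {r : ℕ} (k : Fin (r - 1)) : Hecke q r :=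
  RingQuot.mkAlgHom F (HeckeRel q r) (FreeAlgebra.ι F k)

/-- The standard basis element `T_w = T_{s_{k₁}} ⋯ T_{s_{k_t}}`, for a reduced expression
`w = s_{k₁} ⋯ s_{k_t}`; it does not depend on the reduced expression, by the braid relations. -/
noncomputable def heckeT (q : Fˣ) {r : ℕ} (w : Equiv.Perm (Fin r)) : Hecke q r :=
  ((reducedWord w).map (heckeGen q)).prod

/-- The span of the `T_w` with `w ∈ K`; for `K` parabolic, this is the parabolic subalgebra. -/
noncomputable def heckeSub (q : Fˣ) {r : ℕ} (K : Subgroup (Equiv.Perm (Fin r))) :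
    Submodule F (Hecke q r) :=
  Submodule.span F (heckeT q '' (K : Set (Equiv.Perm (Fin r))))

end Hecke

/-! ### The tensor superspace -/

section Tensor

variable (F : Type*) [Field F] (m n r : ℕ)

/-- The tensor power `V^{⊗ r}` of the superspace `V = V(m|n)`, a vector space of dimension `m + n`
with basis `v_1, …, v_{m+n}`. -/
abbrev TensorSpace : Type _ := ⨂[F] (_ : Fin r), (Fin (m + n) → F)

/-- The basis `v_𝐢 = v_{i_1} ⊗ ⋯ ⊗ v_{i_r}` of `V^{⊗ r}`, indexed by the words `𝐢`. -/
noncomputable def tensorBasis : Module.Basis (Fin r → Fin (m + n)) F (TensorSpace F m n r) :=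
  Basis.piTensorProduct fun _ => Pi.basisFun F (Fin (m + n))

variable {F m n r}

/-- The label `a` is odd, i.e. it is not one of the first `m` labels. -/
abbrev IsOdd (a : Fin (m + n)) : Prop := m ≤ a.1

/-- The sign `(-1)^{â b̂}`. -/
def sgn (F : Type*) [Field F] {m n : ℕ} (a b : Fin (m + n)) : F :=
  if IsOdd a ∧ IsOdd b then -1 else 1

/-- The scalar `q` if `a` is even and `-q⁻¹` if `a` is odd. -/
def diagCoef (q : F) (a : Fin (m + n)) : F := if IsOdd a then -q⁻¹ else q

/-- The action of `T_{s_k}` on the basis vectors of the tensor space. -/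
noncomputable def actGenBasis (q : Fˣ) (k : Fin (r - 1)) (i : Fin r → Fin (m + n)) :
    TensorSpace F m n r :=
  if i (posL k) < i (posR k) then
    sgn F (i (posL k)) (i (posR k)) • tensorBasis F m n r (i ∘ simpleRefl k)
  else if i (posL k) = i (posR k) then
    diagCoef (q : F) (i (posL k)) • tensorBasis F m n r i
  else
    sgn F (i (posL k)) (i (posR k)) • tensorBasis F m n r (i ∘ simpleRefl k) +
      ((q : F) - (q : F)⁻¹) • tensorBasis F m n r i

/-- The linear operator by which `T_{s_k}` acts (from the right) on the tensor space. -/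
noncomputable def actGen (q : Fˣ) (k : Fin (r - 1)) : Module.End F (TensorSpace F m n r) :=
  (tensorBasis F m n r).constr F (actGenBasis q k)

theorem actGen_lt (q : Fˣ) (k : Fin (r - 1)) (i : Fin r → Fin (m + n))
    (h : i (posL k) < i (posR k)) :
    actGen q k (tensorBasis F m n r i) =
      sgn F (i (posL k)) (i (posR k)) • tensorBasis F m n r (i ∘ simpleRefl k) := by
  rw [actGen, Module.Basis.constr_basis, actGenBasis, if_pos h]

theorem actGen_eq (q : Fˣ) (k : Fin (r - 1)) (i : Fin r → Fin (m + n))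
    (h : i (posL k) = i (posR k)) :
    actGen q k (tensorBasis F m n r i) =
      diagCoef (q : F) (i (posL k)) • tensorBasis F m n r i := by
  rw [actGen, Module.Basis.constr_basis, actGenBasis, if_neg (by simp [h]), if_pos h]

theorem actGen_gt (q : Fˣ) (k : Fin (r - 1)) (i : Fin r → Fin (m + n))
    (h : i (posR k) < i (posL k)) :
    actGen q k (tensorBasis F m n r i) =
      sgn F (i (posL k)) (i (posR k)) • tensorBasis F m n r (i ∘ simpleRefl k) +
        ((q : F) - (q : F)⁻¹) • tensorBasis F m n r i := by
  rw [actGen, Module.Basis.constr_basis, actGenBasis, if_neg h.not_gt, if_neg h.ne']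

theorem sgn_comm (a b : Fin (m + n)) : sgn F a b = sgn F b a := by
  by_cases h1 : IsOdd a <;> by_cases h2 : IsOdd b <;> simp [sgn, h1, h2]

theorem sgn_mul_self (a b : Fin (m + n)) : sgn F a b * sgn F a b = 1 := by
  unfold sgn; split_ifs <;> ring

theorem sgn_eq (a b : Fin (m + n)) : sgn F a b = 1 ∨ sgn F a b = -1 := by
  unfold sgn; split_ifs <;> simp

theorem diagCoef_eq (q : F) (a : Fin (m + n)) : diagCoef q a = q ∨ diagCoef q a = -q⁻¹ := by
  unfold diagCoef; split_ifs <;> simp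

theorem simpleRefl_posL (k : Fin (r - 1)) : simpleRefl k (posL k) = posR k :=
  Equiv.swap_apply_left _ _

theorem simpleRefl_posR (k : Fin (r - 1)) : simpleRefl k (posR k) = posL k :=
  Equiv.swap_apply_right _ _

theorem comp_simpleRefl_twice (k : Fin (r - 1)) (i : Fin r → Fin (m + n)) :
    (i ∘ simpleRefl k) ∘ simpleRefl k = i := by
  funext j; simp [simpleRefl]

theorem actGen_quad (q : Fˣ) (k : Fin (r - 1)) :
    (actGen q k * actGen q k : Module.End F (TensorSpace F m n r)) =
      1 + ((q : F) - (q : F)⁻¹) • actGen q k := by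
  refine (tensorBasis F m n r).ext fun i => ?_
  have hq : (q : F) ≠ 0 := q.ne_zero
  simp only [Module.End.mul_apply, LinearMap.add_apply, LinearMap.smul_apply, Module.End.one_apply]
  rcases lt_trichotomy (i (posL k)) (i (posR k)) with h | h | h
  · rw [actGen_lt q k i h, map_smul, actGen_gt q k (i ∘ simpleRefl k)
      (by simpa [simpleRefl_posL, simpleRefl_posR] using h), comp_simpleRefl_twice]
    simp only [Function.comp_apply, simpleRefl_posL, simpleRefl_posR, smul_add, smul_smul]
    rw [sgn_comm (i (posR k)), sgn_mul_self, one_smul, mul_comm]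
  · rw [actGen_eq q k i h, map_smul, actGen_eq q k i h]
    rcases diagCoef_eq (q : F) (i (posL k)) with e | e <;> rw [e] <;> match_scalars <;>
      field_simp <;> ring
  · rw [actGen_gt q k i h, map_add, map_smul, map_smul, actGen_gt q k i h,
      actGen_lt q k (i ∘ simpleRefl k)
      (by simpa [simpleRefl_posL, simpleRefl_posR] using h), comp_simpleRefl_twice]
    simp only [Function.comp_apply, simpleRefl_posL, simpleRefl_posR, smul_add, smul_smul]
    rw [sgn_comm (i (posR k)), sgn_mul_self, one_smul]

theorem actGen_comm (q : Fˣ) (j k : Fin (r - 1)) (h : j.1 + 1 < k.1) :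
    (actGen q j * actGen q k : Module.End F (TensorSpace F m n r)) = actGen q k * actGen q j := by
  have h1 : simpleRefl j (posL k) = posL k := by
    apply Equiv.swap_apply_of_ne_of_ne <;> simp [posL, posR, Fin.ext_iff] <;> omega
  have h2 : simpleRefl j (posR k) = posR k := by
    apply Equiv.swap_apply_of_ne_of_ne <;> simp [posL, posR, Fin.ext_iff] <;> omega
  have h3 : simpleRefl k (posL j) = posL j := by
    apply Equiv.swap_apply_of_ne_of_ne <;> simp [posL, posR, Fin.ext_iff] <;> omega
  have h4 : simpleRefl k (posR j) = posR j := by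
    apply Equiv.swap_apply_of_ne_of_ne <;> simp [posL, posR, Fin.ext_iff] <;> omega
  have hc (i : Fin r → Fin (m + n)) :
      (i ∘ simpleRefl j) ∘ simpleRefl k = (i ∘ simpleRefl k) ∘ simpleRefl j := by
    have : simpleRefl j * simpleRefl k = simpleRefl k * simpleRefl j := by
      apply Equiv.Perm.Disjoint.commute
      intro x
      by_cases hx : x = posL k ∨ x = posR k
      · rcases hx with rfl | rfl
        · exact Or.inl h1
        · exact Or.inl h2
      · push Not at hx
        exact Or.inr (Equiv.swap_apply_of_ne_of_ne hx.1 hx.2)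
    funext x
    exact congrArg i (DFunLike.congr_fun this x)
  refine (tensorBasis F m n r).ext fun i => ?_
  simp only [Module.End.mul_apply]
  rcases lt_trichotomy (i (posL j)) (i (posR j)) with a | a | a <;>
  rcases lt_trichotomy (i (posL k)) (i (posR k)) with b | b | b
  all_goals
    first
      | rw [actGen_lt q j i a]
      | rw [actGen_eq q j i a]
      | rw [actGen_gt q j i a]
    first
      | rw [actGen_lt q k i b]
      | rw [actGen_eq q k i b]
      | rw [actGen_gt q k i b]
    simp only [map_add, map_smul]
    try first
      | rw [actGen_lt q j i a]
      | rw [actGen_eq q j i a]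
      | rw [actGen_gt q j i a]
    try first
      | rw [actGen_lt q k i b]
      | rw [actGen_eq q k i b]
      | rw [actGen_gt q k i b]
    try first
      | rw [actGen_lt q j (i ∘ simpleRefl k) (by simpa [h3, h4] using a)]
      | rw [actGen_eq q j (i ∘ simpleRefl k) (by simpa [h3, h4] using a)]
      | rw [actGen_gt q j (i ∘ simpleRefl k) (by simpa [h3, h4] using a)]
    try first
      | rw [actGen_lt q k (i ∘ simpleRefl j) (by simpa [h1, h2] using b)]
      | rw [actGen_eq q k (i ∘ simpleRefl j) (by simpa [h1, h2] using b)]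
      | rw [actGen_gt q k (i ∘ simpleRefl j) (by simpa [h1, h2] using b)]
    try simp only [Function.comp_apply, h1, h2, h3, h4, hc i]
    try module

theorem braid_aux {M : Type*} [AddCommGroup M] [Module F M] (q : F) (hq : q ≠ 0)
    (x : Fin (m + n) → Fin (m + n) → Fin (m + n) → M) (J K : Module.End F M)
    (hJ1 : ∀ a b c, a < b → J (x a b c) = sgn F a b • x b a c)
    (hJ2 : ∀ a c, J (x a a c) = diagCoef q a • x a a c)
    (hJ3 : ∀ a b c, b < a → J (x a b c) = sgn F b a • x b a c + (q - q⁻¹) • x a b c)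
    (hK1 : ∀ a b c, b < c → K (x a b c) = sgn F b c • x a c b)
    (hK2 : ∀ a b, K (x a b b) = diagCoef q b • x a b b)
    (hK3 : ∀ a b c, c < b → K (x a b c) = sgn F c b • x a c b + (q - q⁻¹) • x a b c)
    (a b c : Fin (m + n)) : J (K (J (x a b c))) = K (J (K (x a b c))) := by
  have hJ (a b c : Fin (m + n)) : J (x a b c) = if a < b then sgn F a b • x b a c else
      if a = b then diagCoef q a • x a a c else
        sgn F b a • x b a c + (q - q⁻¹) • x a b c := by
    rcases lt_trichotomy a b with h | h | h
    · rw [if_pos h, hJ1 _ _ _ h]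
    · subst h; simp [hJ2]
    · rw [if_neg h.not_gt, if_neg h.ne', hJ3 _ _ _ h]
  have hK (a b c : Fin (m + n)) : K (x a b c) = if b < c then sgn F b c • x a c b else
      if b = c then diagCoef q b • x a b b else
        sgn F c b • x a c b + (q - q⁻¹) • x a b c := by
    rcases lt_trichotomy b c with h | h | h
    · rw [if_pos h, hK1 _ _ _ h]
    · subst h; simp [hK2]
    · rw [if_neg h.not_gt, if_neg h.ne', hK3 _ _ _ h]
  clear hJ1 hJ2 hJ3 hK1 hK2 hK3
  have key (a b c : Fin (m + n)) (h1 : a < b) (h2 : b < c) :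
      (J (K (J (x a b c))) = K (J (K (x a b c))) ∧ J (K (J (x a c b))) = K (J (K (x a c b)))) ∧
      (J (K (J (x b a c))) = K (J (K (x b a c))) ∧ J (K (J (x b c a))) = K (J (K (x b c a)))) ∧
      (J (K (J (x c a b))) = K (J (K (x c a b))) ∧ J (K (J (x c b a))) = K (J (K (x c b a)))) := by
    have h3 := h1.trans h2
    simp only [hJ, hK, map_add, map_smul, h1, h2, h3, h1.not_gt, h2.not_gt, h3.not_gt, h1.ne,
      h2.ne, h3.ne, h1.ne', h2.ne', h3.ne', if_true, if_false]
    rcases sgn_eq (F := F) a b with e1 | e1 <;> rcases sgn_eq (F := F) a c with e2 | e2 <;>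
    rcases sgn_eq (F := F) b c with e3 | e3 <;> rw [e1, e2, e3] <;>
    refine ⟨⟨?_, ?_⟩, ⟨?_, ?_⟩, ?_, ?_⟩ <;> module
  have key2 (a b : Fin (m + n)) (h1 : a < b) :
      (J (K (J (x a a b))) = K (J (K (x a a b))) ∧ J (K (J (x a b a))) = K (J (K (x a b a)))) ∧
      (J (K (J (x b a a))) = K (J (K (x b a a))) ∧ J (K (J (x a b b))) = K (J (K (x a b b)))) ∧
      (J (K (J (x b a b))) = K (J (K (x b a b))) ∧ J (K (J (x b b a))) = K (J (K (x b b a)))) := by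
    simp only [hJ, hK, map_add, map_smul, h1, h1.not_gt, h1.ne, h1.ne', lt_irrefl, if_true,
      if_false]
    rcases sgn_eq (F := F) a b with e1 | e1 <;> rcases diagCoef_eq q a with e2 | e2 <;>
    rcases diagCoef_eq q b with e3 | e3 <;> rw [e1, e2, e3] <;>
    refine ⟨⟨?_, ?_⟩, ⟨?_, ?_⟩, ?_, ?_⟩ <;> match_scalars <;> field_simp <;> ring
  rcases lt_trichotomy a b with h1 | h1 | h1 <;> rcases lt_trichotomy b c with h2 | h2 | h2 <;>
  rcases lt_trichotomy a c with h3 | h3 | h3 <;>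
  first
    | (exfalso; order)
    | skip
  · exact (key a b c h1 h2).1.1
  · subst h2; exact (key2 a b h1).2.1.2
  · exact (key a c b h3 h2).1.2
  · subst h3; exact (key2 a b h1).1.2
  · exact (key c a b h3 h1).2.1.2
  · subst h1; exact (key2 a c h2).1.1
  · subst h1; subst h2; simp [hJ, hK]
  · subst h1; exact (key2 c a h2).2.2.2
  · exact (key b a c h1 h3).2.1.1
  · subst h3; exact (key2 b a h1).2.2.1
  · exact (key b c a h2 h3).2.2.1
  · subst h2; exact (key2 b a h1).2.1.1
  · exact (key c b a h2 h1).2.2.2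

theorem actGen_braid (q : Fˣ) (j k : Fin (r - 1)) (h : j.1 + 1 = k.1) :
    (actGen q j * actGen q k * actGen q j : Module.End F (TensorSpace F m n r)) =
      actGen q k * actGen q j * actGen q k := by
  have hp : posR j = posL k := Fin.ext h
  have h01 : posL j ≠ posL k := by simp [posL, Fin.ext_iff]; omega
  have h02 : posL j ≠ posR k := by simp [posL, posR, Fin.ext_iff]; omega
  have h12 : posL k ≠ posR k := by simp [posL, posR, Fin.ext_iff]
  refine (tensorBasis F m n r).ext fun i => ?_
  let w (a b c : Fin (m + n)) : Fin r → Fin (m + n) :=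
    Function.update (Function.update (Function.update i (posL j) a) (posL k) b) (posR k) c
  have w0 (a b c) : w a b c (posL j) = a := by simp [w, h01, h02]
  have w1 (a b c) : w a b c (posL k) = b := by simp [w, h12]
  have w2 (a b c) : w a b c (posR k) = c := by simp [w]
  have w3 (a b c t) (t0 : t ≠ posL j) (t1 : t ≠ posL k) (t2 : t ≠ posR k) :
      w a b c t = i t := by simp [w, t0, t1, t2]
  have wj (a b c) : w a b c ∘ simpleRefl j = w b a c := by
    funext t
    rw [Function.comp_apply, simpleRefl, hp]
    by_cases t0 : t = posL j
    · rw [t0, Equiv.swap_apply_left, w0, w1]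
    by_cases t1 : t = posL k
    · rw [t1, Equiv.swap_apply_right, w0, w1]
    rw [Equiv.swap_apply_of_ne_of_ne t0 t1]
    by_cases t2 : t = posR k
    · rw [t2, w2, w2]
    rw [w3 _ _ _ _ t0 t1 t2, w3 _ _ _ _ t0 t1 t2]
  have wk (a b c) : w a b c ∘ simpleRefl k = w a c b := by
    funext t
    rw [Function.comp_apply, simpleRefl]
    by_cases t1 : t = posL k
    · rw [t1, Equiv.swap_apply_left, w1, w2]
    by_cases t2 : t = posR k
    · rw [t2, Equiv.swap_apply_right, w1, w2]
    rw [Equiv.swap_apply_of_ne_of_ne t1 t2]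
    by_cases t0 : t = posL j
    · rw [t0, w0, w0]
    rw [w3 _ _ _ _ t0 t1 t2, w3 _ _ _ _ t0 t1 t2]
  have wi : i = w (i (posL j)) (i (posL k)) (i (posR k)) := by simp [w]
  simp only [Module.End.mul_apply]
  rw [wi]
  refine braid_aux (q : F) q.ne_zero (fun a b c => tensorBasis F m n r (w a b c)) (actGen q j)
    (actGen q k) ?_ ?_ ?_ ?_ ?_ ?_ _ _ _
  · intro a b c hab
    rw [actGen_lt q j _ (by rwa [hp, w0, w1]), hp, w0, w1, wj]
  · intro a c
    rw [actGen_eq q j _ (by rw [hp, w0, w1]), w0]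
  · intro a b c hab
    rw [actGen_gt q j _ (by rwa [hp, w0, w1]), hp, w0, w1, wj, sgn_comm]
  · intro a b c hab
    rw [actGen_lt q k _ (by rwa [w2, w1]), w1, w2, wk]
  · intro a b
    rw [actGen_eq q k _ (by rw [w2, w1]), w1]
  · intro a b c hab
    rw [actGen_gt q k _ (by rwa [w2, w1]), w1, w2, wk, sgn_comm]

variable (m n) in
/-- The right action of the Hecke algebra on the tensor space, as an algebra homomorphism into the
opposite of the endomorphism algebra. -/
noncomputable def heckeAction (q : Fˣ) (r : ℕ) :
    Hecke q r →ₐ[F] (Module.End F (TensorSpace F m n r))ᵐᵒᵖ :=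
  RingQuot.liftAlgHom F
    ⟨FreeAlgebra.lift F fun k => MulOpposite.op (actGen q k), by
      intro x y h
      induction h with
      | quad k =>
        simp only [map_mul, map_add, map_one, map_smul, FreeAlgebra.lift_ι_apply]
        rw [← MulOpposite.op_mul, actGen_quad]; rfl
      | comm j k h =>
        simp only [map_mul, FreeAlgebra.lift_ι_apply]
        rw [← MulOpposite.op_mul, ← MulOpposite.op_mul, actGen_comm q j k h]
      | braid j k h =>
        simp only [map_mul, FreeAlgebra.lift_ι_apply]
        simp only [← MulOpposite.op_mul, ← mul_assoc]
        rw [actGen_braid q j k h]⟩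

/-- The operator `v ↦ v h` on the tensor space. -/
noncomputable def rightMul (q : Fˣ) (h : Hecke q r) : Module.End F (TensorSpace F m n r) :=
  (heckeAction m n q r h).unop

variable (m n) in
/-- `End_{ℋ_K}(V^{⊗ r})`: the linear endomorphisms `f` with `(v h) f = (v f) h` for all `h` in the
parabolic subalgebra `ℋ_K`. -/
noncomputable def heckeEnd (q : Fˣ) (K : Subgroup (Equiv.Perm (Fin r))) :
    Submodule F (Module.End F (TensorSpace F m n r)) where
  carrier := {f | ∀ h ∈ heckeSub q K, ∀ v, f (rightMul q h v) = rightMul q h (f v)}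
  zero_mem' h _ v := by simp
  add_mem' {f g} hf hg h hh v := by simp [hf h hh v, hg h hh v]
  smul_mem' c f hf h hh v := by simp [hf h hh v]

open scoped Classical in
/-- The relative norm `N_{G, K}(f) = ∑ T_{w⁻¹} f T_w`, the sum over `w ∈ 𝒟_K ∩ G`, on the bimodule
of linear endomorphisms of the tensor space. Endomorphisms are written on the right in this
bimodule, `v (x f y) = ((v x) f) y`. -/
noncomputable def relNorm (q : Fˣ) (G K : Subgroup (Equiv.Perm (Fin r))) :
    Module.End F (TensorSpace F m n r) →ₗ[F] Module.End F (TensorSpace F m n r) :=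
  ∑ w : Equiv.Perm (Fin r) with w ∈ distinguished K ∧ w ∈ G,
    LinearMap.mulLeft F (rightMul q (heckeT q w)) ∘ₗ
      LinearMap.mulRight F (rightMul q (heckeT q w⁻¹))

/-- The matrix unit `e_{𝐢, 𝐣}`, which maps `v_𝐢` to `v_𝐣` and the other basis vectors to `0`. -/
noncomputable def matUnit (F : Type*) [Field F] {m n r : ℕ} (i j : Fin r → Fin (m + n)) :
    Module.End F (TensorSpace F m n r) :=
  (tensorBasis F m n r).constr F fun i' => if i' = i then tensorBasis F m n r j else 0

end Tensor

/-! ### The ideals attached to `l`-parabolic subgroups -/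

section Ideals

variable {m n r : ℕ}

/-- `Λ(m|n, r)`: the compositions of `r` into `m + n` parts, the first `m` parts being the even ones
and the last `n` parts the odd ones. -/
abbrev SuperComp (m n r : ℕ) : Type := {c : Fin (m + n) → ℕ // ∑ a, c a = r}

namespace SuperComp

/-- The list of parts. -/
def toList (c : SuperComp m n r) : List ℕ := List.ofFn c.1

theorem sum_toList (c : SuperComp m n r) : c.toList.sum = r := by
  rw [toList, List.sum_ofFn, c.2]

/-- The word `𝐢_λ = (1, …, 1, 2, …, 2, …)`, in which the label `a` occurs `λ_a` times. -/
def word (c : SuperComp m n r) (j : Fin r) : Fin (m + n) :=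
  ⟨blockIdx c.toList j.1, by
    have := blockIdx_lt c.toList j.1 (by rw [sum_toList]; exact j.2)
    simpa [toList] using this⟩

/-- The parabolic subgroup `W_λ`. -/
def young (c : SuperComp m n r) : Subgroup (Equiv.Perm (Fin r)) := parabolic r c.toList

/-- The even part `W_{λ⁽⁰⁾}` of `W_λ`: it permutes the positions within the even blocks and fixes
the positions in the odd blocks. -/
def youngEven (c : SuperComp m n r) : Subgroup (Equiv.Perm (Fin r)) :=
  c.young ⊓ fixingSubgroup (Equiv.Perm (Fin r)) {j : Fin r | IsOdd (c.word j)}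

/-- The odd part `W_{λ⁽¹⁾}` of `W_λ`. -/
def youngOdd (c : SuperComp m n r) : Subgroup (Equiv.Perm (Fin r)) :=
  c.young ⊓ fixingSubgroup (Equiv.Perm (Fin r)) {j : Fin r | ¬ IsOdd (c.word j)}

end SuperComp

/-- `𝒟_{λμ} = 𝒟_λ ∩ 𝒟_μ⁻¹`, the distinguished double coset representatives. -/
def doubleDist (a b : SuperComp m n r) : Set (Equiv.Perm (Fin r)) :=
  {d | d ∈ distinguished a.young ∧ d⁻¹ ∈ distinguished b.young}

/-- `𝒟°_{λμ}`, the elements of `𝒟_{λμ}` with the even-odd trivial intersection property. -/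
def doubleDistCirc (a b : SuperComp m n r) : Set (Equiv.Perm (Fin r)) :=
  {d | d ∈ doubleDist a b ∧ conjSub a.youngEven d ⊓ b.youngOdd = ⊥ ∧
    conjSub a.youngOdd d ⊓ b.youngEven = ⊥}

/-- The element `N_{μλ}^d = N_{W, W_ν}(e_{μ, λd})` with `W_ν = W_λ^d ∩ W_μ`. -/
noncomputable def normBasis {F : Type*} [Field F] (q : Fˣ) (b a : SuperComp m n r)
    (d : Equiv.Perm (Fin r)) : Module.End F (TensorSpace F m n r) :=
  relNorm q ⊤ (conjSub a.young d ⊓ b.young) (matUnit F b.word (a.word ∘ d))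

variable (m n) in
/-- `I_F(P, r)`: the span of the `N_{μλ}^d` with `λ, μ ∈ Λ(m|n, r)` and `d ∈ 𝒟°_{λμ}` such that
`P_ν ≤_W P`, where `ν` is the composition of `r` with `W_ν = W_λ^d ∩ W_μ` (it is unique up to
zero parts, which do not affect `P_ν`). -/
noncomputable def normIdeal {F : Type*} [Field F] (q : Fˣ) (l : ℕ)
    (P : Subgroup (Equiv.Perm (Fin r))) : Submodule F (Module.End F (TensorSpace F m n r)) :=
  Submodule.span F {N | ∃ (a b : SuperComp m n r) (d : Equiv.Perm (Fin r)) (c : List ℕ),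
    d ∈ doubleDistCirc a b ∧ c.sum = r ∧ parabolic r c = conjSub a.young d ⊓ b.young ∧
    ConjLE (parabolic r (maxLComp l c)) P ∧ N = normBasis q b a d}

end Ideals

end QSchurSuper

namespace QSchurSuper

/-! ### Inversions, length, and shortest coset representatives of Young subgroups. -/

section Inversions

variable {r : ℕ}

/-! Both inclusions rest on one scalar. Let two words `i`, `j` be constant on the blocks of a Young
subgroup `W_γ` and of equal parity on each block with at least two points. Then `T_u`, `u ∈ W_γ`,
multiplies the matrix unit `e` of `(i, j)` by the same character value on either side. For a Young
subgroup `W_ρ ≤ W_γ`, transitivity of the norm therefore makes `N_{W,W_ρ}(e)` equal to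
`N_{W,W_γ}(e)` times the sum of the squares of this character over the shortest coset
representatives (`Compatible.relNorm_matUnit`).

This sum is a quotient of weighted Poincaré polynomials, evaluated at `q ^ 2`, which is again a
primitive `l`-th root of unity because `l` is odd. Up to a common factor, each polynomial is a
product of terms `X ^ (ε a) - 1`, where `a` runs over the ranks of the positions in their blocks and
`ε` is prime to `l`. In characteristic 0 the multiplicity of the root is the number of ranks
divisible by `l`, that is, the sum of `⌊a / l⌋` over the parts `a`. The scalar is nonzero exactly
when these counts agree (`sum_incrOn_ne_zero_iff`).

For the inclusion of the ideal in the image of the norm, compare `W_ν` with `P_ν`. The counts agree,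
so `N_{μλ}^d` is a nonzero multiple of a norm from `P_ν`. A conjugate of `P_ν` lies in `W_θ`, norms
from conjugate parabolic subgroups agree (`relNorm_conj`), and transitivity turns the result into a
norm from `W_θ` (`normBasis_mem`).

Conversely, an endomorphism commuting with the Hecke algebra is determined by its matrix
coefficients at sorted pairs of words, and the elements `N_{μλ}^d` are dual to these coefficients
(`form_relNorm_matUnit`). A coefficient of a norm from `W_θ` splits, over the right cosets of the
stabilizer `W_γ` of the pair, into multiples of the above scalar for `W_γ` and its intersection with
a conjugate of `W_θ`. If it is nonzero, the count of `γ` equals that of some such intersection,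
which is at most `k` when `l > 1` (`fullCount_le_of_coefficient_ne_zero`). Then the maximal
`l`-parabolic subgroup of `W_γ` is conjugate into `W_θ`. For `l = 1` that subgroup is trivial. -/

theorem posL_lt_posR (k : Fin (r - 1)) : posL k < posR k := by
  simp [posL, posR, Fin.lt_def]

theorem exists_pos {a b : Fin r} (h : b.1 = a.1 + 1) : ∃ k, posL k = a ∧ posR k = b :=
  ⟨⟨a.1, by omega⟩, Fin.ext rfl, Fin.ext h.symm⟩

theorem simpleRefl_of_ne {k : Fin (r - 1)} {a : Fin r} (h1 : a ≠ posL k) (h2 : a ≠ posR k) :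
    simpleRefl k a = a :=
  Equiv.swap_apply_of_ne_of_ne h1 h2

theorem simpleRefl_simpleRefl (k : Fin (r - 1)) (a : Fin r) :
    simpleRefl k (simpleRefl k a) = a := by
  simp [simpleRefl]

theorem simpleRefl_mul_self (k : Fin (r - 1)) : simpleRefl k * simpleRefl k = 1 :=
  Equiv.swap_mul_self _ _

theorem mul_simpleRefl_mul_simpleRefl (w : Equiv.Perm (Fin r)) (k : Fin (r - 1)) :
    w * simpleRefl k * simpleRefl k = w := by
  rw [mul_assoc, simpleRefl_mul_self, mul_one]

theorem simpleRefl_inv (k : Fin (r - 1)) : (simpleRefl k)⁻¹ = simpleRefl k :=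
  Equiv.swap_inv _ _

theorem simpleRefl_lt {k : Fin (r - 1)} {a b : Fin r} (hab : a < b)
    (h : ¬ (a = posL k ∧ b = posR k)) : simpleRefl k a < simpleRefl k b := by
  have key (c : Fin r) : (simpleRefl k c).1 =
      if c.1 = k.1 then k.1 + 1 else if c.1 = k.1 + 1 then k.1 else c.1 := by
    split_ifs with h1 h2
    · rw [show c = posL k from Fin.ext h1, simpleRefl_posL]; rfl
    · rw [show c = posR k from Fin.ext h2, simpleRefl_posR]; rfl
    · rw [simpleRefl_of_ne (fun h => h1 (congrArg Fin.val h)) (fun h => h2 (congrArg Fin.val h))]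
  have h' : ¬ (a.1 = k.1 ∧ b.1 = k.1 + 1) := fun h3 => h ⟨Fin.ext h3.1, Fin.ext h3.2⟩
  rw [Fin.lt_def] at hab ⊢
  rw [key, key]
  split_ifs <;> omega

/-- The inversions of a permutation. -/
def inversions (w : Equiv.Perm (Fin r)) : Finset (Fin r × Fin r) :=
  Finset.univ.filter fun p => p.1 < p.2 ∧ w p.2 < w p.1

/-- The number of inversions of a permutation. -/
def ninv (w : Equiv.Perm (Fin r)) : ℕ := (inversions w).card

/-- The product of the weights of the inversions of a permutation. -/
def invProd {M : Type*} [CommMonoid M] (e : Fin r → M) (w : Equiv.Perm (Fin r)) : M :=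
  ∏ p ∈ inversions w, e p.1

theorem mem_inversions {w : Equiv.Perm (Fin r)} {p : Fin r × Fin r} :
    p ∈ inversions w ↔ p.1 < p.2 ∧ w p.2 < w p.1 := by
  simp [inversions]

/-- A basic transposition keeps the order of every pair of positions but the one it swaps, and that
pair becomes the only new inversion. -/
theorem inversions_mul_simpleRefl {w : Equiv.Perm (Fin r)} {k : Fin (r - 1)}
    (h : w (posL k) < w (posR k)) :
    inversions (w * simpleRefl k) = insert (posL k, posR k)
      ((inversions w).map ((simpleRefl k).prodCongr (simpleRefl k)).toEmbedding) := by
  ext ⟨a, b⟩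
  simp only [Finset.mem_insert, Finset.mem_map_equiv, mem_inversions, Prod.mk.injEq,
    Equiv.Perm.mul_apply]
  change _ ↔ _ ∨ (simpleRefl k)⁻¹ a < (simpleRefl k)⁻¹ b ∧
    w ((simpleRefl k)⁻¹ b) < w ((simpleRefl k)⁻¹ a)
  rw [simpleRefl_inv]
  constructor
  · rintro ⟨h1, h2⟩
    by_cases h3 : a = posL k ∧ b = posR k
    · exact Or.inl h3
    · exact Or.inr ⟨simpleRefl_lt h1 h3, h2⟩
  · rintro (⟨rfl, rfl⟩ | ⟨h1, h2⟩)
    · exact ⟨posL_lt_posR k, by rwa [simpleRefl_posL, simpleRefl_posR]⟩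
    · refine ⟨?_, h2⟩
      by_cases h3 : simpleRefl k a = posL k ∧ simpleRefl k b = posR k
      · rw [h3.1, h3.2] at h2
        exact absurd h2 h.not_gt
      · simpa [simpleRefl_simpleRefl] using simpleRefl_lt h1 h3

theorem notMem_map_inversions (w : Equiv.Perm (Fin r)) (k : Fin (r - 1)) :
    (posL k, posR k) ∉
      (inversions w).map ((simpleRefl k).prodCongr (simpleRefl k)).toEmbedding := by
  simp only [Finset.mem_map_equiv, mem_inversions]
  change ¬ ((simpleRefl k)⁻¹ (posL k) < (simpleRefl k)⁻¹ (posR k) ∧ _)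
  rw [simpleRefl_inv, simpleRefl_posL, simpleRefl_posR]
  exact fun h => h.1.not_gt (posL_lt_posR k)

theorem ninv_mul_simpleRefl {w : Equiv.Perm (Fin r)} {k : Fin (r - 1)}
    (h : w (posL k) < w (posR k)) : ninv (w * simpleRefl k) = ninv w + 1 := by
  rw [ninv, inversions_mul_simpleRefl h, Finset.card_insert_of_notMem (notMem_map_inversions w k),
    Finset.card_map, ninv]

theorem invProd_mul_simpleRefl {M : Type*} [CommMonoid M] {e : Fin r → M}
    {w : Equiv.Perm (Fin r)} {k : Fin (r - 1)} (h : w (posL k) < w (posR k))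
    (he : e (posL k) = e (posR k)) :
    invProd e (w * simpleRefl k) = invProd e w * e (posL k) := by
  rw [invProd, inversions_mul_simpleRefl h, Finset.prod_insert (notMem_map_inversions w k),
    Finset.prod_map, invProd, mul_comm]
  congr 1
  refine Finset.prod_congr rfl fun p _ => ?_
  change e (simpleRefl k p.1) = e p.1
  by_cases h1 : p.1 = posL k
  · rw [h1, simpleRefl_posL, he]
  by_cases h2 : p.1 = posR k
  · rw [h2, simpleRefl_posR, he]
  rw [simpleRefl_of_ne h1 h2]

theorem ninv_of_gt {w : Equiv.Perm (Fin r)} {k : Fin (r - 1)}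
    (h : w (posR k) < w (posL k)) : ninv w = ninv (w * simpleRefl k) + 1 := by
  rw [← ninv_mul_simpleRefl, mul_simpleRefl_mul_simpleRefl]
  simpa [simpleRefl_posL, simpleRefl_posR] using h

theorem apply_lt_or_gt (w : Equiv.Perm (Fin r)) (k : Fin (r - 1)) :
    w (posL k) < w (posR k) ∨ w (posR k) < w (posL k) :=
  lt_or_gt_of_ne fun h => (posL_lt_posR k).ne (w.injective h)

theorem inversions_one : inversions (1 : Equiv.Perm (Fin r)) = ∅ := by
  ext p
  simp only [mem_inversions, Equiv.Perm.one_apply, Finset.notMem_empty, iff_false]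
  exact fun h => h.1.not_gt h.2

theorem ninv_one : ninv (1 : Equiv.Perm (Fin r)) = 0 := by
  rw [ninv, inversions_one, Finset.card_empty]

theorem invProd_one {M : Type*} [CommMonoid M] (e : Fin r → M) : invProd e 1 = 1 := by
  rw [invProd, inversions_one, Finset.prod_empty]

theorem ninv_inv (w : Equiv.Perm (Fin r)) : ninv w⁻¹ = ninv w := by
  refine Finset.card_bij' (fun p _ => (w⁻¹ p.2, w⁻¹ p.1)) (fun p _ => (w p.2, w p.1)) ?_ ?_ ?_ ?_
  · intro p hp
    rw [mem_inversions] at hp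
    simpa [mem_inversions] using hp.symm
  · intro p hp
    rw [mem_inversions] at hp
    simpa [mem_inversions] using hp.symm
  · simp
  · simp

theorem ninv_mul_simpleRefl_le (w : Equiv.Perm (Fin r)) (k : Fin (r - 1)) :
    ninv (w * simpleRefl k) ≤ ninv w + 1 := by
  rcases apply_lt_or_gt w k with h | h
  · rw [ninv_mul_simpleRefl h]
  · have := ninv_of_gt h
    omega

/-! ### Classes of a monotone function -/

variable {α : Type*}

/-- The stabilizer of a labelling of the positions. -/
def stab (β : Fin r → α) : Subgroup (Equiv.Perm (Fin r)) where
  carrier := {w | ∀ j, β (w j) = β j}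
  one_mem' _ := rfl
  mul_mem' {a b} ha hb j := by rw [Equiv.Perm.mul_apply, ha, hb]
  inv_mem' {a} ha j := by
    have := ha (a⁻¹ j)
    simpa using this.symm

theorem mem_stab {β : Fin r → α} {w : Equiv.Perm (Fin r)} : w ∈ stab β ↔ ∀ j, β (w j) = β j :=
  Iff.rfl

theorem swap_mem_stab {β : Fin r → α} {a b : Fin r} (h : β a = β b) :
    Equiv.swap a b ∈ stab β := by
  intro j
  by_cases h1 : j = a
  · rw [h1, Equiv.swap_apply_left, h]
  by_cases h2 : j = b
  · rw [h2, Equiv.swap_apply_right, h]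
  rw [Equiv.swap_apply_of_ne_of_ne h1 h2]

theorem simpleRefl_mem_stab {β : Fin r → α} {k : Fin (r - 1)} :
    simpleRefl k ∈ stab β ↔ β (posL k) = β (posR k) := by
  refine ⟨fun h => ?_, fun h => swap_mem_stab h⟩
  have := h (posL k)
  rw [simpleRefl_posL] at this
  exact this.symm

theorem stab_le_stab_iff {γ : Type*} {β : Fin r → α} {β' : Fin r → γ} :
    stab β ≤ stab β' ↔ ∀ a b, β a = β b → β' a = β' b := by
  refine ⟨fun h a b hab => ?_, fun h w hw j => h _ _ (hw j)⟩
  have := h (swap_mem_stab hab) a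
  rw [Equiv.swap_apply_left] at this
  exact this.symm

/-- The permutations that are increasing on the classes of a labelling. -/
def IncrOn (β : Fin r → α) (w : Equiv.Perm (Fin r)) : Prop :=
  ∀ a b, a < b → β a = β b → w a < w b

theorem incrOn_one {β : Fin r → α} : IncrOn β (1 : Equiv.Perm (Fin r)) := fun _ _ h _ => h

variable [LinearOrder α] {β : Fin r → α}

theorem incrOn_of_simple (hβ : Monotone β) {w : Equiv.Perm (Fin r)}
    (h : ∀ k, β (posL k) = β (posR k) → w (posL k) < w (posR k)) : IncrOn β w := by
  intro a b hab hβab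
  obtain ⟨n, hn⟩ : ∃ n, b.1 = a.1 + 1 + n := ⟨b.1 - a.1 - 1, by
    have : a.1 < b.1 := hab
    omega⟩
  induction n generalizing b with
  | zero =>
    obtain ⟨k, rfl, rfl⟩ := exists_pos (a := a) (b := b) (by omega)
    exact h k hβab
  | succ n ih =>
    obtain ⟨k, hk1, hk2⟩ := exists_pos (a := ⟨a.1 + 1 + n, by omega⟩) (b := b) (by simp; omega)
    have h1 : a < posL k := by rw [hk1, Fin.lt_def]; simp; omega
    have h2 : posL k < posR k := posL_lt_posR k
    have h3 : β a = β (posL k) :=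
      le_antisymm (hβ h1.le) (by rw [hβab, ← hk2]; exact hβ h2.le)
    have := ih (posL k) h1 h3 (by rw [hk1])
    rw [← hk2] at hβab ⊢
    exact this.trans (h k (h3.symm.trans hβab))

theorem eq_one_of_forall_lt {w : Equiv.Perm (Fin r)}
    (h : ∀ k, w (posL k) < w (posR k)) : w = 1 := by
  have h1 : StrictMono w := fun a b hab =>
    incrOn_of_simple (β := fun _ => ()) (fun _ _ _ => le_rfl) (fun k _ => h k) a b hab rfl
  have h2 : h1.orderIsoOfSurjective w w.surjective = OrderIso.refl _ := Subsingleton.elim _ _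
  exact Equiv.ext fun a => DFunLike.congr_fun h2 a

/-- Between neighbours in different blocks `u` keeps the order, because it preserves the blocks and
these are intervals. So a descent must occur inside a block. -/
theorem exists_descent (hβ : Monotone β) {u : Equiv.Perm (Fin r)} (hu : u ∈ stab β)
    (h1 : u ≠ 1) : ∃ k, β (posL k) = β (posR k) ∧ u (posR k) < u (posL k) := by
  by_contra! h
  refine h1 (eq_one_of_forall_lt fun k => ?_)
  rcases (hβ (posL_lt_posR k).le).eq_or_lt with h2 | h2
  · exact (apply_lt_or_gt u k).resolve_right (h k h2).not_gt
  · rw [← hu (posL k), ← hu (posR k)] at h2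
    exact lt_of_not_ge fun h3 => (hβ h3).not_gt h2

/-- Removing descents one at a time never leaves the Young subgroup. This is the substitute for
reduced words in the generators of a parabolic subgroup. -/
theorem stab_induction (hβ : Monotone β) {P : Equiv.Perm (Fin r) → Prop} (h1 : P 1)
    (hs : ∀ u ∈ stab β, ∀ k, β (posL k) = β (posR k) → u (posL k) < u (posR k) → P u →
      P (u * simpleRefl k)) {u : Equiv.Perm (Fin r)} (hu : u ∈ stab β) : P u := by
  induction hn : ninv u using Nat.strong_induction_on generalizing u with
  | _ n ih =>
    by_cases hu1 : u = 1
    · rwa [hu1]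
    obtain ⟨k, hk, hd⟩ := exists_descent hβ hu hu1
    have hmem := mul_mem hu (simpleRefl_mem_stab.2 hk)
    have := hs _ hmem k hk (by simpa [simpleRefl_posL, simpleRefl_posR] using hd)
      (ih _ (by have := ninv_of_gt hd; omega) hmem rfl)
    rwa [mul_simpleRefl_mul_simpleRefl] at this

theorem perm_induction {P : Equiv.Perm (Fin r) → Prop} (h1 : P 1)
    (hs : ∀ u k, u (posL k) < u (posR k) → P u → P (u * simpleRefl k))
    (u : Equiv.Perm (Fin r)) : P u :=
  stab_induction (β := fun _ => ()) (fun _ _ _ => le_rfl) h1 (fun u _ k _ => hs u k)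
    (fun _ => rfl)

theorem ninv_wordProd_le (ω : List (Fin (r - 1))) : ninv (wordProd ω) ≤ ω.length := by
  induction ω using List.reverseRecOn with
  | nil => simp [wordProd, ninv_one]
  | append_singleton ω k ih =>
    have : wordProd (ω ++ [k]) = wordProd ω * simpleRefl k := by simp [wordProd]
    rw [this, List.length_append, List.length_singleton]
    exact (ninv_mul_simpleRefl_le _ _).trans (by omega)

theorem exists_word_length (w : Equiv.Perm (Fin r)) :
    ∃ ω : List (Fin (r - 1)), wordProd ω = w ∧ ω.length = ninv w := by
  induction w using perm_induction with
  | h1 => exact ⟨[], rfl, by simp [ninv_one]⟩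
  | hs u k h ih =>
    obtain ⟨ω, rfl, hω⟩ := ih
    exact ⟨ω ++ [k], by simp [wordProd], by simp [hω, ninv_mul_simpleRefl h]⟩

theorem len_eq_ninv (w : Equiv.Perm (Fin r)) : len w = ninv w := by
  apply le_antisymm
  · exact Nat.sInf_le (exists_word_length w)
  · obtain ⟨ω, rfl, hω⟩ := exists_reduced_word w
    rw [← hω]
    exact ninv_wordProd_le ω

theorem ninv_mul_le (u w : Equiv.Perm (Fin r)) : ninv (u * w) ≤ ninv u + ninv w := by
  induction w using perm_induction with
  | h1 => simp
  | hs w k h ih =>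
    rw [← mul_assoc, ninv_mul_simpleRefl h]
    exact (ninv_mul_simpleRefl_le _ _).trans (by omega)

/-- Every letter that lengthens `u` also lengthens `d * u`, since `d` is increasing on the blocks in
which `u` moves points. -/
theorem invProd_mul {M : Type*} [CommMonoid M] {e : Fin r → M} (hβ : Monotone β)
    (he : ∀ a b, β a = β b → e a = e b) {d u : Equiv.Perm (Fin r)} (hd : IncrOn β d)
    (hu : u ∈ stab β) : invProd e (d * u) = invProd e d * invProd e u := by
  refine stab_induction (P := fun u => invProd e (d * u) = invProd e d * invProd e u) hβ
    (by simp [invProd_one]) (fun u hu k hk h ih => ?_) hu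
  have h2 : (d * u) (posL k) < (d * u) (posR k) := hd _ _ h (by rw [hu, hu, hk])
  rw [← mul_assoc, invProd_mul_simpleRefl h2 (he _ _ hk), ih,
    invProd_mul_simpleRefl h (he _ _ hk), mul_assoc]

theorem ninv_mul (hβ : Monotone β) {d u : Equiv.Perm (Fin r)} (hd : IncrOn β d)
    (hu : u ∈ stab β) : ninv (d * u) = ninv d + ninv u := by
  refine stab_induction (P := fun u => ninv (d * u) = ninv d + ninv u) hβ
    (by simp [ninv_one]) (fun u hu k hk h ih => ?_) hu
  have h2 : (d * u) (posL k) < (d * u) (posR k) := hd _ _ h (by rw [hu, hu, hk])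
  rw [← mul_assoc, ninv_mul_simpleRefl h2, ih, ninv_mul_simpleRefl h, add_assoc]

theorem ninv_mul' (hβ : Monotone β) {d u : Equiv.Perm (Fin r)} (hd : IncrOn β d⁻¹)
    (hu : u ∈ stab β) : ninv (u * d) = ninv u + ninv d := by
  rw [← ninv_inv, mul_inv_rev, ninv_mul hβ hd (inv_mem hu), ninv_inv, ninv_inv, add_comm]

/-- A descent of `d⁻¹` inside a block would shorten the coset representative. Without one, lengths
add along the coset. From here on minimality is replaced by monotonicity on blocks. -/
theorem mem_distinguished_stab (hβ : Monotone β) {d : Equiv.Perm (Fin r)} :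
    d ∈ distinguished (stab β) ↔ IncrOn β d⁻¹ := by
  constructor
  · intro h
    refine incrOn_of_simple hβ fun k hk => (apply_lt_or_gt _ k).resolve_right fun h2 => ?_
    have h3 := h _ (simpleRefl_mem_stab.2 hk)
    rw [len_eq_ninv, len_eq_ninv, ← ninv_inv d, ← ninv_inv (_ * d), mul_inv_rev, simpleRefl_inv,
      ninv_of_gt h2] at h3
    omega
  · intro h w hw
    rw [len_eq_ninv, len_eq_ninv, ninv_mul' hβ h hw]
    omega

theorem eq_one_of_incrOn (hβ : Monotone β) {u : Equiv.Perm (Fin r)} (hu : u ∈ stab β)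
    (h : IncrOn β u) : u = 1 := by
  by_contra h1
  obtain ⟨k, hk, hd⟩ := exists_descent hβ hu h1
  exact hd.not_gt (h _ _ (posL_lt_posR k) hk)

theorem exists_incrOn_mul (hβ : Monotone β) (w : Equiv.Perm (Fin r)) :
    ∃ d, IncrOn β d ∧ ∃ u ∈ stab β, d * u = w := by
  induction hn : ninv w using Nat.strong_induction_on generalizing w with
  | _ n ih =>
    by_cases h : IncrOn β w
    · exact ⟨w, h, 1, one_mem _, mul_one _⟩
    obtain ⟨k, hk, hd⟩ : ∃ k, β (posL k) = β (posR k) ∧ w (posR k) < w (posL k) := by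
      by_contra! h2
      exact h (incrOn_of_simple hβ fun k hk => (apply_lt_or_gt w k).resolve_right (h2 k hk).not_gt)
    obtain ⟨d, hd1, u, hu, he⟩ := ih _ (by have := ninv_of_gt hd; omega) (w * simpleRefl k) rfl
    exact ⟨d, hd1, u * simpleRefl k, mul_mem hu (simpleRefl_mem_stab.2 hk), by
      rw [← mul_assoc, he, mul_simpleRefl_mul_simpleRefl]⟩

theorem incrOn_mul_inj (hβ : Monotone β) {d d' u u' : Equiv.Perm (Fin r)} (hd : IncrOn β d)
    (hd' : IncrOn β d') (hu : u ∈ stab β) (hu' : u' ∈ stab β) (h : d * u = d' * u') :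
    d = d' ∧ u = u' := by
  have h1 : u * u'⁻¹ = 1 := by
    have hm : u * u'⁻¹ ∈ stab β := mul_mem hu (inv_mem hu')
    by_contra h1
    obtain ⟨k, hk, hlt⟩ := exists_descent hβ hm h1
    have h2 := hd _ _ hlt (by rw [hm, hm, hk])
    have h3 : d * (u * u'⁻¹) = d' := by rw [← mul_assoc, h, mul_inv_cancel_right]
    rw [← Equiv.Perm.mul_apply, ← Equiv.Perm.mul_apply, h3] at h2
    exact h2.not_gt (hd' _ _ (posL_lt_posR k) hk)
  rw [mul_inv_eq_one] at h1
  subst h1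
  exact ⟨mul_right_cancel h, rfl⟩

open scoped Classical in
theorem sum_incrOn_mul {M : Type*} [AddCommMonoid M] (hβ : Monotone β)
    {G : Subgroup (Equiv.Perm (Fin r))} (hG : stab β ≤ G) (f : Equiv.Perm (Fin r) → M) :
    ∑ w with w ∈ G, f w =
      ∑ d with IncrOn β d ∧ d ∈ G, ∑ u with u ∈ stab β, f (d * u) := by
  rw [← Finset.sum_product']
  symm
  refine Finset.sum_bij (fun p _ => p.1 * p.2) ?_ ?_ ?_ ?_
  · intro p hp
    simp only [Finset.mem_product, Finset.mem_filter_univ] at hp ⊢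
    exact mul_mem hp.1.2 (hG hp.2)
  · intro p hp p' hp' h
    simp only [Finset.mem_product, Finset.mem_filter_univ] at hp hp'
    have := incrOn_mul_inj hβ hp.1.1 hp'.1.1 hp.2 hp'.2 h
    exact Prod.ext this.1 this.2
  · intro w hw
    simp only [Finset.mem_filter_univ] at hw
    obtain ⟨d, hd, u, hu, rfl⟩ := exists_incrOn_mul hβ w
    refine ⟨(d, u), ?_, rfl⟩
    simp only [Finset.mem_product, Finset.mem_filter_univ]
    exact ⟨⟨hd, (mul_mem_cancel_right (hG hu)).1 hw⟩, hu⟩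
  · intros; rfl

theorem sum_mem_inv {M : Type*} [AddCommMonoid M] (p : Equiv.Perm (Fin r) → Prop)
    [DecidablePred p] [DecidablePred fun w => p w⁻¹] (f : Equiv.Perm (Fin r) → M) : ∑ w with p w, f w = ∑ w with p w⁻¹, f w⁻¹ := by
  refine Finset.sum_bij' (fun w _ => w⁻¹) (fun w _ => w⁻¹) ?_ ?_ ?_ ?_ ?_ <;> simp

open scoped Classical in
theorem sum_mul_distinguished {M : Type*} [AddCommMonoid M] (hβ : Monotone β)
    {G : Subgroup (Equiv.Perm (Fin r))} (hG : stab β ≤ G) (f : Equiv.Perm (Fin r) → M) :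
    ∑ w with w ∈ G, f w =
      ∑ d with d ∈ distinguished (stab β) ∧ d ∈ G, ∑ u with u ∈ stab β, f (u * d) := by
  rw [sum_mem_inv (· ∈ G), sum_mem_inv (fun d => d ∈ distinguished (stab β) ∧ d ∈ G)]
  simp only [mem_distinguished_stab hβ, inv_inv, inv_mem_iff]
  rw [sum_incrOn_mul hβ hG]
  refine Finset.sum_congr rfl fun d _ => ?_
  rw [sum_mem_inv]
  simp

/-- The inverse of `u * d` applies `d⁻¹` after `u⁻¹`, and `d⁻¹` is increasing on each class of `β`,
so it neither creates nor destroys a descent inside a class of `ρ`. -/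
theorem mul_mem_distinguished_iff {α' : Type*} [LinearOrder α'] {ρ : Fin r → α'}
    (hβ : Monotone β) (hρ : Monotone ρ) (h : stab ρ ≤ stab β) {u d : Equiv.Perm (Fin r)}
    (hu : u ∈ stab β) (hd : d ∈ distinguished (stab β)) :
    u * d ∈ distinguished (stab ρ) ↔ u ∈ distinguished (stab ρ) := by
  rw [mem_distinguished_stab hρ, mem_distinguished_stab hρ, mul_inv_rev]
  rw [mem_distinguished_stab hβ] at hd
  have h1 := stab_le_stab_iff.1 h
  refine forall₄_congr fun a b hab hρab => ?_
  have h2 : β (u⁻¹ a) = β (u⁻¹ b) := by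
    rw [mem_stab.1 (inv_mem hu), mem_stab.1 (inv_mem hu), h1 _ _ hρab]
  rw [Equiv.Perm.mul_apply, Equiv.Perm.mul_apply]
  refine ⟨fun h3 => ?_, fun h3 => hd _ _ h3 h2⟩
  by_contra h4
  rcases (not_lt.1 h4).eq_or_lt with h5 | h5
  · rw [h5] at h3; exact h3.false
  · exact h3.not_gt (hd _ _ h5 h2.symm)

open scoped Classical in
theorem sum_distinguished_trans {M : Type*} [AddCommMonoid M] {α' : Type*} [LinearOrder α']
    {ρ : Fin r → α'} (hβ : Monotone β) (hρ : Monotone ρ) (h : stab ρ ≤ stab β)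
    (f : Equiv.Perm (Fin r) → M) :
    ∑ w with w ∈ distinguished (stab ρ) ∧ w ∈ (⊤ : Subgroup (Equiv.Perm (Fin r))), f w =
      ∑ d with d ∈ distinguished (stab β) ∧ d ∈ (⊤ : Subgroup (Equiv.Perm (Fin r))),
        ∑ u with u ∈ distinguished (stab ρ) ∧ u ∈ stab β, f (u * d) := by
  have h1 := sum_mul_distinguished hβ (G := ⊤) le_top
    (fun w => if w ∈ distinguished (stab ρ) then f w else 0)
  rw [← Finset.sum_filter, Finset.filter_filter] at h1
  simp only [and_comm (b := _ ∈ distinguished (stab ρ))] at h1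
  rw [h1]
  refine Finset.sum_congr rfl fun d hd => ?_
  rw [← Finset.sum_filter, Finset.filter_filter]
  simp only [Finset.mem_filter_univ] at hd
  refine Finset.sum_congr ?_ fun _ _ => rfl
  ext u
  simp only [Finset.mem_filter_univ]
  constructor
  · rintro ⟨hu, h2⟩
    exact ⟨(mul_mem_distinguished_iff hβ hρ h hu hd.1).1 h2, hu⟩
  · rintro ⟨h2, hu⟩
    exact ⟨hu, (mul_mem_distinguished_iff hβ hρ h hu hd.1).2 h2⟩

end Inversions

/-! ### Weighted Poincaré polynomials of Young subgroups. -/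

section Poincare

variable {r : ℕ} {α : Type*} [LinearOrder α] {β : Fin r → α}

/-- The rank of a position within its class. -/
def rank (β : Fin r → α) (p : Fin r) : ℕ := (Finset.univ.filter fun i => i ≤ p ∧ β i = β p).card

theorem eq_range_of_lower {S : Finset ℕ} (h : ∀ a ∈ S, ∀ b ≤ a, b ∈ S) :
    S = Finset.range S.card := by
  refine Finset.eq_of_subset_of_card_le (fun a ha => ?_) (by simp)
  have : Finset.range (a + 1) ⊆ S := fun b hb => h a ha b (by simpa [Nat.lt_succ_iff] using hb)
  have := Finset.card_le_card this
  rw [Finset.card_range] at this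
  simpa using this

/-- The members of the class up to `p` form an interval ending at `p`, so their distances to `p` are
exactly the numbers below the rank. -/
theorem sum_class {M : Type*} [CommSemiring M] (hβ : Monotone β) (p : Fin r) (x : M) :
    ∑ i with i ≤ p ∧ β i = β p, x ^ (p.1 - i.1) = ∑ n ∈ Finset.range (rank β p), x ^ n := by
  have hinj : Set.InjOn (fun i : Fin r => p.1 - i.1)
      (Finset.univ.filter fun i => i ≤ p ∧ β i = β p : Finset (Fin r)) := by
    intro i hi i' hi' h
    simp only [Finset.coe_filter, Finset.mem_univ, true_and, Set.mem_ofPred_eq, Fin.le_def] at hi hi'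
    dsimp only at h
    exact Fin.ext (by omega)
  rw [rank, ← Finset.card_image_of_injOn hinj, ← eq_range_of_lower, Finset.sum_image hinj]
  intro a ha b hb
  simp only [Finset.mem_image, Finset.mem_filter_univ] at ha ⊢
  obtain ⟨i, ⟨hi, hβi⟩, rfl⟩ := ha
  have hi' := Fin.le_def.1 hi
  refine ⟨⟨p.1 - b, by omega⟩, ⟨Fin.le_def.2 (by simp), le_antisymm (hβ (Fin.le_def.2 (by simp))) ?_⟩,
    by simp; omega⟩
  rw [← hβi]
  exact hβ (Fin.le_def.2 (by simp; omega))

open scoped Classical in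
-- Here `t` is the largest point that may move, and `i` is its preimage. Moving this preimage one
-- place to the right removes exactly one inversion, of weight `e t`. After `n` moves `t` is fixed.
theorem sum_stab_step {M : Type*} [CommSemiring M] (hβ : Monotone β) {e : Fin r → M}
    (he : ∀ a b, β a = β b → e a = e b) (t : Fin r) (n : ℕ) (i : Fin r) (hi : i.1 + n = t.1)
    (hβi : β i = β t) :
    ∑ w with (w ∈ stab β ∧ ∀ p, t < p → w p = p) ∧ w i = t, invProd e w =
      e t ^ n * ∑ w with w ∈ stab β ∧ ∀ p, t ≤ p → w p = p, invProd e w := by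
  induction n generalizing i with
  | zero =>
    obtain rfl : i = t := Fin.ext hi
    rw [pow_zero, one_mul]
    refine Finset.sum_congr ?_ fun _ _ => rfl
    ext w
    simp only [Finset.mem_filter_univ]
    constructor
    · rintro ⟨⟨h1, h2⟩, h3⟩
      refine ⟨h1, fun p hp => ?_⟩
      rcases hp.eq_or_lt with rfl | hp
      · exact h3
      · exact h2 p hp
    · rintro ⟨h1, h2⟩
      exact ⟨⟨h1, fun p hp => h2 p hp.le⟩, h2 i le_rfl⟩
  | succ n ih =>
    obtain ⟨k, hk1, hk2⟩ := exists_pos (a := i) (b := ⟨i.1 + 1, by omega⟩) rfl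
    subst hk1
    have hle : posR k ≤ t := by rw [hk2, Fin.le_def]; simp; omega
    have hk : β (posL k) = β (posR k) :=
      le_antisymm (hβ (posL_lt_posR k).le) (hβi ▸ hβ hle)
    have hlt : posL k < t := lt_of_lt_of_le (posL_lt_posR k) hle
    rw [pow_succ', mul_assoc, ← ih (posR k) (by rw [hk2]; simp; omega) (hk.symm.trans hβi),
      Finset.mul_sum]
    have hfix (p : Fin r) (hp : t < p) : simpleRefl k p = p :=
      simpleRefl_of_ne (hlt.trans hp).ne' (hle.trans_lt hp).ne'
    refine Finset.sum_bij' (fun w _ => w * simpleRefl k) (fun w _ => w * simpleRefl k)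
      ?_ ?_ ?_ ?_ ?_
    · intro w hw
      simp only [Finset.mem_filter_univ] at hw ⊢
      refine ⟨⟨mul_mem hw.1.1 (simpleRefl_mem_stab.2 hk), fun p hp => ?_⟩, ?_⟩
      · rw [Equiv.Perm.mul_apply, hfix p hp, hw.1.2 p hp]
      · rw [Equiv.Perm.mul_apply, simpleRefl_posR, hw.2]
    · intro w hw
      simp only [Finset.mem_filter_univ] at hw ⊢
      refine ⟨⟨mul_mem hw.1.1 (simpleRefl_mem_stab.2 hk), fun p hp => ?_⟩, ?_⟩
      · rw [Equiv.Perm.mul_apply, hfix p hp, hw.1.2 p hp]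
      · rw [Equiv.Perm.mul_apply, simpleRefl_posL, hw.2]
    · intro w _; exact mul_simpleRefl_mul_simpleRefl w k
    · intro w _; exact mul_simpleRefl_mul_simpleRefl w k
    · intro w hw
      simp only [Finset.mem_filter_univ] at hw
      have h1 : w (posR k) < w (posL k) := by
        refine (apply_lt_or_gt w k).resolve_left fun h => ?_
        rw [hw.2] at h
        have h2 := w.injective (hw.1.2 _ h)
        rw [h2] at h
        exact h.not_ge hle
      have h3 : (w * simpleRefl k) (posL k) < (w * simpleRefl k) (posR k) := by
        simpa [simpleRefl_posL, simpleRefl_posR] using h1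
      rw [← he _ _ hβi, mul_comm, ← invProd_mul_simpleRefl h3 (he _ _ hk),
        mul_simpleRefl_mul_simpleRefl]

open scoped Classical in
/-- The weighted Poincaré polynomial of a standard Young subgroup. -/
theorem sum_stab_invProd {M : Type*} [CommSemiring M] (hβ : Monotone β) {e : Fin r → M}
    (he : ∀ a b, β a = β b → e a = e b) :
    ∑ w with w ∈ stab β, invProd e w =
      ∏ p, ∑ n ∈ Finset.range (rank β p), e p ^ n := by
  have key (t : ℕ) (ht : t ≤ r) :
      ∑ w with w ∈ stab β ∧ ∀ p : Fin r, t ≤ p.1 → w p = p, invProd e w =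
        ∏ p : Fin r with p.1 < t, ∑ n ∈ Finset.range (rank β p), e p ^ n := by
    induction t with
    | zero =>
      have h1 : (Finset.univ.filter fun w : Equiv.Perm (Fin r) =>
          w ∈ stab β ∧ ∀ p : Fin r, 0 ≤ p.1 → w p = p) = {1} := by
        ext w
        simp only [Finset.mem_filter_univ, Finset.mem_singleton]
        refine ⟨fun h => Equiv.ext fun p => h.2 p (Nat.zero_le _), ?_⟩
        rintro rfl
        exact ⟨one_mem _, fun _ _ => rfl⟩
      rw [h1, Finset.sum_singleton, invProd_one]
      simp
    | succ t ih =>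
      have hP : (Finset.univ.filter fun p : Fin r => p.1 < t + 1) =
          insert ⟨t, ht⟩ (Finset.univ.filter fun p : Fin r => p.1 < t) := by
        ext p
        simp only [Finset.mem_filter_univ, Finset.mem_insert, Fin.ext_iff]
        omega
      rw [hP, Finset.prod_insert (by simp), ← ih (Nat.le_of_succ_le ht), ← sum_class hβ,
        Finset.sum_mul]
      -- Split by the preimage of the last movable point; the fibres contribute the powers in the
      -- geometric sum for that point.
      rw [← Finset.sum_fiberwise_of_maps_to (g := fun w : Equiv.Perm (Fin r) => w⁻¹ ⟨t, ht⟩)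
        (t := Finset.univ.filter fun i => i ≤ ⟨t, ht⟩ ∧ β i = β ⟨t, ht⟩)]
      · refine Finset.sum_congr rfl fun i hi => ?_
        simp only [Finset.mem_filter_univ] at hi
        have h2 := Fin.le_def.1 hi.1
        have := sum_stab_step hβ he ⟨t, ht⟩ (t - i.1) i (by simp at h2 ⊢; omega) hi.2
        refine Eq.trans (Finset.sum_congr ?_ fun _ _ => rfl) this
        ext w
        simp only [Finset.mem_filter, Finset.mem_univ, true_and, Fin.lt_def, Nat.succ_le_iff,
          Equiv.Perm.inv_eq_iff_eq]
        rw [eq_comm (b := w i)]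
      · intro w hw
        simp only [Finset.mem_filter_univ] at hw ⊢
        refine ⟨?_, mem_stab.1 (inv_mem hw.1) _⟩
        by_contra h
        have h2 := hw.2 (w⁻¹ ⟨t, ht⟩) (by rw [not_le, Fin.lt_def] at h; exact h)
        exact h (w⁻¹.injective (w.injective (by simpa using h2)) ▸ le_rfl)
  have := key r le_rfl
  simpa [fun p : Fin r => p.2.not_ge] using this

end Poincare

/-! ### Vanishing of relative Poincaré polynomials at roots of unity. -/

section Multiplicity

open Polynomial

variable {F : Type*} [Field F] [CharZero F] {r : ℕ}

theorem rootMultiplicity_X_pow_sub_one {ζ : F} {l : ℕ} (hζ : IsPrimitiveRoot ζ l) {n : ℕ}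
    (hn : 0 < n) : rootMultiplicity ζ (X ^ n - 1 : F[X]) = if l ∣ n then 1 else 0 := by
  have hsep : (X ^ n - 1 : F[X]).Separable := by
    rw [X_pow_sub_one_separable_iff]
    exact_mod_cast hn.ne'
  have hne : (X ^ n - 1 : F[X]) ≠ 0 := hsep.ne_zero
  split_ifs with h
  · refine le_antisymm (rootMultiplicity_le_one_of_separable hsep ζ) ?_
    rw [Nat.succ_le_iff, rootMultiplicity_pos hne]
    simp [(hζ.pow_eq_one_iff_dvd n).2 h, IsRoot]
  · refine rootMultiplicity_eq_zero fun h2 => h ((hζ.pow_eq_one_iff_dvd n).1 ?_)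
    simpa [IsRoot, sub_eq_zero] using h2

/-- The number of positions whose rank is divisible by `l`. -/
def fullCount {α : Type*} [LinearOrder α] (l : ℕ) (β : Fin r → α) : ℕ :=
  (Finset.univ.filter fun p => l ∣ rank β p).card

theorem rank_pos {α : Type*} [LinearOrder α] (β : Fin r → α) (p : Fin r) : 0 < rank β p :=
  Finset.card_pos.2 ⟨p, by simp⟩

theorem prod_X_pow_sub_one_ne_zero {n : Fin r → ℕ} (hn : ∀ p, 0 < n p) :
    ∏ p, (X ^ n p - 1 : F[X]) ≠ 0 :=
  Finset.prod_ne_zero_iff.2 fun p _ =>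
    ((X_pow_sub_one_separable_iff).2 (by exact_mod_cast (hn p).ne')).ne_zero

theorem rootMultiplicity_prod_X_pow_sub_one {ζ : F} {l : ℕ} (hζ : IsPrimitiveRoot ζ l)
    {n : Fin r → ℕ} (hn : ∀ p, 0 < n p) :
    rootMultiplicity ζ (∏ p, (X ^ n p - 1 : F[X])) =
      (Finset.univ.filter fun p => l ∣ n p).card := by
  classical
  rw [← count_roots, roots_prod _ _ (prod_X_pow_sub_one_ne_zero hn), Multiset.count_bind,
    Finset.card_filter]
  exact congrArg Multiset.sum (Multiset.map_congr rfl fun p _ => by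
    rw [count_roots, rootMultiplicity_X_pow_sub_one hζ (hn p)])

open scoped Classical in
-- The sum is the value at `ζ` of a polynomial `D`, the quotient of the Poincaré polynomials of
-- `stab γ` and `stab ρ`. Its multiplicity at `ζ` is `fullCount l γ - fullCount l ρ`. Lifting to
-- polynomials makes sense of the quotient even when both values at `ζ` vanish.
theorem sum_incrOn_ne_zero_iff {α α' : Type*} [LinearOrder α] [LinearOrder α'] {γ : Fin r → α}
    {ρ : Fin r → α'} (hγ : Monotone γ) (hρ : Monotone ρ) (h : stab ρ ≤ stab γ) {ζ : F} {l : ℕ}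
    (hζ : IsPrimitiveRoot ζ l) {ε : Fin r → ℕ} (hε : ∀ a b, γ a = γ b → ε a = ε b)
    (hε0 : ∀ p, 0 < ε p) (hεl : ∀ p, (ε p).Coprime l) :
    ∑ d with IncrOn ρ d ∧ d ∈ stab γ, invProd (fun p => ζ ^ ε p) d ≠ 0 ↔
      fullCount l γ = fullCount l ρ := by
  set D : F[X] := ∑ d with IncrOn ρ d ∧ d ∈ stab γ, invProd (fun p => X ^ ε p) d with hD
  have hDe : ∑ d with IncrOn ρ d ∧ d ∈ stab γ, invProd (fun p => ζ ^ ε p) d = D.eval ζ := by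
    simp [hD, eval_finsetSum, invProd, eval_prod]
  have hερ (a b) (hab : ρ a = ρ b) : ε a = ε b := hε a b (stab_le_stab_iff.1 h a b hab)
  have h1 := sum_incrOn_mul hρ h (invProd (fun p => (X : F[X]) ^ ε p))
  have h2 (d : Equiv.Perm (Fin r)) (hd : IncrOn ρ d) :
      ∑ u with u ∈ stab ρ, invProd (fun p => (X : F[X]) ^ ε p) (d * u) =
        invProd (fun p => (X : F[X]) ^ ε p) d *
          ∏ p, ∑ n ∈ Finset.range (rank ρ p), (X ^ ε p) ^ n := by
    rw [← sum_stab_invProd hρ fun a b hab => by rw [hερ a b hab], Finset.mul_sum]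
    refine Finset.sum_congr rfl fun u hu => invProd_mul hρ (fun a b hab => by rw [hερ a b hab]) hd ?_
    simpa using hu
  rw [sum_stab_invProd hγ fun a b hab => by rw [hε a b hab],
    Finset.sum_congr rfl fun d hd => h2 d (by simp at hd; exact hd.1), ← Finset.sum_mul, ← hD] at h1
  -- The factor `∏ (X ^ ε p - 1)` is the same for both labellings and turns each geometric sum into
  -- a binomial.
  have h3 : ∏ p, (X ^ (ε p * rank γ p) - 1 : F[X]) = D * ∏ p, (X ^ (ε p * rank ρ p) - 1) := by
    have h4 (k : Fin r → ℕ) : ∏ p, (X ^ (ε p * k p) - 1 : F[X]) =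
        (∏ p, ∑ n ∈ Finset.range (k p), (X ^ ε p) ^ n) * ∏ p, (X ^ ε p - 1) := by
      rw [← Finset.prod_mul_distrib]
      exact Finset.prod_congr rfl fun p _ => by rw [geom_sum_mul, pow_mul]
    rw [h4, h4, h1, mul_assoc]
  have hγ0 : ∏ p, (X ^ (ε p * rank γ p) - 1 : F[X]) ≠ 0 :=
    prod_X_pow_sub_one_ne_zero fun p => Nat.mul_pos (hε0 p) (rank_pos γ p)
  have h5 : rootMultiplicity ζ (∏ p, (X ^ (ε p * rank γ p) - 1 : F[X])) = fullCount l γ := by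
    rw [rootMultiplicity_prod_X_pow_sub_one hζ fun p => Nat.mul_pos (hε0 p) (rank_pos γ p)]
    -- Coprimality of `ε p` and `l` makes the parity weights invisible to the count.
    simp only [fun p => (hεl p).symm.dvd_mul_left]
    rfl
  have h6 : rootMultiplicity ζ (∏ p, (X ^ (ε p * rank ρ p) - 1 : F[X])) = fullCount l ρ := by
    rw [rootMultiplicity_prod_X_pow_sub_one hζ fun p => Nat.mul_pos (hε0 p) (rank_pos ρ p)]
    simp only [fun p => (hεl p).symm.dvd_mul_left]
    rfl
  rw [h3] at hγ0 h5
  rw [rootMultiplicity_mul hγ0, h6] at h5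
  rw [hDe, ← not_iff_not, not_not]
  change D.IsRoot ζ ↔ _
  rw [← rootMultiplicity_pos (left_ne_zero_of_mul hγ0)]
  omega

end Multiplicity

/-! ### Independence of the reduced expression. -/

section Matsumoto

variable {r : ℕ}

theorem wordProd_append (ω ω' : List (Fin (r - 1))) :
    wordProd (ω ++ ω') = wordProd ω * wordProd ω' := by
  simp [wordProd]

theorem wordProd_singleton (k : Fin (r - 1)) : wordProd [k] = simpleRefl k := by
  simp [wordProd]

theorem simpleRefl_comm {j k : Fin (r - 1)} (h : j.1 + 1 < k.1) :
    simpleRefl j * simpleRefl k = simpleRefl k * simpleRefl j := by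
  apply Equiv.Perm.Disjoint.commute
  intro x
  by_cases hx : x = posL k ∨ x = posR k
  · refine Or.inl (simpleRefl_of_ne ?_ ?_) <;> rcases hx with rfl | rfl <;>
      simp [posL, posR, Fin.ext_iff] <;> omega
  · push Not at hx
    exact Or.inr (simpleRefl_of_ne hx.1 hx.2)

theorem simpleRefl_braid {j k : Fin (r - 1)} (h : j.1 + 1 = k.1) :
    simpleRefl j * simpleRefl k * simpleRefl j = simpleRefl k * simpleRefl j * simpleRefl k := by
  have hp : posR j = posL k := Fin.ext h
  have h01 : posL j ≠ posL k := by simp [posL, Fin.ext_iff]; omega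
  have h02 : posL j ≠ posR k := by simp [posL, posR, Fin.ext_iff]; omega
  have h12 : posR k ≠ posL k := (posL_lt_posR k).ne'
  unfold simpleRefl
  rw [hp, Equiv.swap_mul_swap_mul_swap h01 h02, Equiv.swap_comm (posL j) (posL k),
    Equiv.swap_comm (posL k) (posR k), Equiv.swap_mul_swap_mul_swap h12 h02.symm,
    Equiv.swap_comm]

theorem reduced_append {ω : List (Fin (r - 1))} {k : Fin (r - 1)}
    (h : (ω ++ [k]).length = ninv (wordProd (ω ++ [k]))) :
    wordProd (ω ++ [k]) (posR k) < wordProd (ω ++ [k]) (posL k) ∧ ω.length = ninv (wordProd ω) := by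
  have h1 := ninv_wordProd_le ω
  have h2 : wordProd ω = wordProd (ω ++ [k]) * simpleRefl k := by
    rw [wordProd_append, wordProd_singleton, mul_simpleRefl_mul_simpleRefl]
  rw [List.length_append, List.length_singleton] at h
  rcases apply_lt_or_gt (wordProd (ω ++ [k])) k with h3 | h3
  · have := ninv_mul_simpleRefl h3
    rw [← h2] at this
    omega
  · have := ninv_of_gt h3
    rw [← h2] at this
    exact ⟨h3, by omega⟩

/-- With two descents `j < k`, the longest element of the subgroup they generate splits off on the
right of `w`. Its two reduced words, ending in `j` and in `k`, are related by a single braid or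
commutation relation. -/
theorem exists_reduced_pair {M : Type*} [Monoid M] {g : Fin (r - 1) → M}
    (hcomm : ∀ j k : Fin (r - 1), j.1 + 1 < k.1 → g j * g k = g k * g j)
    (hbraid : ∀ j k : Fin (r - 1), j.1 + 1 = k.1 → g j * g k * g j = g k * g j * g k)
    {w : Equiv.Perm (Fin r)} {j k : Fin (r - 1)} (hjk : j < k) (hj : w (posR j) < w (posL j))
    (hk : w (posR k) < w (posL k)) :
    ∃ η η' : List (Fin (r - 1)), wordProd η = w * simpleRefl j ∧ wordProd η' = w * simpleRefl k ∧
      η.length + 1 = ninv w ∧ η'.length + 1 = ninv w ∧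
      (η.map g).prod * g j = (η'.map g).prod * g k := by
  have n1 := ninv_of_gt hj
  rcases (Nat.succ_le_of_lt (Fin.lt_def.1 hjk)).eq_or_lt with h | h
  · have hp : posR j = posL k := Fin.ext h
    have e1 : simpleRefl j (posR k) = posR k := by
      apply simpleRefl_of_ne <;> simp [posL, posR, Fin.ext_iff] <;> omega
    have e2 : simpleRefl k (posL j) = posL j := by
      apply simpleRefl_of_ne <;> simp [posL, posR, Fin.ext_iff] <;> omega
    have n2 : ninv (w * simpleRefl j) = ninv (w * simpleRefl j * simpleRefl k) + 1 := by
      refine ninv_of_gt ?_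
      rw [Equiv.Perm.mul_apply, Equiv.Perm.mul_apply, e1, ← hp, simpleRefl_posR]
      exact hk.trans (hp ▸ hj)
    have n3 : ninv (w * simpleRefl j * simpleRefl k) =
        ninv (w * simpleRefl j * simpleRefl k * simpleRefl j) + 1 := by
      refine ninv_of_gt ?_
      simp only [Equiv.Perm.mul_apply]
      rw [e2, hp, simpleRefl_posL, simpleRefl_posL, e1, hp]
      exact hk
    obtain ⟨η, hη, hl⟩ := exists_word_length (w * simpleRefl j * simpleRefl k * simpleRefl j)
    refine ⟨η ++ [j] ++ [k], η ++ [k] ++ [j], ?_, ?_, ?_, ?_, ?_⟩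
    · simp only [wordProd_append, wordProd_singleton, hη, mul_simpleRefl_mul_simpleRefl]
    · have : w * simpleRefl j * simpleRefl k * simpleRefl j =
          w * simpleRefl k * simpleRefl j * simpleRefl k := by
        have := congrArg (w * ·) (simpleRefl_braid h)
        simpa only [mul_assoc] using this
      simp only [wordProd_append, wordProd_singleton, hη, this, mul_simpleRefl_mul_simpleRefl]
    · simp; omega
    · simp; omega
    · have := congrArg ((η.map g).prod * ·) (hbraid j k h)
      simpa [mul_assoc] using this
  · have e1 : simpleRefl j (posR k) = posR k := by
      apply simpleRefl_of_ne <;> simp [posL, posR, Fin.ext_iff] <;> omega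
    have e2 : simpleRefl j (posL k) = posL k := by
      apply simpleRefl_of_ne <;> simp [posL, posR, Fin.ext_iff] <;> omega
    have n2 : ninv (w * simpleRefl j) = ninv (w * simpleRefl j * simpleRefl k) + 1 := by
      refine ninv_of_gt ?_
      rwa [Equiv.Perm.mul_apply, Equiv.Perm.mul_apply, e1, e2]
    obtain ⟨η, hη, hl⟩ := exists_word_length (w * simpleRefl j * simpleRefl k)
    refine ⟨η ++ [k], η ++ [j], ?_, ?_, ?_, ?_, ?_⟩
    · simp only [wordProd_append, wordProd_singleton, hη, mul_simpleRefl_mul_simpleRefl]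
    · simp only [wordProd_append, wordProd_singleton, hη]
      rw [mul_assoc w, simpleRefl_comm h, ← mul_assoc, mul_simpleRefl_mul_simpleRefl]
    · simp; omega
    · simp; omega
    · simp [mul_assoc, hcomm j k h]

/-- Matsumoto's theorem for the symmetric group. -/
theorem prod_eq_of_reduced {M : Type*} [Monoid M] {g : Fin (r - 1) → M}
    (hcomm : ∀ j k : Fin (r - 1), j.1 + 1 < k.1 → g j * g k = g k * g j)
    (hbraid : ∀ j k : Fin (r - 1), j.1 + 1 = k.1 → g j * g k * g j = g k * g j * g k)
    {ω ω' : List (Fin (r - 1))} (h : wordProd ω = wordProd ω')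
    (hω : ω.length = ninv (wordProd ω)) (hω' : ω'.length = ninv (wordProd ω')) :
    (ω.map g).prod = (ω'.map g).prod := by
  induction hn : ω.length generalizing ω ω' with
  | zero =>
    have h1 : ω = [] := List.length_eq_zero_iff.1 hn
    have h2 : ω' = [] := List.length_eq_zero_iff.1 (by rw [hω', ← h, ← hω, hn])
    rw [h1, h2]
  | succ n ih =>
    have hn' : ω'.length = n + 1 := by rw [hω', ← h, ← hω, hn]
    rcases List.eq_nil_or_concat' ω with rfl | ⟨ω, j, rfl⟩
    · simp at hn
    rcases List.eq_nil_or_concat' ω' with rfl | ⟨ω', k, rfl⟩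
    · simp at hn'
    obtain ⟨dj, lj⟩ := reduced_append hω
    obtain ⟨dk, lk⟩ := reduced_append hω'
    set w := wordProd (ω ++ [j]) with hw
    rw [← h] at dk
    have ej : wordProd ω = w * simpleRefl j := by
      rw [hw, wordProd_append, wordProd_singleton, mul_simpleRefl_mul_simpleRefl]
    have ek : wordProd ω' = w * simpleRefl k := by
      rw [h, wordProd_append, wordProd_singleton, mul_simpleRefl_mul_simpleRefl]
    have nj := ninv_of_gt dj
    have nk := ninv_of_gt dk
    rw [List.length_append, List.length_singleton] at hn hn'
    simp only [List.map_append, List.prod_append, List.map_singleton, List.prod_singleton]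
    rcases lt_trichotomy j k with hjk | rfl | hjk
    · obtain ⟨η, η', h1, h2, h3, h4, h5⟩ := exists_reduced_pair hcomm hbraid hjk dj dk
      rw [ih (ω := ω) (ω' := η) (by rw [h1, ej]) lj (by rw [h1]; omega) (by omega), h5,
        ih (ω := ω') (ω' := η') (by rw [h2, ek]) lk (by rw [h2]; omega) (by omega)]
    · rw [ih (ω := ω) (ω' := ω') (by rw [ej, ek]) lj lk (by omega)]
    · obtain ⟨η', η, h1, h2, h3, h4, h5⟩ := exists_reduced_pair hcomm hbraid hjk dk dj
      rw [ih (ω := ω) (ω' := η) (by rw [h2, ej]) lj (by rw [h2]; omega) (by omega), ← h5,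
        ih (ω := ω') (ω' := η') (by rw [h1, ek]) lk (by rw [h1]; omega) (by omega)]

end Matsumoto

/-! ### Multiplication of the elements `T_w` and parabolic subalgebras. -/

section HeckeBasis

variable {F : Type*} [Field F] {r : ℕ} (q : Fˣ)

theorem heckeGen_quad (k : Fin (r - 1)) :
    heckeGen q k * heckeGen q k = 1 + ((q : F) - (q : F)⁻¹) • heckeGen q k := by
  simpa [heckeGen] using RingQuot.mkAlgHom_rel F (HeckeRel.quad (q := q) k)

theorem heckeGen_comm (j k : Fin (r - 1)) (h : j.1 + 1 < k.1) :
    heckeGen q j * heckeGen q k = heckeGen q k * heckeGen q j := by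
  simpa [heckeGen] using RingQuot.mkAlgHom_rel F (HeckeRel.comm (q := q) j k h)

theorem heckeGen_braid (j k : Fin (r - 1)) (h : j.1 + 1 = k.1) :
    heckeGen q j * heckeGen q k * heckeGen q j = heckeGen q k * heckeGen q j * heckeGen q k := by
  simpa [heckeGen] using RingQuot.mkAlgHom_rel F (HeckeRel.braid (q := q) j k h)

theorem heckeT_wordProd {ω : List (Fin (r - 1))} (h : ω.length = ninv (wordProd ω)) :
    heckeT q (wordProd ω) = (ω.map (heckeGen q)).prod := by
  have h1 := Classical.choose_spec (exists_reduced_word (wordProd ω))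
  refine prod_eq_of_reduced (heckeGen_comm q) (heckeGen_braid q) h1.1 ?_ h
  refine h1.2.trans ?_
  rw [len_eq_ninv, reducedWord, h1.1]

theorem heckeT_one : heckeT q (1 : Equiv.Perm (Fin r)) = 1 :=
  heckeT_wordProd q (ω := []) ninv_one.symm

theorem heckeT_mul_gen {w : Equiv.Perm (Fin r)} {k : Fin (r - 1)}
    (h : w (posL k) < w (posR k)) :
    heckeT q (w * simpleRefl k) = heckeT q w * heckeGen q k := by
  obtain ⟨ω, rfl, hω⟩ := exists_word_length w
  rw [← wordProd_singleton, ← wordProd_append, heckeT_wordProd, heckeT_wordProd q hω]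
  · simp
  · rw [wordProd_append, wordProd_singleton, ninv_mul_simpleRefl h, ← hω]
    simp

theorem heckeT_mul_gen_of_gt {w : Equiv.Perm (Fin r)} {k : Fin (r - 1)}
    (h : w (posR k) < w (posL k)) :
    heckeT q w * heckeGen q k =
      heckeT q (w * simpleRefl k) + ((q : F) - (q : F)⁻¹) • heckeT q w := by
  have h1 : (w * simpleRefl k) (posL k) < (w * simpleRefl k) (posR k) := by
    simpa [simpleRefl_posL, simpleRefl_posR] using h
  have h2 := heckeT_mul_gen q h1
  rw [mul_simpleRefl_mul_simpleRefl] at h2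
  rw [h2, mul_assoc, heckeGen_quad, mul_add, mul_one, mul_smul_comm]

theorem heckeT_simpleRefl (k : Fin (r - 1)) : heckeT q (simpleRefl k) = heckeGen q k := by
  have := heckeT_mul_gen q (w := 1) (k := k) (posL_lt_posR k)
  rwa [one_mul, heckeT_one, one_mul] at this

theorem heckeT_mul {u w : Equiv.Perm (Fin r)} (h : ninv (u * w) = ninv u + ninv w) :
    heckeT q (u * w) = heckeT q u * heckeT q w := by
  induction w using perm_induction with
  | h1 => rw [heckeT_one, mul_one, mul_one]
  | hs w k hk ih =>
    rw [← mul_assoc, ninv_mul_simpleRefl hk] at h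
    have h1 := ninv_mul_le u w
    rcases apply_lt_or_gt (u * w) k with h2 | h2
    · rw [ninv_mul_simpleRefl h2] at h
      rw [← mul_assoc, heckeT_mul_gen q h2, ih (by omega), heckeT_mul_gen q hk, mul_assoc]
    · have := ninv_of_gt h2
      omega

theorem heckeT_mem {K : Subgroup (Equiv.Perm (Fin r))} {w : Equiv.Perm (Fin r)} (hw : w ∈ K) :
    heckeT q w ∈ heckeSub q K :=
  Submodule.subset_span ⟨w, hw, rfl⟩

variable {α : Type*}

theorem heckeSub_mul_gen {β : Fin r → α} {a : Hecke q r} (ha : a ∈ heckeSub q (stab β))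
    {k : Fin (r - 1)} (hk : β (posL k) = β (posR k)) :
    a * heckeGen q k ∈ heckeSub q (stab β) := by
  induction ha using Submodule.span_induction with
  | mem x hx =>
    obtain ⟨w, hw, rfl⟩ := hx
    have hm := heckeT_mem q (mul_mem hw (simpleRefl_mem_stab.2 hk))
    rcases apply_lt_or_gt w k with h | h
    · rwa [← heckeT_mul_gen q h]
    · rw [heckeT_mul_gen_of_gt q h]
      exact add_mem hm (Submodule.smul_mem _ _ (heckeT_mem q hw))
  | zero => simp
  | add x y _ _ hx hy => rw [add_mul]; exact add_mem hx hy
  | smul c x _ hx => rw [smul_mul_assoc]; exact Submodule.smul_mem _ _ hx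

theorem heckeSub_mul [LinearOrder α] {β : Fin r → α} (hβ : Monotone β) {a b : Hecke q r} (ha : a ∈ heckeSub q (stab β))
    (hb : b ∈ heckeSub q (stab β)) : a * b ∈ heckeSub q (stab β) := by
  induction hb using Submodule.span_induction with
  | mem x hx =>
    obtain ⟨w, hw, rfl⟩ := hx
    refine stab_induction (P := fun w => a * heckeT q w ∈ heckeSub q (stab β)) hβ ?_ ?_ hw
    · rwa [heckeT_one, mul_one]
    · intro u _ k hk hlt hm
      rw [heckeT_mul_gen q hlt, ← mul_assoc]
      exact heckeSub_mul_gen q hm hk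
  | zero => simp
  | add x y _ _ hx hy => rw [mul_add]; exact add_mem hx hy
  | smul c x _ hx => rw [mul_smul_comm]; exact Submodule.smul_mem _ _ hx

theorem top_eq_stab : (⊤ : Subgroup (Equiv.Perm (Fin r))) = stab fun _ => () :=
  (eq_top_iff.2 fun _ _ _ => rfl).symm

theorem heckeSub_top : heckeSub q (⊤ : Subgroup (Equiv.Perm (Fin r))) = ⊤ := by
  rw [eq_top_iff]
  rintro a -
  obtain ⟨a, rfl⟩ := RingQuot.mkAlgHom_surjective F (HeckeRel q r) a
  have h1 : (1 : Hecke q r) ∈ heckeSub q (⊤ : Subgroup (Equiv.Perm (Fin r))) := by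
    rw [← heckeT_one]
    exact heckeT_mem q (Subgroup.mem_top _)
  induction a using FreeAlgebra.induction with
  | grade0 c =>
    rw [AlgHom.commutes, Algebra.algebraMap_eq_smul_one]
    exact Submodule.smul_mem _ _ h1
  | grade1 k =>
    change heckeGen q k ∈ _
    rw [← heckeT_simpleRefl]
    exact heckeT_mem q (Subgroup.mem_top _)
  | mul a b ha hb =>
    rw [map_mul]
    rw [top_eq_stab] at *
    exact heckeSub_mul q (fun _ _ _ => le_rfl) ha hb
  | add a b ha hb => rw [map_add]; exact add_mem ha hb

/-- The quadratic relation says that `T_s - (q - q⁻¹)` is inverse to `T_s`. -/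
theorem exists_heckeT_inv (w : Equiv.Perm (Fin r)) :
    ∃ x : Hecke q r, heckeT q w * x = 1 ∧ x * heckeT q w = 1 := by
  induction w using perm_induction with
  | h1 => exact ⟨1, by simp [heckeT_one]⟩
  | hs w k hk ih =>
    obtain ⟨x, h1, h2⟩ := ih
    have h3 : heckeGen q k * (heckeGen q k - algebraMap F _ ((q : F) - (q : F)⁻¹)) = 1 := by
      rw [mul_sub, heckeGen_quad, ← Algebra.commutes, ← Algebra.smul_def, add_sub_cancel_right]
    have h4 : (heckeGen q k - algebraMap F _ ((q : F) - (q : F)⁻¹)) * heckeGen q k = 1 := by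
      rw [sub_mul, heckeGen_quad, ← Algebra.smul_def, add_sub_cancel_right]
    refine ⟨(heckeGen q k - algebraMap F _ ((q : F) - (q : F)⁻¹)) * x, ?_, ?_⟩
    · rw [heckeT_mul_gen q hk, mul_assoc, ← mul_assoc (heckeGen q k), h3, one_mul, h1]
    · rw [heckeT_mul_gen q hk, mul_assoc, ← mul_assoc x, h2, one_mul, h4]

end HeckeBasis

/-! ### The orthonormal form on words and the action on sorted words. -/

section Form

variable {F : Type*} [Field F] {m n r : ℕ} (q : Fˣ)

theorem rightMul_mul (a b : Hecke q r) :
    (rightMul q (a * b) : Module.End F (TensorSpace F m n r)) = rightMul q b * rightMul q a := by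
  simp [rightMul]

theorem rightMul_one : (rightMul q (1 : Hecke q r) : Module.End F (TensorSpace F m n r)) = 1 := by
  simp [rightMul]

theorem rightMul_add (a b : Hecke q r) :
    (rightMul q (a + b) : Module.End F (TensorSpace F m n r)) = rightMul q a + rightMul q b := by
  simp [rightMul]

theorem rightMul_smul (c : F) (a : Hecke q r) :
    (rightMul q (c • a) : Module.End F (TensorSpace F m n r)) = c • rightMul q a := by
  simp [rightMul]

theorem rightMul_zero : (rightMul q (0 : Hecke q r) : Module.End F (TensorSpace F m n r)) = 0 := by
  simp [rightMul]

theorem rightMul_sum {ι : Type*} (s : Finset ι) (a : ι → Hecke q r) :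
    (rightMul q (∑ i ∈ s, a i) : Module.End F (TensorSpace F m n r)) =
      ∑ i ∈ s, rightMul q (a i) := by
  simp [rightMul]

theorem rightMul_gen (k : Fin (r - 1)) :
    (rightMul q (heckeGen q k) : Module.End F (TensorSpace F m n r)) = actGen q k := by
  simp [rightMul, heckeGen, heckeAction]

variable (F m n r) in
/-- The bilinear form on the tensor space for which the words are an orthonormal basis. -/
noncomputable def form : TensorSpace F m n r →ₗ[F] TensorSpace F m n r →ₗ[F] F :=
  (tensorBasis F m n r).toDual

theorem form_basis (i j : Fin r → Fin (m + n)) :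
    form F m n r (tensorBasis F m n r i) (tensorBasis F m n r j) = if i = j then 1 else 0 :=
  (tensorBasis F m n r).toDual_apply i j

theorem form_comm (x y : TensorSpace F m n r) : form F m n r x y = form F m n r y x := by
  have : form F m n r = (form F m n r).flip := by
    refine (tensorBasis F m n r).ext fun i => (tensorBasis F m n r).ext fun j => ?_
    rw [LinearMap.flip_apply, form_basis, form_basis]
    simp only [eq_comm]
  exact LinearMap.congr_fun₂ this x y

theorem eq_of_form {x y : TensorSpace F m n r}
    (h : ∀ j, form F m n r x (tensorBasis F m n r j) = form F m n r y (tensorBasis F m n r j)) :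
    x = y := by
  refine (tensorBasis F m n r).ext_elem fun j => ?_
  have := h j
  rwa [form, Module.Basis.toDual_apply_left, Module.Basis.toDual_apply_left] at this

theorem comp_simpleRefl_eq_iff {k : Fin (r - 1)} {i j : Fin r → Fin (m + n)} :
    i ∘ simpleRefl k = j ↔ i = j ∘ simpleRefl k := by
  constructor <;> rintro rfl <;> rw [comp_simpleRefl_twice]

/-- The matrix of a generator in the basis of words is symmetric: off the diagonal only the sign
appears, and it is symmetric in the two letters. -/
theorem form_actGen (k : Fin (r - 1)) (x y : TensorSpace F m n r) :
    form F m n r (actGen q k x) y = form F m n r x (actGen q k y) := by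
  have : form F m n r ∘ₗ actGen q k = (form F m n r).compl₂ (actGen q k) := by
    refine (tensorBasis F m n r).ext fun i => (tensorBasis F m n r).ext fun j => ?_
    rw [LinearMap.comp_apply, LinearMap.compl₂_apply]
    have hsj (h : i = j ∘ simpleRefl k) : i (posL k) = j (posR k) ∧ i (posR k) = j (posL k) := by
      simp [h, simpleRefl_posL, simpleRefl_posR]
    by_cases hij : i = j
    · subst hij
      exact form_comm _ _
    by_cases hs : i = j ∘ simpleRefl k
    · have hs' := comp_simpleRefl_eq_iff.2 hs
      obtain ⟨h1, h2⟩ := hsj hs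
      rcases lt_trichotomy (i (posL k)) (i (posR k)) with a | a | a
      · rw [actGen_lt q k i a, actGen_gt q k j (by rwa [← h1, ← h2]), map_smul, map_add, map_smul,
          map_smul, LinearMap.smul_apply, hs', ← hs, form_basis, form_basis, form_basis, h1, h2,
          sgn_comm]
        simp [hij]
      · refine absurd (hs.trans (funext fun t => ?_)) hij
        rw [Function.comp_apply]
        by_cases t1 : t = posL k
        · rw [t1, simpleRefl_posL, ← h1, ← h2, a]
        by_cases t2 : t = posR k
        · rw [t2, simpleRefl_posR, ← h1, ← h2, a]
        rw [simpleRefl_of_ne t1 t2]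
      · rw [actGen_gt q k i a, actGen_lt q k j (by rwa [← h1, ← h2]), map_add, map_smul, map_smul,
          map_smul, LinearMap.add_apply, LinearMap.smul_apply, LinearMap.smul_apply, hs', ← hs,
          form_basis, form_basis, form_basis, h1, h2, sgn_comm]
        simp [hij]
    · have hs' : ¬ i ∘ simpleRefl k = j := fun h => hs (comp_simpleRefl_eq_iff.1 h)
      rcases lt_trichotomy (i (posL k)) (i (posR k)) with a | a | a <;>
      rcases lt_trichotomy (j (posL k)) (j (posR k)) with b | b | b
      all_goals
        first
          | rw [actGen_lt q k i a]
          | rw [actGen_eq q k i a]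
          | rw [actGen_gt q k i a]
        first
          | rw [actGen_lt q k j b]
          | rw [actGen_eq q k j b]
          | rw [actGen_gt q k j b]
        simp [form_basis, hij, hs, hs']
  exact LinearMap.congr_fun₂ this x y

theorem form_rightMul (w : Equiv.Perm (Fin r)) (x y : TensorSpace F m n r) :
    form F m n r (rightMul q (heckeT q w) x) y =
      form F m n r x (rightMul q (heckeT q w⁻¹) y) := by
  induction w using perm_induction generalizing x y with
  | h1 => rw [inv_one]; simp [heckeT_one, rightMul_one]
  | hs w k h ih =>
    have h1 : heckeT q (w * simpleRefl k)⁻¹ = heckeGen q k * heckeT q w⁻¹ := by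
      rw [mul_inv_rev, simpleRefl_inv, heckeT_mul, heckeT_simpleRefl]
      have h2 := ninv_mul_simpleRefl (w := 1) (k := k) (posL_lt_posR k)
      rw [← ninv_inv, mul_inv_rev, inv_inv, simpleRefl_inv, ninv_mul_simpleRefl h, ninv_inv,
        ← one_mul (simpleRefl k), h2, ninv_one]
      omega
    rw [h1, heckeT_mul_gen q h, rightMul_mul, rightMul_mul, rightMul_gen, Module.End.mul_apply,
      Module.End.mul_apply, form_actGen, ih]

/-- A word is an eigenvector for the permutations that leave it invariant. -/
theorem rightMul_basis_of_mem_stab {α : Type*} [LinearOrder α] {β : Fin r → α} (hβ : Monotone β)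
    {i : Fin r → Fin (m + n)} (hi : ∀ a b, β a = β b → i a = i b) {u : Equiv.Perm (Fin r)}
    (hu : u ∈ stab β) :
    rightMul q (heckeT q u) (tensorBasis F m n r i) =
      invProd (fun p => diagCoef (q : F) (i p)) u • tensorBasis F m n r i := by
  refine stab_induction (P := fun u => rightMul q (heckeT q u) (tensorBasis F m n r i) =
      invProd (fun p => diagCoef (q : F) (i p)) u • tensorBasis F m n r i) hβ ?_ ?_ hu
  · rw [heckeT_one, rightMul_one, invProd_one, one_smul, Module.End.one_apply]
  · intro u _ k hk h ih
    rw [heckeT_mul_gen q h, rightMul_mul, Module.End.mul_apply, ih, map_smul, rightMul_gen,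
      actGen_eq q k i (hi _ _ hk), smul_smul, invProd_mul_simpleRefl h (by rw [hi _ _ hk])]

/-- Along a reduced word of `y` only strictly increasing neighbouring letters are swapped, since
equal letters keep their order. So only the signed branch of the action occurs, with no `q - q⁻¹`
term. -/
theorem rightMul_basis_of_sorted {α : Type*} [LinearOrder α] {β : Fin r → α} (hβ : Monotone β)
    {i : Fin r → Fin (m + n)} (hi : ∀ a b, a < b → β a = β b → i a ≤ i b)
    {y : Equiv.Perm (Fin r)} (hyβ : y ∈ stab β)
    (hy : ∀ a b, a < b → β a = β b → i a = i b → y⁻¹ a < y⁻¹ b) :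
    ∃ c : F, (c = 1 ∨ c = -1 ∧ n ≠ 0) ∧ rightMul q (heckeT q y) (tensorBasis F m n r i) =
      c • tensorBasis F m n r (i ∘ y) := by
  revert hy
  refine stab_induction (P := fun y => (∀ a b, a < b → β a = β b → i a = i b → y⁻¹ a < y⁻¹ b) →
    ∃ c : F, (c = 1 ∨ c = -1 ∧ n ≠ 0) ∧ rightMul q (heckeT q y) (tensorBasis F m n r i) =
      c • tensorBasis F m n r (i ∘ y)) hβ
    (fun _ => ⟨1, Or.inl rfl, by simp [heckeT_one, rightMul_one]⟩) ?_ hyβ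
  intro y hyβ k hk h ih hy
  rw [mul_inv_rev, simpleRefl_inv] at hy
  have hβy : β (y (posL k)) = β (y (posR k)) := by rw [hyβ, hyβ, hk]
  have hlt : i (y (posL k)) < i (y (posR k)) := by
    refine lt_of_le_of_ne (hi _ _ h hβy) fun h2 => ?_
    have h3 : posR k < posL k := by
      simpa [simpleRefl_posL, simpleRefl_posR] using hy _ _ h hβy h2
    exact h3.not_gt (posL_lt_posR k)
  obtain ⟨c, hc, he⟩ := ih fun a b hab hβab h2 => by
    have h3 := hy a b hab hβab h2
    rw [Equiv.Perm.mul_apply, Equiv.Perm.mul_apply] at h3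
    have h4 := simpleRefl_lt h3 (k := k)
    rw [simpleRefl_simpleRefl, simpleRefl_simpleRefl] at h4
    refine h4 fun h5 => ?_
    have h6 : a = y (posR k) := by
      rw [← simpleRefl_posL k, ← h5.1, simpleRefl_simpleRefl]; simp
    have h7 : b = y (posL k) := by
      rw [← simpleRefl_posR k, ← h5.2, simpleRefl_simpleRefl]; simp
    rw [h6, h7] at hab
    exact hab.not_gt h
  refine ⟨c * sgn F (i (y (posL k))) (i (y (posR k))), ?_, ?_⟩
  · have hs : sgn F (i (y (posL k))) (i (y (posR k))) = 1 ∨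
        sgn F (i (y (posL k))) (i (y (posR k))) = -1 ∧ n ≠ 0 := by
      unfold sgn
      split_ifs with h5
      · refine Or.inr ⟨rfl, ?_⟩
        rintro rfl
        exact (i (y (posL k))).2.not_ge h5.1
      · exact Or.inl rfl
    rcases hc with rfl | ⟨rfl, h0⟩ <;> rcases hs with hs | ⟨hs, h0⟩ <;> simp_all
  · rw [heckeT_mul_gen q h, rightMul_mul, Module.End.mul_apply, he, map_smul, rightMul_gen,
      actGen_lt q k _ hlt, smul_smul]
    rfl

theorem rightMul_basis_of_incrOn {i : Fin r → Fin (m + n)} (hi : Monotone i)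
    {y : Equiv.Perm (Fin r)} (hy : IncrOn i y⁻¹) :
    ∃ c : F, (c = 1 ∨ c = -1 ∧ n ≠ 0) ∧ rightMul q (heckeT q y) (tensorBasis F m n r i) =
      c • tensorBasis F m n r (i ∘ y) :=
  rightMul_basis_of_sorted q (β := fun _ => ()) (fun _ _ _ => le_rfl) (fun _ _ h _ => hi h.le)
    (fun _ => rfl) (fun a b hab _ h => hy a b hab h)

end Form

/-! ### The symmetrizing trace and projections onto parabolic subalgebras. -/

section Trace

variable {F : Type*} [Field F] {r : ℕ} (q : Fˣ)

/-- A permutation, as a word in the labels of an even space of dimension `r`. -/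
def permWord (w : Equiv.Perm (Fin r)) : Fin r → Fin (r + 0) := w

theorem permWord_inj {u w : Equiv.Perm (Fin r)} : permWord u = permWord w ↔ u = w :=
  DFunLike.coe_fn_eq

theorem rightMul_permWord_one (w : Equiv.Perm (Fin r)) :
    rightMul q (heckeT q w) (tensorBasis F r 0 r (permWord 1)) =
      tensorBasis F r 0 r (permWord w) := by
  obtain ⟨c, hc, h⟩ := rightMul_basis_of_incrOn (F := F) q (m := r) (n := 0) (i := permWord 1)
    (fun a b h => h) (y := w) (fun a b hab h => absurd h hab.ne)
  rcases hc with rfl | hc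
  · rw [h, one_smul]; rfl
  · exact absurd rfl hc.2

/-- The symmetrizing trace of the Hecke algebra. -/
noncomputable def trace (h : Hecke q r) : F :=
  form F r 0 r (rightMul q h (tensorBasis F r 0 r (permWord 1))) (tensorBasis F r 0 r (permWord 1))

theorem trace_add (a b : Hecke q r) : trace q (a + b) = trace q a + trace q b := by
  simp [trace, rightMul_add]

theorem trace_smul (c : F) (a : Hecke q r) : trace q (c • a) = c * trace q a := by
  simp [trace, rightMul_smul]

theorem trace_zero : trace q (0 : Hecke q r) = 0 := by
  simp [trace, rightMul_zero]

/-- On the even space of dimension `r`, the word with distinct letters in order is sent by `T_w` to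
the word `w`. With adjointness this makes `T_w` and `T_{w⁻¹}` dual bases. -/
theorem trace_heckeT_mul (u w : Equiv.Perm (Fin r)) :
    trace q (heckeT q u * heckeT q w) = if u = w⁻¹ then 1 else 0 := by
  rw [trace, rightMul_mul, Module.End.mul_apply, form_rightMul, rightMul_permWord_one,
    rightMul_permWord_one, form_basis]
  simp only [permWord_inj]

theorem hecke_induction {P : Hecke q r → Prop} (hT : ∀ w, P (heckeT q w)) (h0 : P 0)
    (ha : ∀ a b, P a → P b → P (a + b)) (hs : ∀ (c : F) a, P a → P (c • a)) (a : Hecke q r) :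
    P a := by
  have : a ∈ heckeSub q (⊤ : Subgroup (Equiv.Perm (Fin r))) := by
    rw [heckeSub_top]; trivial
  induction this using Submodule.span_induction with
  | mem x hx =>
    obtain ⟨w, _, rfl⟩ := hx
    exact hT w
  | zero => exact h0
  | add x y _ _ hx hy => exact ha x y hx hy
  | smul c x _ hx => exact hs c x hx

theorem trace_mul_comm (a b : Hecke q r) : trace q (a * b) = trace q (b * a) := by
  induction a using hecke_induction with
  | hT u =>
    induction b using hecke_induction with
    | hT w =>
      rw [trace_heckeT_mul, trace_heckeT_mul]
      exact if_congr ⟨fun h => by rw [h, inv_inv], fun h => by rw [h, inv_inv]⟩ rfl rfl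
    | h0 => simp
    | ha a b h1 h2 => rw [mul_add, add_mul, trace_add, trace_add, h1, h2]
    | hs c a h => rw [mul_smul_comm, smul_mul_assoc, trace_smul, trace_smul, h]
  | h0 => simp
  | ha a b h1 h2 => rw [mul_add, add_mul, trace_add, trace_add, h1, h2]
  | hs c a h => rw [mul_smul_comm, smul_mul_assoc, trace_smul, trace_smul, h]

open scoped Classical in
/-- The projection of the Hecke algebra onto a parabolic subalgebra. -/
noncomputable def proj (K : Subgroup (Equiv.Perm (Fin r))) (a : Hecke q r) : Hecke q r :=
  ∑ k with k ∈ K, trace q (a * heckeT q k⁻¹) • heckeT q k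

theorem proj_mem (K : Subgroup (Equiv.Perm (Fin r))) (a : Hecke q r) :
    proj q K a ∈ heckeSub q K :=
  sum_mem fun k hk => Submodule.smul_mem _ _ (heckeT_mem q (by simpa using hk))

open scoped Classical in
theorem sum_trace_smul {G : Subgroup (Equiv.Perm (Fin r))} {a : Hecke q r}
    (ha : a ∈ heckeSub q G) :
    ∑ w with w ∈ G, trace q (a * heckeT q w⁻¹) • heckeT q w = a := by
  induction ha using Submodule.span_induction with
  | mem x hx =>
    obtain ⟨u, hu, rfl⟩ := hx
    simp only [trace_heckeT_mul, inv_inv, ite_smul, one_smul, zero_smul]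
    rw [Finset.sum_ite_eq, if_pos (by simpa using hu)]
  | zero => simp [trace_zero]
  | add x y _ _ hx hy =>
    simp only [add_mul, trace_add, add_smul, Finset.sum_add_distrib, hx, hy]
  | smul c x _ hx =>
    simp only [smul_mul_assoc, trace_smul, mul_smul, ← Finset.smul_sum, hx]

variable {α : Type*} [LinearOrder α] {β : Fin r → α}

theorem heckeT_mul_distinguished (hβ : Monotone β) {u d : Equiv.Perm (Fin r)}
    (hd : d ∈ distinguished (stab β)) (hu : u ∈ stab β) :
    heckeT q (u * d) = heckeT q u * heckeT q d :=
  heckeT_mul q (ninv_mul' hβ ((mem_distinguished_stab hβ).1 hd) hu)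

theorem heckeT_inv_mul_distinguished (hβ : Monotone β) {u d : Equiv.Perm (Fin r)}
    (hd : d ∈ distinguished (stab β)) (hu : u ∈ stab β) :
    heckeT q (u * d)⁻¹ = heckeT q d⁻¹ * heckeT q u⁻¹ := by
  rw [mul_inv_rev, heckeT_mul]
  rw [← mul_inv_rev, ninv_inv, ninv_inv, ninv_inv,
    ninv_mul' hβ ((mem_distinguished_stab hβ).1 hd) hu, add_comm]

open scoped Classical in
-- The dual-basis expansion over `G`, grouped by cosets: `a` is written in the left basis `T_d` over
-- the parabolic subalgebra. The next lemma is its mirror image.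
theorem sum_proj_mul (hβ : Monotone β) {G : Subgroup (Equiv.Perm (Fin r))} (hG : stab β ≤ G)
    {a : Hecke q r} (ha : a ∈ heckeSub q G) :
    ∑ d with d ∈ distinguished (stab β) ∧ d ∈ G, proj q (stab β) (a * heckeT q d⁻¹) * heckeT q d =
      a := by
  conv_rhs => rw [← sum_trace_smul q ha, sum_mul_distinguished hβ hG]
  refine Finset.sum_congr rfl fun d hd => ?_
  rw [Finset.mem_filter_univ] at hd
  rw [proj, Finset.sum_mul]
  refine Finset.sum_congr rfl fun k hk => ?_
  rw [Finset.mem_filter_univ] at hk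
  rw [heckeT_mul_distinguished q hβ hd.1 hk, heckeT_inv_mul_distinguished q hβ hd.1 hk, mul_assoc,
    smul_mul_assoc]

open scoped Classical in
theorem sum_mul_proj (hβ : Monotone β) {G : Subgroup (Equiv.Perm (Fin r))} (hG : stab β ≤ G)
    {a : Hecke q r} (ha : a ∈ heckeSub q G) :
    ∑ d with d ∈ distinguished (stab β) ∧ d ∈ G,
      heckeT q d⁻¹ * proj q (stab β) (heckeT q d * a) = a := by
  conv_rhs => rw [← sum_trace_smul q ha, sum_mem_inv]
  simp only [inv_mem_iff, inv_inv]
  rw [sum_mul_distinguished hβ hG]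
  refine Finset.sum_congr rfl fun d hd => ?_
  rw [Finset.mem_filter_univ] at hd
  rw [proj, Finset.mul_sum, sum_mem_inv]
  simp only [inv_mem_iff, inv_inv]
  refine Finset.sum_congr rfl fun k hk => ?_
  rw [Finset.mem_filter_univ] at hk
  rw [heckeT_mul_distinguished q hβ hd.1 hk, heckeT_inv_mul_distinguished q hβ hd.1 hk,
    mul_smul_comm, trace_mul_comm, ← mul_assoc, trace_mul_comm]

end Trace

/-! ### Relative norms: image, transitivity and conjugation. -/

section Norm

variable {F : Type*} [Field F] {m n r : ℕ} (q : Fˣ)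

open scoped Classical in
theorem relNorm_apply (G K : Subgroup (Equiv.Perm (Fin r)))
    (f : Module.End F (TensorSpace F m n r)) :
    relNorm q G K f = ∑ w with w ∈ distinguished K ∧ w ∈ G,
      rightMul q (heckeT q w) * f * rightMul q (heckeT q w⁻¹) := by
  simp [relNorm, mul_assoc]

theorem mem_heckeEnd {K : Subgroup (Equiv.Perm (Fin r))}
    {f : Module.End F (TensorSpace F m n r)} :
    f ∈ heckeEnd m n q K ↔ ∀ h ∈ heckeSub q K, f * rightMul q h = rightMul q h * f :=
  ⟨fun hf h hh => LinearMap.ext fun v => hf h hh v,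
    fun hf h hh v => LinearMap.congr_fun (hf h hh) v⟩

theorem mem_heckeEnd_of_heckeT {K : Subgroup (Equiv.Perm (Fin r))}
    {f : Module.End F (TensorSpace F m n r)}
    (h : ∀ w ∈ K, f * rightMul q (heckeT q w) = rightMul q (heckeT q w) * f) :
    f ∈ heckeEnd m n q K := by
  rw [mem_heckeEnd]
  intro a ha
  induction ha using Submodule.span_induction with
  | mem x hx =>
    obtain ⟨w, hw, rfl⟩ := hx
    exact h w hw
  | zero => simp [rightMul_zero]
  | add x y _ _ hx hy => rw [rightMul_add, mul_add, add_mul, hx, hy]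
  | smul c x _ hx => rw [rightMul_smul, mul_smul_comm, smul_mul_assoc, hx]

variable {α α' : Type*} [LinearOrder α] [LinearOrder α'] {β : Fin r → α} {ρ : Fin r → α'}

/-- A relative Casimir argument: expand `T_d a` in the left basis `T_{d'}`, pass the coefficients,
which lie in the parabolic subalgebra, through `f`, and reassemble them with the `T_{d⁻¹}` into `a
T_{d'⁻¹}`. -/
theorem relNorm_mem_heckeEnd (hβ : Monotone β) {G : Subgroup (Equiv.Perm (Fin r))}
    (hG : stab β ≤ G) (hmul : ∀ a ∈ heckeSub q G, ∀ b ∈ heckeSub q G, a * b ∈ heckeSub q G)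
    {f : Module.End F (TensorSpace F m n r)} (hf : f ∈ heckeEnd m n q (stab β)) :
    relNorm q G (stab β) f ∈ heckeEnd m n q G := by
  classical
  rw [mem_heckeEnd] at hf ⊢
  intro a ha
  have hL (d : Equiv.Perm (Fin r)) (hd : d ∈ G) := sum_proj_mul q hβ hG (hmul _ (heckeT_mem q hd) _ ha)
  have hR (d : Equiv.Perm (Fin r)) (hd : d ∈ G) :=
    sum_mul_proj q hβ hG (hmul _ ha _ (heckeT_mem q (inv_mem hd)))
  rw [relNorm_apply, Finset.mul_sum, Finset.sum_mul]
  symm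
  calc _ = ∑ d with d ∈ distinguished (stab β) ∧ d ∈ G,
        ∑ d' with d' ∈ distinguished (stab β) ∧ d' ∈ G,
          rightMul q (heckeT q d') * f *
            rightMul q (heckeT q d⁻¹ * proj q (stab β) (heckeT q d * a * heckeT q d'⁻¹)) := by
        refine Finset.sum_congr rfl fun d hd => ?_
        rw [Finset.mem_filter_univ] at hd
        rw [← mul_assoc, ← mul_assoc, ← rightMul_mul, ← hL d hd.2, rightMul_sum, Finset.sum_mul,
          Finset.sum_mul]
        refine Finset.sum_congr rfl fun d' _ => ?_
        rw [rightMul_mul, mul_assoc (rightMul q _), ← hf _ (proj_mem q _ _), hL d hd.2,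
          rightMul_mul]
        simp only [mul_assoc]
    _ = _ := by
        rw [Finset.sum_comm]
        refine Finset.sum_congr rfl fun d' hd' => ?_
        rw [Finset.mem_filter_univ] at hd'
        rw [← Finset.mul_sum, ← rightMul_sum]
        simp only [mul_assoc (heckeT q _) a]
        rw [hR d' hd'.2, rightMul_mul, ← mul_assoc]

/-- Shortest representatives for the smaller subgroup factor uniquely as `u * d` with lengths
adding, so `T_{u d} = T_u T_d`. -/
theorem relNorm_trans (hβ : Monotone β) (hρ : Monotone ρ) (h : stab ρ ≤ stab β)
    (f : Module.End F (TensorSpace F m n r)) :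
    relNorm q ⊤ (stab ρ) f = relNorm q ⊤ (stab β) (relNorm q (stab β) (stab ρ) f) := by
  classical
  rw [relNorm_apply, relNorm_apply, relNorm_apply, sum_distinguished_trans hβ hρ h]
  refine Finset.sum_congr rfl fun d hd => ?_
  rw [Finset.mem_filter_univ] at hd
  rw [Finset.mul_sum, Finset.sum_mul]
  refine Finset.sum_congr rfl fun u hu => ?_
  rw [Finset.mem_filter_univ] at hu
  rw [heckeT_mul_distinguished q hβ hd.1 hu.2, heckeT_inv_mul_distinguished q hβ hd.1 hu.2,
    rightMul_mul, rightMul_mul]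
  simp only [mul_assoc]

theorem mem_conjSub {K : Subgroup (Equiv.Perm (Fin r))} {x w : Equiv.Perm (Fin r)} :
    w ∈ conjSub K x ↔ x * w * x⁻¹ ∈ K := by
  rw [conjSub, Subgroup.mem_map]
  constructor
  · rintro ⟨k, hk, rfl⟩
    simpa [mul_assoc] using hk
  · intro h
    exact ⟨_, h, by simp [mul_assoc]⟩

/-- The right coset of `stab β` through `x` is also the left coset of `stab ρ` through `x`, so
shortest in one means shortest in the other. -/
theorem incrOn_of_conj {ι ι' : Type*} [LinearOrder ι'] {β : Fin r → ι} {ρ : Fin r → ι'} {x : Equiv.Perm (Fin r)}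
    (hx : x ∈ distinguished (stab β)) (h : conjSub (stab β) x = stab ρ) (hρ : Monotone ρ) :
    IncrOn ρ x := by
  rw [← inv_inv x, ← mem_distinguished_stab hρ]
  intro w hw
  rw [← h, mem_conjSub] at hw
  have := hx _ (inv_mem hw)
  rw [len_eq_ninv, len_eq_ninv, ← ninv_inv (w * x⁻¹), ninv_inv]
  rw [len_eq_ninv, len_eq_ninv] at this
  simpa [mul_assoc] using this

/-- The relative norms from two conjugate parabolic subgroups agree. -/
theorem relNorm_conj (hβ : Monotone β) (hρ : Monotone ρ) {x : Equiv.Perm (Fin r)}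
    (hx : x ∈ distinguished (stab β)) (h : conjSub (stab β) x = stab ρ)
    {f : Module.End F (TensorSpace F m n r)} (hf : f ∈ heckeEnd m n q (stab β)) :
    ∃ g ∈ heckeEnd m n q (stab ρ), relNorm q ⊤ (stab β) f = relNorm q ⊤ (stab ρ) g := by
  classical
  obtain ⟨y, hy1, hy2⟩ := exists_heckeT_inv q x
  have hxρ := incrOn_of_conj hx h hρ
  have hmem (k : Equiv.Perm (Fin r)) (hk : k ∈ stab ρ) : x * k * x⁻¹ ∈ stab β := by
    rwa [← h, mem_conjSub] at hk
  -- Since `x` is shortest on both sides, `T_x` intertwines the two parabolic subalgebras. Hence the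
  -- conjugate of `f` by `T_x` is the required `g`.
  have hT (k : Equiv.Perm (Fin r)) (hk : k ∈ stab ρ) :
      heckeT q x * heckeT q k = heckeT q (x * k * x⁻¹) * heckeT q x := by
    rw [← heckeT_mul q (ninv_mul hρ hxρ hk), ← heckeT_mul_distinguished q hβ hx (hmem k hk)]
    simp
  have hT' (k : Equiv.Perm (Fin r)) (hk : k ∈ stab ρ) :
      heckeT q k * y = y * heckeT q (x * k * x⁻¹) := by
    calc heckeT q k * y = y * (heckeT q x * heckeT q k) * y := by rw [← mul_assoc, hy2, one_mul]
      _ = _ := by rw [hT k hk, mul_assoc, mul_assoc, hy1, mul_one]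
  refine ⟨rightMul q (heckeT q x) * f * rightMul q y, ?_, ?_⟩
  · refine mem_heckeEnd_of_heckeT q fun k hk => ?_
    have hf' := (mem_heckeEnd q).1 hf _ (heckeT_mem q (hmem k hk))
    rw [mul_assoc, ← rightMul_mul, hT' k hk, rightMul_mul, ← mul_assoc, mul_assoc _ f, hf',
      ← mul_assoc, ← mul_assoc, ← mul_assoc, ← rightMul_mul, ← rightMul_mul, hT k hk]
  · have hproj (a : Hecke q r) : heckeT q x * proj q (stab ρ) a =
        proj q (stab β) (heckeT q x * a * y) * heckeT q x := by
      rw [proj, proj, Finset.mul_sum, Finset.sum_mul]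
      refine Finset.sum_bij' (fun k _ => x * k * x⁻¹) (fun k _ => x⁻¹ * k * x) ?_ ?_ ?_ ?_ ?_
      · intro k hk
        rw [Finset.mem_filter_univ] at hk ⊢
        exact hmem k hk
      · intro k hk
        rw [Finset.mem_filter_univ] at hk ⊢
        rw [← h, mem_conjSub]
        simpa [mul_assoc] using hk
      · intro k _; simp [mul_assoc]
      · intro k _; simp [mul_assoc]
      · intro k hk
        rw [Finset.mem_filter_univ] at hk
        have h1 : (x * k * x⁻¹)⁻¹ = x * k⁻¹ * x⁻¹ := by simp [mul_assoc]
        rw [mul_smul_comm, hT k hk, smul_mul_assoc, h1, mul_assoc (heckeT q x * a),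
          ← hT' _ (inv_mem hk), trace_mul_comm _ (heckeT q x * a), ← mul_assoc, trace_mul_comm,
          mul_assoc _ y, hy2, mul_one]
    rw [mem_heckeEnd] at hf
    rw [relNorm_apply, relNorm_apply]
    have hmemtop (a : Hecke q r) : a ∈ heckeSub q (⊤ : Subgroup (Equiv.Perm (Fin r))) := by
      rw [heckeSub_top]; trivial
    -- Besides the `T_d`, the elements `T_x T_w` also form a left basis over the first parabolic
    -- subalgebra. Changing between the two bases proves that the norms agree.
    have hL (d : Equiv.Perm (Fin r)) : ∑ w with w ∈ distinguished (stab ρ) ∧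
        w ∈ (⊤ : Subgroup (Equiv.Perm (Fin r))),
          proj q (stab β) (heckeT q d * (heckeT q w⁻¹ * y)) * heckeT q x * heckeT q w =
        heckeT q d := by
      have h1 := congrArg (heckeT q x * ·) (sum_proj_mul q hρ le_top (hmemtop (y * heckeT q d)))
      rw [Finset.mul_sum, ← mul_assoc, hy1, one_mul] at h1
      refine Eq.trans (Finset.sum_congr rfl fun w _ => ?_) h1
      rw [← mul_assoc (heckeT q x), hproj]
      simp only [← mul_assoc, hy1, one_mul]
    calc _ = ∑ d with d ∈ distinguished (stab β) ∧ d ∈ (⊤ : Subgroup (Equiv.Perm (Fin r))),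
          ∑ w with w ∈ distinguished (stab ρ) ∧ w ∈ (⊤ : Subgroup (Equiv.Perm (Fin r))),
            rightMul q (heckeT q x * heckeT q w) * f * rightMul q (heckeT q d⁻¹ *
              proj q (stab β) (heckeT q d * (heckeT q w⁻¹ * y))) := by
          refine Finset.sum_congr rfl fun d _ => ?_
          conv_lhs => rw [← hL d]
          rw [rightMul_sum, Finset.sum_mul, Finset.sum_mul]
          refine Finset.sum_congr rfl fun w _ => ?_
          rw [mul_assoc (proj q _ _), rightMul_mul, mul_assoc (rightMul q _) _ f,
            ← hf _ (proj_mem q _ _), rightMul_mul q (heckeT q d⁻¹)]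
          simp only [mul_assoc]
      _ = _ := by
          rw [Finset.sum_comm]
          refine Finset.sum_congr rfl fun w _ => ?_
          rw [← Finset.mul_sum, ← rightMul_sum, sum_mul_proj q hβ le_top (hmemtop _),
            rightMul_mul, rightMul_mul]
          simp only [mul_assoc]

end Norm

/-! ### Matrix units as eigenvectors of parabolic subalgebras. -/

section MatUnit

variable {F : Type*} [Field F] {m n r : ℕ} (q : Fˣ)

theorem matUnit_apply (i j : Fin r → Fin (m + n)) (x : TensorSpace F m n r) :
    matUnit F i j x = form F m n r x (tensorBasis F m n r i) • tensorBasis F m n r j := by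
  have : matUnit F i j = ((form F m n r).flip (tensorBasis F m n r i)).smulRight
      (tensorBasis F m n r j) := by
    refine (tensorBasis F m n r).ext fun k => ?_
    rw [matUnit, Module.Basis.constr_basis, LinearMap.smulRight_apply, LinearMap.flip_apply,
      form_basis, ite_smul, one_smul, zero_smul]
  rw [this]
  rfl

variable {α α' : Type*} [LinearOrder α] [LinearOrder α'] {γ : Fin r → α} {ρ : Fin r → α'}
  {i j : Fin r → Fin (m + n)}

/-- Both ends of an inversion of `u` lie in one class, so weights at singleton classes never enter.
This is why parity matters only on classes with two elements. -/
theorem invProd_congr {M : Type*} [CommMonoid M] {e e' : Fin r → M} (hγ : Monotone γ)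
    {u : Equiv.Perm (Fin r)} (hu : u ∈ stab γ)
    (h : ∀ a b, a ≠ b → γ a = γ b → e a = e' a) : invProd e u = invProd e' u := by
  refine Finset.prod_congr rfl fun p hp => ?_
  rw [mem_inversions] at hp
  refine h _ p.2 hp.1.ne (le_antisymm (hγ hp.1.le) ?_)
  rw [← hu p.1, ← hu p.2]
  exact hγ hp.2.le

theorem invProd_inv {M : Type*} [CommMonoid M] {e : Fin r → M} (hγ : Monotone γ)
    {u : Equiv.Perm (Fin r)} (hu : u ∈ stab γ) (he : ∀ a b, γ a = γ b → e a = e b) :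
    invProd e u⁻¹ = invProd e u := by
  refine Finset.prod_bij' (fun p _ => (u⁻¹ p.2, u⁻¹ p.1)) (fun p _ => (u p.2, u p.1)) ?_ ?_ ?_ ?_ ?_
  · intro p hp
    rw [mem_inversions] at hp
    simpa [mem_inversions] using hp.symm
  · intro p hp
    rw [mem_inversions] at hp
    simpa [mem_inversions] using hp.symm
  · simp
  · simp
  · intro p hp
    rw [mem_inversions] at hp
    refine he _ _ (le_antisymm ?_ ?_)
    · rw [mem_stab.1 (inv_mem hu)]
      exact hγ hp.1.le
    · rw [← mem_stab.1 (inv_mem hu) p.1]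
      exact hγ hp.2.le

/-- The words `i` and `j` are constant on the classes of `γ`, and of the same parity on every class
with at least two elements. -/
structure Compatible (γ : Fin r → α) (i j : Fin r → Fin (m + n)) : Prop where
  left : ∀ a b, γ a = γ b → i a = i b
  right : ∀ a b, γ a = γ b → j a = j b
  parity : ∀ a b, a ≠ b → γ a = γ b → (IsOdd (i a) ↔ IsOdd (j a))

theorem Compatible.rightMul_right (hγ : Monotone γ) (h : Compatible γ i j)
    {u : Equiv.Perm (Fin r)} (hu : u ∈ stab γ) :
    rightMul q (heckeT q u) (tensorBasis F m n r j) =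
      invProd (fun p => diagCoef (q : F) (i p)) u • tensorBasis F m n r j := by
  rw [rightMul_basis_of_mem_stab q hγ h.right hu]
  congr 1
  refine invProd_congr hγ hu fun a b hab hγab => ?_
  simp only [diagCoef, h.parity a b hab hγab]

theorem Compatible.mul_matUnit (hγ : Monotone γ) (h : Compatible γ i j)
    {u : Equiv.Perm (Fin r)} (hu : u ∈ stab γ) :
    rightMul q (heckeT q u) * matUnit F i j =
      invProd (fun p => diagCoef (q : F) (i p)) u • matUnit F i j := by
  refine LinearMap.ext fun x => ?_
  rw [Module.End.mul_apply, LinearMap.smul_apply, matUnit_apply, map_smul,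
    h.rightMul_right q hγ hu, smul_comm]

theorem Compatible.matUnit_mul (hγ : Monotone γ) (h : Compatible γ i j)
    {u : Equiv.Perm (Fin r)} (hu : u ∈ stab γ) :
    matUnit F i j * rightMul q (heckeT q u) =
      invProd (fun p => diagCoef (q : F) (i p)) u • matUnit F i j := by
  refine LinearMap.ext fun x => ?_
  rw [Module.End.mul_apply, LinearMap.smul_apply, matUnit_apply, matUnit_apply, form_rightMul,
    rightMul_basis_of_mem_stab q hγ h.left (inv_mem hu), map_smul,
    invProd_inv hγ hu fun a b hab => by rw [h.left a b hab], smul_smul, smul_eq_mul]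

theorem Compatible.matUnit_mem (hγ : Monotone γ) (h : Compatible γ i j) :
    matUnit F i j ∈ heckeEnd m n q (stab γ) :=
  mem_heckeEnd_of_heckeT q fun u hu => by rw [h.matUnit_mul q hγ hu, h.mul_matUnit q hγ hu]

/-- The exponents for which the square of the character of a word is a power of `q ^ 2`. -/
def parityExp (l : ℕ) (i : Fin r → Fin (m + n)) (p : Fin r) : ℕ :=
  if IsOdd (i p) then 2 * l - 1 else 1

/-- An odd letter gives `q⁻²`, which is `(q ^ 2) ^ (2 * l - 1)`. The exponent `l - 1` would serve
equally here, but it vanishes for `l = 1`, and positivity is needed for the root count. -/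
theorem diagCoef_sq {l : ℕ} (hl : 0 < l) (hq : (q : F) ^ l = 1) (i : Fin r → Fin (m + n))
    (p : Fin r) :
    diagCoef (q : F) (i p) * diagCoef (q : F) (i p) = ((q : F) ^ 2) ^ parityExp l i p := by
  unfold diagCoef parityExp
  split_ifs
  · rw [neg_mul_neg, ← mul_inv]
    refine (eq_inv_of_mul_eq_one_left ?_).symm
    rw [← pow_two, ← pow_succ, ← pow_mul, show 2 * (2 * l - 1 + 1) = l * 4 by omega, pow_mul, hq,
      one_pow]
  · rw [pow_one, pow_two]

theorem invProd_mul_self {l : ℕ} (hl : 0 < l) (hq : (q : F) ^ l = 1) (i : Fin r → Fin (m + n))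
    (u : Equiv.Perm (Fin r)) :
    invProd (fun p => diagCoef (q : F) (i p)) u * invProd (fun p => diagCoef (q : F) (i p)) u =
      invProd (fun p => ((q : F) ^ 2) ^ parityExp l i p) u := by
  rw [invProd, ← Finset.prod_mul_distrib]
  exact Finset.prod_congr rfl fun p _ => diagCoef_sq q hl hq i p.1

open scoped Classical in
-- In the inner norm from `stab ρ` to `stab γ`, the factors `T_{u⁻¹}` and `T_u` contribute the same
-- character value, whence its square.
theorem Compatible.relNorm_matUnit (hγ : Monotone γ) (hρ : Monotone ρ) (hle : stab ρ ≤ stab γ)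
    (h : Compatible γ i j) {l : ℕ} (hl : 0 < l) (hq : (q : F) ^ l = 1) :
    relNorm q ⊤ (stab ρ) (matUnit F i j) =
      (∑ d with IncrOn ρ d ∧ d ∈ stab γ, invProd (fun p => ((q : F) ^ 2) ^ parityExp l i p) d) •
        relNorm q ⊤ (stab γ) (matUnit F i j) := by
  rw [relNorm_trans q hγ hρ hle, ← map_smul]
  congr 1
  rw [relNorm_apply, Finset.sum_smul, sum_mem_inv]
  simp only [mem_distinguished_stab hρ, inv_inv, inv_mem_iff]
  refine Finset.sum_congr rfl fun u hu => ?_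
  rw [Finset.mem_filter_univ] at hu
  rw [h.mul_matUnit q hγ (inv_mem hu.2), smul_mul_assoc, h.matUnit_mul q hγ hu.2,
    invProd_inv hγ hu.2 (fun a b hab => by rw [h.left a b hab]), smul_smul,
    invProd_mul_self q hl hq]

end MatUnit

/-! ### Combinatorics of compositions. -/

section Lists

theorem blockIdx_mono (L : List ℕ) : Monotone (blockIdx L) := by
  induction L with
  | nil => exact fun _ _ _ => le_rfl
  | cons a L ih =>
    intro x y hxy
    simp only [blockIdx]
    split_ifs
    · exact le_rfl
    · exact Nat.zero_le _
    · omega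
    · exact Nat.succ_le_succ (ih (by omega))

theorem blockIdx_append (A B : List ℕ) (p : ℕ) :
    blockIdx (A ++ B) p =
      if p < A.sum then blockIdx A p else A.length + blockIdx B (p - A.sum) := by
  induction A generalizing p with
  | nil => simp
  | cons a A ih =>
    simp only [List.cons_append, blockIdx, ih, List.sum_cons, List.length_cons]
    by_cases h1 : p < a
    · simp [h1, show p < a + A.sum by omega]
    · by_cases h2 : p < a + A.sum
      · simp [h1, h2, show p - a < A.sum by omega]
      · simp only [h1, h2, show ¬ p - a < A.sum by omega, if_false, Nat.sub_sub]
        omega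

theorem blockIdx_replicate {k l p : ℕ} (h : p < k * l) : blockIdx (List.replicate k l) p = p / l := by
  induction k generalizing p with
  | zero => simp at h
  | succ k ih =>
    rw [List.replicate_succ, blockIdx]
    split_ifs with h1
    · rw [Nat.div_eq_of_lt h1]
    · rw [Nat.succ_mul] at h
      have hl : 0 < l := Nat.pos_of_ne_zero (by rintro rfl; simp at h)
      rw [ih (p := p - l) (by omega), Nat.div_eq p, if_pos ⟨hl, by omega⟩]

theorem blockIdx_theta {l k r p : ℕ} (hp : p < r) :
    blockIdx (theta l k r) p = if p < k * l then p / l else k + (p - k * l) := by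
  rw [theta, blockIdx_append, List.sum_replicate, smul_eq_mul]
  split_ifs with h
  · exact blockIdx_replicate h
  · rw [List.length_replicate, blockIdx_replicate (by omega), Nat.div_one]

theorem sum_theta {l k r : ℕ} (hk : k * l ≤ r) : (theta l k r).sum = r := by
  simp [theta]
  omega

/-- Subdividing every part refines the blocks. It is used to see that `P_ν` lies in `W_ν`. -/
theorem blockIdx_flatMap {f : ℕ → List ℕ} (hf : ∀ a, (f a).sum = a) {L : List ℕ} {x y : ℕ}
    (hxy : x ≤ y) (hy : y < L.sum) (h : blockIdx (L.flatMap f) x = blockIdx (L.flatMap f) y) :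
    blockIdx L x = blockIdx L y := by
  induction L generalizing x y with
  | nil => rfl
  | cons a L ih =>
    rw [List.flatMap_cons, blockIdx_append, blockIdx_append, hf] at h
    rw [List.sum_cons] at hy
    simp only [blockIdx]
    by_cases h1 : x < a
    · by_cases h2 : y < a
      · simp [h1, h2]
      · rw [if_pos h1, if_neg h2] at h
        have := blockIdx_lt (f a) x (by rwa [hf])
        omega
    · have h2 : ¬ y < a := by omega
      rw [if_neg h1, if_neg h2] at h ⊢
      rw [ih (x := x - a) (y := y - a) (by omega) (by omega) (by omega)]

theorem sum_maxLPart (l a : ℕ) :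
    (List.replicate (a / l) l ++ List.replicate (a % l) 1).sum = a := by
  simp [Nat.div_add_mod']

theorem sum_maxLComp (l : ℕ) (L : List ℕ) : (maxLComp l L).sum = L.sum := by
  induction L with
  | nil => rfl
  | cons a L ih =>
    rw [maxLComp, List.flatMap_cons, List.sum_append, sum_maxLPart, List.sum_cons]
    exact congrArg (a + ·) ih

theorem sum_div_maxLComp {l : ℕ} (hl : 0 < l) (L : List ℕ) :
    ((maxLComp l L).map (· / l)).sum = (L.map (· / l)).sum := by
  induction L with
  | nil => rfl
  | cons a L ih =>
    rw [maxLComp, List.flatMap_cons, List.map_append, List.sum_append, List.map_cons,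
      List.sum_cons]
    refine congrArg₂ (· + ·) ?_ ih
    rw [List.map_append, List.sum_append, List.map_replicate, List.map_replicate,
      List.sum_replicate, List.sum_replicate, Nat.div_self hl, smul_eq_mul, mul_one, smul_eq_mul]
    -- A part `1` contributes `1 / l`, which is zero unless `l = 1`; in that case the remainders
    -- vanish and there are no such parts.
    rcases Nat.eq_or_lt_of_le hl with h | h
    · simp [← h, Nat.mod_one]
    · simp [Nat.div_eq_of_lt h]

theorem maxLComp_perm (l : ℕ) (L : List ℕ) :
    (maxLComp l L).Perm
      (List.replicate (L.map (· / l)).sum l ++ List.replicate (L.map (· % l)).sum 1) := by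
  induction L with
  | nil => exact List.Perm.refl _
  | cons a L ih =>
    rw [maxLComp, List.flatMap_cons, List.map_cons, List.sum_cons, List.map_cons, List.sum_cons,
      List.replicate_add, List.replicate_add, List.append_assoc, List.append_assoc]
    refine List.Perm.append_left _ ?_
    refine (List.Perm.append_left _ ih).trans ?_
    rw [← List.append_assoc, ← List.append_assoc]
    exact List.Perm.append_right _ List.perm_append_comm

theorem sum_div_mul_add_sum_mod (l : ℕ) (L : List ℕ) :
    (L.map (· / l)).sum * l + (L.map (· % l)).sum = L.sum := by
  induction L with
  | nil => simp
  | cons a L ih =>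
    simp only [List.map_cons, List.sum_cons, add_mul]
    have := Nat.div_add_mod' a l
    omega

theorem count_blockIdx (L : List ℕ) (t : ℕ) :
    Nat.count (fun p => blockIdx L p = t) L.sum = L.getD t 0 := by
  induction L generalizing t with
  | nil => simp
  | cons a L ih =>
    rw [List.sum_cons, Nat.count_add]
    have h1 : Nat.count (fun p => blockIdx (a :: L) (a + p) = t) L.sum =
        Nat.count (fun p => blockIdx L p + 1 = t) L.sum := by
      simp [blockIdx]
    have h2 : Nat.count (fun p => blockIdx (a :: L) p = t) a = if t = 0 then a else 0 := by
      rw [Nat.count_eq_card_filter_range]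
      split_ifs with h
      · rw [Finset.filter_true_of_mem, Finset.card_range]
        intro p hp
        simp [blockIdx, Finset.mem_range.1 hp, h]
      · rw [Finset.filter_false_of_mem, Finset.card_empty]
        intro p hp
        simp [blockIdx, Finset.mem_range.1 hp, Ne.symm h]
    rw [h1, h2]
    cases t with
    | zero => simp [Nat.count_eq_card_filter_range]
    | succ t => simp [ih]

/-- The rank of a position within its block. -/
def natRank (L : List ℕ) (p : ℕ) : ℕ := Nat.count (fun i => blockIdx L i = blockIdx L p) (p + 1)

theorem natRank_cons_of_lt {a : ℕ} {L : List ℕ} {p : ℕ} (h : p < a) :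
    natRank (a :: L) p = p + 1 := by
  rw [natRank, Nat.count_eq_card_filter_range, Finset.filter_true_of_mem, Finset.card_range]
  intro i hi
  rw [Finset.mem_range] at hi
  simp [blockIdx, h, show i < a by omega]

theorem natRank_cons_add (a : ℕ) (L : List ℕ) (p : ℕ) :
    natRank (a :: L) (a + p) = natRank L p := by
  rw [natRank, add_assoc, Nat.count_add, natRank]
  have : Nat.count (fun i => blockIdx (a :: L) i = blockIdx (a :: L) (a + p)) a = 0 := by
    rw [Nat.count_eq_card_filter_range, Finset.filter_false_of_mem, Finset.card_empty]
    intro i hi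
    simp [blockIdx, Finset.mem_range.1 hi]
  rw [this]
  simp [blockIdx]

/-- The ranks in a part `a` are `1, …, a`, of which `a / l` are multiples of `l`. -/
theorem count_dvd_natRank {l : ℕ} (L : List ℕ) :
    Nat.count (fun p => l ∣ natRank L p) L.sum = (L.map (· / l)).sum := by
  induction L with
  | nil => simp
  | cons a L ih =>
    rw [List.sum_cons, Nat.count_add, List.map_cons, List.sum_cons]
    simp only [natRank_cons_add, ih]
    congr 1
    rw [Nat.count_eq_card_filter_range, ← Nat.card_multiples a l]
    congr 1
    refine Finset.filter_congr fun p hp => ?_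
    rw [natRank_cons_of_lt (Finset.mem_range.1 hp)]

theorem card_filter_fin (r : ℕ) (P : ℕ → Prop) [DecidablePred P] :
    (Finset.univ.filter fun p : Fin r => P p.1).card = Nat.count P r := by
  rw [Nat.count_eq_card_filter_range]
  refine Finset.card_bij (fun p _ => p.1) ?_ ?_ ?_
  · intro p hp
    simp at hp ⊢
    exact hp
  · intro p _ p' _ h
    exact Fin.ext h
  · intro p hp
    simp only [Finset.mem_filter, Finset.mem_range] at hp
    exact ⟨⟨p, hp.1⟩, by simpa using hp.2, rfl⟩

/-- The labelling of the positions by the blocks of a composition. -/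
def blockFun (r : ℕ) (L : List ℕ) (p : Fin r) : ℕ := blockIdx L p.1

theorem blockFun_mono (r : ℕ) (L : List ℕ) : Monotone (blockFun r L) :=
  fun _ _ h => blockIdx_mono L h

theorem parabolic_eq_stab (r : ℕ) (L : List ℕ) : parabolic r L = stab (blockFun r L) := rfl

theorem rank_blockFun (r : ℕ) (L : List ℕ) (p : Fin r) :
    rank (blockFun r L) p = natRank L p.1 := by
  rw [rank, natRank, Nat.count_eq_card_filter_range]
  refine Finset.card_bij (fun i _ => i.1) ?_ ?_ ?_
  · intro i hi
    simp only [Finset.mem_filter, Finset.mem_univ, true_and, Finset.mem_range] at hi ⊢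
    exact ⟨Nat.lt_succ_of_le hi.1, hi.2⟩
  · intro i _ i' _ h
    exact Fin.ext h
  · intro i hi
    simp only [Finset.mem_filter, Finset.mem_range] at hi
    have hp := p.2
    refine ⟨⟨i, by omega⟩, ?_, rfl⟩
    rw [Finset.mem_filter_univ]
    exact ⟨Fin.le_def.2 (Nat.lt_succ_iff.1 hi.1), hi.2⟩

theorem fullCount_blockFun {l r : ℕ} {L : List ℕ} (hL : L.sum = r) :
    fullCount l (blockFun r L) = (L.map (· / l)).sum := by
  rw [fullCount, ← count_dvd_natRank, hL, ← card_filter_fin]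
  simp only [rank_blockFun]

theorem card_blockFun {r : ℕ} {L : List ℕ} (hL : L.sum = r) (t : ℕ) :
    (Finset.univ.filter fun p => blockFun r L p = t).card = L.getD t 0 := by
  rw [← count_blockIdx, hL, ← card_filter_fin]
  rfl

theorem blockIdx_eq_of_take {L : List ℕ} {t p : ℕ} (h1 : (L.take t).sum ≤ p)
    (h2 : p < (L.take (t + 1)).sum) : blockIdx L p = t := by
  induction L generalizing t p with
  | nil => simp at h2
  | cons a L ih =>
    rw [List.take_succ_cons, List.sum_cons] at h2
    cases t with
    | zero =>
      have : p < a := by simpa using h2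
      simp [blockIdx, this]
    | succ t =>
      rw [List.take_succ_cons, List.sum_cons] at h1
      rw [blockIdx, if_neg (by omega), ih (t := t) (by omega) (by omega)]

/-- The composition of the class sizes of a labelling. -/
def classSizes {r N : ℕ} (β : Fin r → Fin N) (a : Fin N) : ℕ :=
  (Finset.univ.filter fun p => β p = a).card

theorem sum_classSizes {r N : ℕ} (β : Fin r → Fin N) : ∑ a, classSizes β a = r := by
  have := Finset.card_eq_sum_card_fiberwise (f := β) (s := Finset.univ) (t := Finset.univ)
    (fun _ _ => Finset.mem_coe.2 (Finset.mem_univ _))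
  rw [Finset.card_univ, Fintype.card_fin] at this
  exact this.symm

theorem sum_take_classSizes {r N : ℕ} (β : Fin r → Fin N) (t : ℕ) :
    ((List.ofFn (classSizes β)).take t).sum = (Finset.univ.filter fun p => (β p).1 < t).card := by
  rw [List.sum_take_ofFn, Finset.card_eq_sum_card_fiberwise (f := β)
    (t := Finset.univ.filter fun a => a.1 < t) (fun p hp => by simpa using hp)]
  refine Finset.sum_congr rfl fun a ha => ?_
  rw [Finset.mem_filter_univ] at ha
  rw [classSizes, Finset.filter_filter]
  congr 1
  ext p
  simp only [Finset.mem_filter_univ]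
  exact ⟨fun h => ⟨h ▸ ha, h⟩, fun h => h.2⟩

theorem blockIdx_classSizes {r N : ℕ} {β : Fin r → Fin N} (hβ : Monotone β) (p : Fin r) :
    blockIdx (List.ofFn (classSizes β)) p.1 = (β p).1 := by
  apply blockIdx_eq_of_take
  · rw [sum_take_classSizes]
    refine (Finset.card_le_card fun p' hp' => ?_).trans_eq (Fin.card_Iio p)
    rw [Finset.mem_filter_univ] at hp'
    rw [Finset.mem_Iio]
    exact hβ.reflect_lt hp'
  · rw [sum_take_classSizes, Nat.lt_iff_add_one_le]
    refine (Fin.card_Iic p).symm.trans_le (Finset.card_le_card fun p' hp' => ?_)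
    rw [Finset.mem_Iic] at hp'
    rw [Finset.mem_filter_univ, Nat.lt_succ_iff]
    exact hβ hp'

end Lists

/-! ### Conjugacy of Young subgroups. -/

section ConjLE

variable {r : ℕ}

theorem exists_equiv_of_card {A B C : Type*} [Fintype A] [Fintype B] [DecidableEq C] {f : A → C}
    {g : B → C} (h : ∀ s, (Finset.univ.filter fun a => f a = s).card =
      (Finset.univ.filter fun b => g b = s).card) : ∃ e : A ≃ B, ∀ a, g (e a) = f a := by
  have h1 (s : C) : Nonempty ({a // f a = s} ≃ {b // g b = s}) := by
    rw [← Fintype.card_eq, Fintype.card_subtype, Fintype.card_subtype, h]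
  refine ⟨(Equiv.sigmaFiberEquiv f).symm.trans ((Equiv.sigmaCongrRight fun s => (h1 s).some).trans
    (Equiv.sigmaFiberEquiv g)), fun a => ?_⟩
  exact ((h1 (f a)).some ⟨a, rfl⟩).2

theorem card_get_eq_count (L : List ℕ) (s : ℕ) :
    (Finset.univ.filter fun a => L.get a = s).card = L.count s := by
  have h1 : (Finset.univ.val.map L.get : Multiset ℕ) = L := by
    rw [Fin.univ_val_map, List.ofFn_get]
  rw [← Multiset.coe_count, ← h1, Multiset.count_map]
  simp only [eq_comm (a := s)]
  rfl

/-- Match the parts of equal size by a bijection `e`, then choose a bijection `x` of the positions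
that carries each block of `L'` onto its partner in `L`. -/
theorem exists_conj_of_perm {L L' : List ℕ} (hp : L.Perm L') (hL : L.sum = r) :
    ∃ x, conjSub (parabolic r L) x = parabolic r L' := by
  have hL' : L'.sum = r := by rw [← hp.sum_eq, hL]
  obtain ⟨e, he⟩ := exists_equiv_of_card (f := L.get) (g := L'.get) fun s => by
    rw [card_get_eq_count, card_get_eq_count, hp.count_eq]
  let f (M : List ℕ) (hM : M.sum = r) (p : Fin r) : Fin M.length :=
    ⟨blockFun r M p, blockIdx_lt M p.1 (hM ▸ p.2)⟩
  have hf (M : List ℕ) (hM : M.sum = r) (t : Fin M.length) :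
      (Finset.univ.filter fun p => f M hM p = t).card = M.get t := by
    have := card_blockFun hM t.1
    rw [List.getD_eq_getElem _ _ t.2] at this
    rw [List.get_eq_getElem, ← this]
    congr 1
    ext p
    simp [f, Fin.ext_iff]
  obtain ⟨x, hx⟩ := exists_equiv_of_card (f := f L' hL') (g := fun p => e (f L hL p)) fun t => by
    rw [hf L' hL', ← e.apply_symm_apply t, he, ← hf L hL, e.apply_symm_apply]
    simp only [Equiv.eq_symm_apply]
  refine ⟨x, ?_⟩
  have key (a b : Fin r) : blockFun r L (x a) = blockFun r L (x b) ↔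
      blockFun r L' a = blockFun r L' b := by
    have h1 := hx a
    have h2 := hx b
    constructor
    · intro h
      have h3 : f L hL (x a) = f L hL (x b) := Fin.ext h
      rw [h3, h2] at h1
      exact congrArg Fin.val h1.symm
    · intro h
      have h3 : f L' hL' a = f L' hL' b := Fin.ext h
      rw [← h1, ← h2] at h3
      exact congrArg Fin.val (e.injective h3)
  ext w
  rw [mem_conjSub, parabolic_eq_stab, parabolic_eq_stab, mem_stab, mem_stab]
  constructor
  · intro h p
    rw [← key]
    simpa using h (x p)
  · intro h p
    have := (key (w (x⁻¹ p)) (x⁻¹ p)).2 (h _)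
    simpa using this

theorem conjSub_one (K : Subgroup (Equiv.Perm (Fin r))) : conjSub K 1 = K := by
  ext w
  simp [mem_conjSub]

theorem parabolic_theta_le {l N k : ℕ} (hN : N ≤ k) :
    parabolic r (theta l N r) ≤ parabolic r (theta l k r) := by
  rw [parabolic_eq_stab, parabolic_eq_stab, stab_le_stab_iff]
  intro a b h
  have hNk : N * l ≤ k * l := Nat.mul_le_mul_right l hN
  have hlt {p : ℕ} (hp : p < N * l) : p / l < N := Nat.div_lt_of_lt_mul (by rwa [mul_comm])
  have ha := a.2
  have hb := b.2
  unfold blockFun at h ⊢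
  rw [blockIdx_theta ha, blockIdx_theta hb] at h ⊢
  by_cases h1 : a.1 < N * l <;> by_cases h2 : b.1 < N * l
  · rw [if_pos h1, if_pos h2] at h
    rw [if_pos (by omega), if_pos (by omega), h]
  · rw [if_pos h1, if_neg h2] at h
    have := hlt h1
    omega
  · rw [if_neg h1, if_pos h2] at h
    have := hlt h2
    omega
  · rw [if_neg h1, if_neg h2] at h
    rw [show a.1 = b.1 by omega]

/-- Up to order, the parts of `P_L` are those of `theta l N r`, with `N` the number of blocks of
size `l` obtained by cutting up the parts, and `N ≤ k`. -/
theorem conjLE_of_sum_div_le {l k : ℕ} {L : List ℕ} (hL : L.sum = r)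
    (h : (L.map (· / l)).sum ≤ k) :
    ConjLE (parabolic r (maxLComp l L)) (parabolic r (theta l k r)) := by
  have h1 := sum_div_mul_add_sum_mod l L
  have hp : (maxLComp l L).Perm (theta l (L.map (· / l)).sum r) := by
    refine (maxLComp_perm l L).trans ?_
    rw [theta, show r - (L.map (· / l)).sum * l = (L.map (· % l)).sum by omega]
  obtain ⟨x, hx⟩ := exists_conj_of_perm hp (by rw [sum_maxLComp, hL])
  exact ⟨x, hx ▸ parabolic_theta_le h, _, sum_theta (by omega), hx⟩

theorem conjLE_maxLComp_one {L : List ℕ} (hL : L.sum = r)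
    (K : Subgroup (Equiv.Perm (Fin r))) : ConjLE (parabolic r (maxLComp 1 L)) K := by
  refine ⟨1, ?_, _, sum_maxLComp 1 L ▸ hL, conjSub_one _⟩
  rw [conjSub_one]
  have h1 : maxLComp 1 L = List.replicate r 1 := by
    have h2 : maxLComp 1 L = L.flatMap fun a => List.replicate a 1 := by
      simp [maxLComp, Nat.mod_one]
    rw [h2, List.eq_replicate_iff]
    refine ⟨?_, fun b hb => ?_⟩
    · simp [hL]
    · simp only [List.mem_flatMap, List.mem_replicate] at hb
      obtain ⟨_, _, _, h⟩ := hb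
      exact h
  intro w hw
  have : w = 1 := Equiv.ext fun p => by
    have h2 := hw p
    rw [h1, blockIdx_replicate (by simp), blockIdx_replicate (by simp), Nat.div_one,
      Nat.div_one] at h2
    exact Fin.ext h2
  rw [this]
  exact one_mem K

end ConjLE

/-! ### Pairs of words, double cosets and the parity condition. -/

section Labels

variable {m n r : ℕ}

theorem SuperComp.young_eq_stab (c : SuperComp m n r) : c.young = stab c.word := by
  ext w
  exact forall_congr' fun j => by simp [SuperComp.word]

theorem exists_superComp {i : Fin r → Fin (m + n)} (hi : Monotone i) :
    ∃ c : SuperComp m n r, c.word = i :=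
  ⟨⟨classSizes i, sum_classSizes i⟩, funext fun p => Fin.ext (blockIdx_classSizes hi p)⟩

/-- The labelling of the positions by the pairs of letters of two words. -/
def pairLabel (i j : Fin r → Fin (m + n)) (p : Fin r) : Fin (m + n) ×ₗ Fin (m + n) :=
  toLex (i p, j p)

theorem pairLabel_eq {i j : Fin r → Fin (m + n)} {a b : Fin r} :
    pairLabel i j a = pairLabel i j b ↔ i a = i b ∧ j a = j b := by
  simp [pairLabel]

theorem monotone_pairLabel {i j : Fin r → Fin (m + n)} :
    Monotone (pairLabel i j) ↔ Monotone i ∧ ∀ a b, a < b → i a = i b → j a ≤ j b := by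
  constructor
  · intro h
    refine ⟨fun a b hab => ?_, fun a b hab hi => ?_⟩
    · rcases Prod.Lex.toLex_le_toLex.1 (h hab) with h1 | h1
      · exact h1.le
      · exact h1.1.le
    · rcases Prod.Lex.toLex_le_toLex.1 (h hab.le) with h1 | h1
      · exact absurd hi h1.ne
      · exact h1.2
  · rintro ⟨hi, hj⟩ a b hab
    refine Prod.Lex.toLex_le_toLex.2 ?_
    rcases hab.eq_or_lt with rfl | hab'
    · exact Or.inr ⟨rfl, le_rfl⟩
    · rcases (hi hab).eq_or_lt with h | h
      · exact Or.inr ⟨h, hj _ _ hab' h⟩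
      · exact Or.inl h

theorem exists_sorted (j : Fin r → Fin (m + n)) :
    ∃ i : Fin r → Fin (m + n), Monotone i ∧ ∃ d : Equiv.Perm (Fin r), IncrOn i d⁻¹ ∧ i ∘ d = j := by
  have hm := Tuple.monotone_sort j
  obtain ⟨e, he, u, hu, h⟩ := exists_incrOn_mul hm (Tuple.sort j)
  refine ⟨_, hm, e⁻¹, by rwa [inv_inv], funext fun p => ?_⟩
  have h1 := mem_stab.1 (inv_mem hu) (e⁻¹ p)
  rw [Function.comp_apply, ← h1]
  simp [← h]

theorem conjSub_inf_young (a b : SuperComp m n r) (d : Equiv.Perm (Fin r)) :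
    conjSub a.young d ⊓ b.young = stab (pairLabel b.word (a.word ∘ d)) := by
  ext w
  rw [Subgroup.mem_inf, mem_conjSub, a.young_eq_stab, b.young_eq_stab, mem_stab, mem_stab, mem_stab]
  simp only [pairLabel_eq, Function.comp_apply]
  constructor
  · rintro ⟨h1, h2⟩ p
    exact ⟨h2 p, by simpa using h1 (d p)⟩
  · intro h
    exact ⟨fun p => by simpa using (h (d⁻¹ p)).2, fun p => (h p).1⟩

/-- Triviality is tested on transpositions: if `w` in the intersection moves `p`, then `p` and `w p`
are two distinct unfixed positions sharing both labels, and swapping any such pair lies in the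
intersection. -/
theorem conjSub_fixing_inf_eq_bot {A B : Type*} {f : Fin r → A} {g : Fin r → B} {S : A → Prop}
    {T : B → Prop} {d : Equiv.Perm (Fin r)} :
    conjSub (stab f ⊓ fixingSubgroup (Equiv.Perm (Fin r)) {t | S (f t)}) d ⊓
        (stab g ⊓ fixingSubgroup (Equiv.Perm (Fin r)) {t | T (g t)}) = ⊥ ↔
      ∀ a b, a ≠ b → f (d a) = f (d b) → g a = g b → S (f (d a)) ∨ T (g a) := by
  rw [Subgroup.eq_bot_iff_forall]
  simp only [Subgroup.mem_inf, mem_conjSub, mem_fixingSubgroup_iff, Equiv.Perm.smul_def]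
  constructor
  · intro h a b hab hf hg
    by_contra! hST
    refine hab ?_
    have h1 : d * Equiv.swap a b * d⁻¹ = Equiv.swap (d a) (d b) := Equiv.swap_apply_apply d a b |>.symm
    have h2 := h (Equiv.swap a b) (by
      rw [h1]
      refine ⟨⟨swap_mem_stab hf, fun t ht => ?_⟩, swap_mem_stab hg, fun t ht => ?_⟩
      · refine Equiv.swap_apply_of_ne_of_ne ?_ ?_ <;> rintro rfl
        · exact hST.1 ht
        · exact hST.1 (hf ▸ ht)
      · refine Equiv.swap_apply_of_ne_of_ne ?_ ?_ <;> rintro rfl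
        · exact hST.2 ht
        · exact hST.2 (hg ▸ ht))
    exact Equiv.swap_eq_one_iff.1 h2
  · rintro h w ⟨⟨h1, h2⟩, h3, h4⟩
    refine Equiv.ext fun p => ?_
    by_contra hp
    have h5 := h1 (d p)
    simp only [Equiv.Perm.mul_apply] at h5
    rcases h p (w p) (Ne.symm hp) (by simpa using h5.symm) (h3 p).symm with h6 | h6
    · refine hp (d.injective ?_)
      simpa using h2 (d p) h6
    · exact hp (h4 p h6)

theorem mem_doubleDistCirc {a b : SuperComp m n r} {d : Equiv.Perm (Fin r)} :
    d ∈ doubleDistCirc a b ↔ d ∈ doubleDist a b ∧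
      ∀ s t, s ≠ t → pairLabel b.word (a.word ∘ d) s = pairLabel b.word (a.word ∘ d) t →
        (IsOdd (b.word s) ↔ IsOdd ((a.word ∘ d) s)) := by
  change (_ ∧ _ ∧ _) ↔ _
  refine and_congr_right fun _ => ?_
  simp only [SuperComp.youngEven, SuperComp.youngOdd, SuperComp.young_eq_stab]
  rw [conjSub_fixing_inf_eq_bot (S := fun x => IsOdd x) (T := fun x => ¬ IsOdd x),
    conjSub_fixing_inf_eq_bot (S := fun x => ¬ IsOdd x) (T := fun x => IsOdd x)]
  simp only [pairLabel_eq, Function.comp_apply]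
  constructor
  · rintro ⟨h1, h2⟩ s t hst ⟨h3, h4⟩
    have h5 := h1 s t hst h4 h3
    have h6 := h2 s t hst h4 h3
    tauto
  · intro h
    refine ⟨fun s t hst h4 h3 => ?_, fun s t hst h4 h3 => ?_⟩ <;>
    · have := h s t hst ⟨h3, h4⟩
      tauto

theorem Compatible.of_label {α α' : Type*} [LinearOrder α] [LinearOrder α'] {γ : Fin r → α}
    {γ' : Fin r → α'} {i j : Fin r → Fin (m + n)} (h : Compatible γ i j)
    (hγ : ∀ a b, γ' a = γ' b → γ a = γ b) : Compatible γ' i j :=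
  ⟨fun a b hab => h.left a b (hγ a b hab), fun a b hab => h.right a b (hγ a b hab),
    fun a b hne hab => h.parity a b hne (hγ a b hab)⟩

theorem compatible_pairLabel {i j : Fin r → Fin (m + n)} :
    Compatible (pairLabel i j) i j ↔ ∀ s t, s ≠ t → pairLabel i j s = pairLabel i j t →
      (IsOdd (i s) ↔ IsOdd (j s)) :=
  ⟨fun h => h.parity, fun h => ⟨fun _ _ hab => (pairLabel_eq.1 hab).1,
    fun _ _ hab => (pairLabel_eq.1 hab).2, h⟩⟩

theorem fullCount_congr {α α' : Type*} [LinearOrder α] [LinearOrder α'] {γ : Fin r → α}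
    {γ' : Fin r → α'} (l : ℕ) (h : stab γ = stab γ') : fullCount l γ = fullCount l γ' := by
  have h1 (a b : Fin r) : γ a = γ b ↔ γ' a = γ' b :=
    ⟨stab_le_stab_iff.1 h.le a b, stab_le_stab_iff.1 h.ge a b⟩
  have h2 (p : Fin r) : rank γ p = rank γ' p :=
    congrArg Finset.card (Finset.filter_congr fun i _ => and_congr_right fun _ => h1 i p)
  simp only [fullCount, h2]

theorem exists_composition {α : Type*} [LinearOrder α] [Fintype α] {γ : Fin r → α}
    (hγ : Monotone γ) : ∃ c : List ℕ, c.sum = r ∧ parabolic r c = stab γ := by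
  let e := Fintype.orderIsoFinOfCardEq α rfl
  have hm : Monotone (e.symm ∘ γ) := e.symm.monotone.comp hγ
  refine ⟨List.ofFn (classSizes (e.symm ∘ γ)), by rw [List.sum_ofFn, sum_classSizes], ?_⟩
  ext w
  refine forall_congr' fun p => ?_
  rw [blockIdx_classSizes hm, blockIdx_classSizes hm, ← Fin.ext_iff, Function.comp_apply,
    Function.comp_apply, e.symm.apply_eq_iff_eq]

end Labels

/-! ### The spanning elements are norms from the prescribed parabolic subgroup. -/

section NormIdealLE

variable {F : Type*} [Field F] [CharZero F] {m n r l k : ℕ} {q : Fˣ}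

theorem parityExp_pos (hl : 0 < l) (i : Fin r → Fin (m + n)) (p : Fin r) :
    0 < parityExp l i p := by
  unfold parityExp
  split_ifs <;> omega

theorem parityExp_coprime (hl : 0 < l) (i : Fin r → Fin (m + n)) (p : Fin r) :
    (parityExp l i p).Coprime l := by
  unfold parityExp
  split_ifs
  · have h : (l + (l - 1)).Coprime l := by
      rw [Nat.coprime_self_add_left, Nat.coprime_comm]
      exact (Nat.coprime_self_sub_right hl).2 (Nat.coprime_one_right l)
    rwa [show 2 * l - 1 = l + (l - 1) by omega]
  · exact Nat.coprime_one_left l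

theorem isPrimitiveRoot_sq {F : Type*} [Field F] {q : Fˣ} (hl : Odd l) (hq : IsPrimitiveRoot (q : F) l) :
    IsPrimitiveRoot ((q : F) ^ 2) l :=
  hq.pow_of_coprime 2 (Nat.coprime_two_left.2 hl)

/-- Multiplying the conjugating element on the left by an element of the subgroup does not change
the conjugate, so the shortest element of the coset will do. -/
theorem exists_distinguished_conj {α α' : Type*} [LinearOrder α] [LinearOrder α'] {β : Fin r → α}
    {ρ : Fin r → α'} (hβ : Monotone β) {x : Equiv.Perm (Fin r)}
    (h : conjSub (stab β) x = stab ρ) :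
    ∃ y ∈ distinguished (stab β), conjSub (stab β) y = stab ρ := by
  obtain ⟨d, hd, u, hu, he⟩ := exists_incrOn_mul hβ x⁻¹
  refine ⟨d⁻¹, (mem_distinguished_stab hβ).2 (by rwa [inv_inv]), ?_⟩
  rw [← h]
  have hx : x = u⁻¹ * d⁻¹ := by rw [← mul_inv_rev, he, inv_inv]
  ext w
  rw [mem_conjSub, mem_conjSub, hx]
  rw [show u⁻¹ * d⁻¹ * w * (u⁻¹ * d⁻¹)⁻¹ = u⁻¹ * (d⁻¹ * w * d⁻¹⁻¹) * u by simp [mul_assoc],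
    Subgroup.mul_mem_cancel_right _ hu, Subgroup.mul_mem_cancel_left _ (inv_mem hu)]

theorem normBasis_mem (hl : Odd l) (hq : IsPrimitiveRoot (q : F) l) {a b : SuperComp m n r}
    {d : Equiv.Perm (Fin r)} {c L : List ℕ} (hd : d ∈ doubleDistCirc a b) (hc : c.sum = r)
    (hcν : parabolic r c = conjSub a.young d ⊓ b.young)
    (hP : ConjLE (parabolic r (maxLComp l c)) (parabolic r L)) :
    normBasis q b a d ∈ (heckeEnd m n q (parabolic r L)).map
      (relNorm q ⊤ (parabolic r L)) := by
  classical
  have hl0 : 0 < l := hl.pos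
  rw [normBasis, ← hcν]
  rw [conjSub_inf_young] at hcν
  simp only [parabolic_eq_stab] at hcν hP ⊢
  have hγ := blockFun_mono r c
  have hρ := blockFun_mono r (maxLComp l c)
  have hcomp : Compatible (blockFun r c) b.word (a.word ∘ d) :=
    (compatible_pairLabel.2 (mem_doubleDistCirc.1 hd).2).of_label (stab_le_stab_iff.1 hcν.le)
  have hle : stab (blockFun r (maxLComp l c)) ≤ stab (blockFun r c) := by
    rw [stab_le_stab_iff]
    intro s t hst
    have hf := sum_maxLPart l
    rcases le_total s t with h | h
    · exact blockIdx_flatMap hf h (by rw [hc]; exact t.2) hst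
    · exact (blockIdx_flatMap hf h (by rw [hc]; exact s.2) hst.symm).symm
  have hne := (sum_incrOn_ne_zero_iff hγ hρ hle (isPrimitiveRoot_sq hl hq)
    (ε := parityExp l b.word) (fun s t h => by simp only [parityExp, hcomp.left s t h])
    (parityExp_pos hl0 _) (parityExp_coprime hl0 _)).2 (by
      rw [fullCount_blockFun hc, fullCount_blockFun (by rw [sum_maxLComp, hc]),
        sum_div_maxLComp hl0])
  have hnorm := hcomp.relNorm_matUnit q hγ hρ hle hl0 hq.pow_eq_one
  obtain ⟨x, hx, M, hM, hxM⟩ := hP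
  rw [parabolic_eq_stab] at hxM
  obtain ⟨y, hy, hyM⟩ := exists_distinguished_conj hρ hxM
  have hmem' : matUnit F b.word (a.word ∘ d) ∈
      heckeEnd m n q (stab (blockFun r (maxLComp l c))) :=
    (hcomp.of_label (stab_le_stab_iff.1 hle)).matUnit_mem q hρ
  obtain ⟨g, hg, hgN⟩ := relNorm_conj q hρ (blockFun_mono r M) hy hyM hmem'
  rw [hxM] at hx
  -- The nonzero scalar is inserted to replace the norm from `W_ν` by the norm from `P_ν`, which can
  -- then be conjugated.
  refine (Submodule.smul_mem_iff _ hne).1 ?_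
  rw [← hnorm, hgN, relNorm_trans q (blockFun_mono r L) (blockFun_mono r M) hx]
  refine Submodule.mem_map_of_mem ?_
  exact relNorm_mem_heckeEnd q (blockFun_mono r M) hx
    (fun _ h1 _ h2 => heckeSub_mul q (blockFun_mono r L) h1 h2) hg

end NormIdealLE

/-! ### Matrix coefficients at sorted pairs of words. -/

section Coefficients

variable {F : Type*} [Field F] {m n r : ℕ} {q : Fˣ}

/-- If `j` has a descent at `k` inside a class of `i`, adjointness of `T_k` expresses its
coefficient through that of the lexicographically smaller word `j ∘ s_k`. Hence the coefficients at
words sorted within the classes determine `Y`. -/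
theorem form_basis_eigen {i : Fin r → Fin (m + n)} {Y : TensorSpace F m n r}
    (hY : ∀ k : Fin (r - 1), i (posL k) = i (posR k) →
      actGen q k Y = diagCoef (q : F) (i (posL k)) • Y)
    (h0 : ∀ j, (∀ a b, a < b → i a = i b → j a ≤ j b) → form F m n r Y (tensorBasis F m n r j) = 0)
    (hi : Monotone i) : Y = 0 := by
  refine eq_of_form fun j => ?_
  rw [map_zero, LinearMap.zero_apply]
  have hwf : WellFounded fun x y : Fin r → Fin (m + n) => toLex x < toLex y :=
    InvImage.wf toLex wellFounded_lt
  induction j using hwf.induction with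
  | _ j ih =>
    by_cases hj : ∀ a b, a < b → i a = i b → j a ≤ j b
    · exact h0 j hj
    obtain ⟨k, hik, hjk⟩ : ∃ k, i (posL k) = i (posR k) ∧ j (posR k) < j (posL k) := by
      by_contra! hk
      refine hj fun a b hab hiab => ?_
      have hm : Monotone fun p => (pairLabel i j p) := by
        have hstep (k : Fin (r - 1)) : pairLabel i j (posL k) ≤ pairLabel i j (posR k) := by
          refine Prod.Lex.toLex_le_toLex.2 ?_
          rcases (hi (posL_lt_posR k).le).eq_or_lt with h | h
          · exact Or.inr ⟨h, hk k h⟩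
          · exact Or.inl h
        intro a b hab
        obtain ⟨t, ht⟩ : ∃ t, b.1 = a.1 + t := ⟨b.1 - a.1, by have := Fin.le_def.1 hab; omega⟩
        induction t generalizing b with
        | zero => rw [Fin.ext (show b.1 = a.1 by omega)]
        | succ t iht =>
          have hb := b.2
          obtain ⟨k, hk1, hk2⟩ := exists_pos (a := ⟨a.1 + t, by omega⟩) (b := b) (by simp; omega)
          have h1 := iht (b := posL k) (by rw [hk1, Fin.le_def]; simp) (by rw [hk1])
          exact h1.trans (hk2 ▸ hstep k)
      exact (monotone_pairLabel.1 hm).2 a b hab hiab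
    have hlt : toLex (j ∘ simpleRefl k) < toLex j := by
      refine ⟨posL k, fun p hp => ?_, ?_⟩
      · change j (simpleRefl k p) = j p
        rw [simpleRefl_of_ne hp.ne (hp.trans (posL_lt_posR k)).ne]
      · change j (simpleRefl k (posL k)) < j (posL k)
        rwa [simpleRefl_posL]
    have h1 := form_actGen q k Y (tensorBasis F m n r j)
    rw [hY k hik, actGen_gt q k j hjk, map_add, map_smul, map_smul, ih _ hlt, smul_zero, zero_add,
      map_smul, LinearMap.smul_apply, smul_eq_mul, smul_eq_mul, ← sub_eq_zero, ← sub_mul] at h1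
    -- The eigenvalue minus `q - q⁻¹` is `q⁻¹` or `-q`, hence nonzero.
    refine (mul_eq_zero.1 h1).resolve_left ?_
    rcases diagCoef_eq (q : F) (i (posL k)) with e | e <;> rw [e]
    · simp
    · rw [neg_sub_left, neg_eq_zero]
      simp

/-- Inside a class of the pair, `T_k` has eigenvalue given by the parity of `i` on `Y` and by that
of `j` on `v_j`. A nonzero coefficient forces the two eigenvalues to agree. -/
theorem parity_of_eigen (hq2 : (q : F) ≠ -(q : F)⁻¹) {i j : Fin r → Fin (m + n)}
    {Y : TensorSpace F m n r}
    (hY : ∀ k : Fin (r - 1), i (posL k) = i (posR k) →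
      actGen q k Y = diagCoef (q : F) (i (posL k)) • Y)
    (hm : Monotone (pairLabel i j)) (h0 : form F m n r Y (tensorBasis F m n r j) ≠ 0) :
    Compatible (pairLabel i j) i j := by
  rw [compatible_pairLabel]
  have key (s t : Fin r) (hst : s < t) (h : pairLabel i j s = pairLabel i j t) :
      IsOdd (i s) ↔ IsOdd (j s) := by
    have ht := t.2
    have hst' := Fin.lt_def.1 hst
    obtain ⟨k, rfl, hk2⟩ := exists_pos (a := s) (b := ⟨s.1 + 1, by omega⟩) rfl
    have h1 : pairLabel i j (posL k) = pairLabel i j (posR k) := by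
      refine le_antisymm (hm (posL_lt_posR k).le) (h ▸ hm ?_)
      rw [hk2, Fin.le_def]
      exact hst'
    rw [pairLabel_eq] at h1
    have h2 := form_actGen q k Y (tensorBasis F m n r j)
    rw [hY k h1.1, actGen_eq q k j h1.2, map_smul, map_smul, LinearMap.smul_apply] at h2
    have h3 := mul_right_cancel₀ h0 h2
    unfold diagCoef at h3
    split_ifs at h3 with h4 h5 h5
    · exact iff_of_true h4 h5
    · exact absurd h3.symm hq2
    · exact absurd h3 hq2
    · exact iff_of_false h4 h5
  intro s t hst h
  rcases lt_or_gt_of_ne hst with h1 | h1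
  · exact key s t h1 h
  · rw [(pairLabel_eq.1 h).1, (pairLabel_eq.1 h).2]
    exact key t s h1 h.symm

theorem eigen_of_commutes {N : Module.End F (TensorSpace F m n r)}
    (hN : N ∈ heckeEnd m n q ⊤) (i : Fin r → Fin (m + n)) (k : Fin (r - 1))
    (hk : i (posL k) = i (posR k)) :
    actGen q k (N (tensorBasis F m n r i)) =
      diagCoef (q : F) (i (posL k)) • N (tensorBasis F m n r i) := by
  have h1 := hN (heckeGen q k) (by rw [heckeSub_top]; trivial) (tensorBasis F m n r i)
  rw [rightMul_gen, actGen_eq q k i hk, map_smul] at h1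
  exact h1.symm

/-- Sorted words generate the tensor space over the Hecke algebra, because every word is, up to
sign, `v_i T_d` with `i` sorted. -/
theorem end_eq_zero {N : Module.End F (TensorSpace F m n r)} (hN : N ∈ heckeEnd m n q ⊤)
    (h : ∀ i, Monotone i → N (tensorBasis F m n r i) = 0) : N = 0 := by
  refine (tensorBasis F m n r).ext fun j => ?_
  obtain ⟨i, hi, d, hd, rfl⟩ := exists_sorted j
  obtain ⟨c, hc, he⟩ := rightMul_basis_of_incrOn (F := F) q hi hd
  have hc0 : c ≠ 0 := by rcases hc with rfl | ⟨rfl, _⟩ <;> simp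
  have h1 := hN (heckeT q d) (by rw [heckeSub_top]; trivial) (tensorBasis F m n r i)
  rw [h i hi, map_zero, he, map_smul] at h1
  exact (smul_eq_zero.1 h1).resolve_left hc0

theorem eq_of_form_rightMul_ne_zero {i i' : Fin r → Fin (m + n)} (hi : Monotone i)
    (hi' : Monotone i') {w : Equiv.Perm (Fin r)}
    (h : form F m n r (rightMul q (heckeT q w) (tensorBasis F m n r i')) (tensorBasis F m n r i) ≠ 0) :
    i' = i ∧ w ∈ stab i := by
  obtain ⟨e, he, v, hv, hw⟩ := exists_incrOn_mul hi' w⁻¹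
  obtain rfl : w = v⁻¹ * e⁻¹ := by rw [← mul_inv_rev, hw, inv_inv]
  have hd : e⁻¹ ∈ distinguished (stab i') := (mem_distinguished_stab hi').2 (by rwa [inv_inv])
  obtain ⟨c, -, hc⟩ := rightMul_basis_of_incrOn (F := F) q hi' (y := e⁻¹) (by rwa [inv_inv])
  rw [heckeT_mul_distinguished q hi' hd (inv_mem hv), rightMul_mul, Module.End.mul_apply,
    rightMul_basis_of_mem_stab q hi' (fun _ _ h => h) (inv_mem hv), map_smul, hc, map_smul, map_smul,
    LinearMap.smul_apply, LinearMap.smul_apply, form_basis] at h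
  have h1 : i' ∘ ⇑e⁻¹ = i := by
    by_contra h1
    rw [if_neg h1] at h
    simp at h
  have h2 : i' = i := by
    have := Tuple.unique_monotone (f := i') (σ := 1) (τ := e⁻¹) hi' (h1 ▸ hi)
    exact this.trans h1
  subst h2
  exact ⟨rfl, mul_mem (inv_mem hv) fun p => congrFun h1 p⟩

/-- Only `w = 1` can contribute: the first factor forces `i' = i` and `w ∈ stab i`, and the second
forces `w` to permute the sorted pair to a sorted pair. So `w` stabilizes the pair, and being
shortest in its coset it is `1`. -/
theorem form_relNorm_matUnit {i j i' j' : Fin r → Fin (m + n)} (hm : Monotone (pairLabel i j))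
    (hm' : Monotone (pairLabel i' j')) :
    form F m n r (relNorm q ⊤ (stab (pairLabel i j)) (matUnit F i j) (tensorBasis F m n r i'))
      (tensorBasis F m n r j') = if i = i' ∧ j = j' then 1 else 0 := by
  classical
  have hi := (monotone_pairLabel.1 hm).1
  have hi' := (monotone_pairLabel.1 hm').1
  rw [relNorm_apply, LinearMap.sum_apply, map_sum, LinearMap.sum_apply]
  simp only [Module.End.mul_apply, matUnit_apply, map_smul, LinearMap.smul_apply, smul_eq_mul]
  have hterm (w : Equiv.Perm (Fin r)) (hw : w ∈ distinguished (stab (pairLabel i j)))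
      (h : form F m n r (rightMul q (heckeT q w⁻¹) (tensorBasis F m n r i'))
        (tensorBasis F m n r i) * form F m n r (rightMul q (heckeT q w) (tensorBasis F m n r j))
          (tensorBasis F m n r j') ≠ 0) : w = 1 ∧ i = i' ∧ j = j' := by
    obtain ⟨rfl, hwi⟩ := eq_of_form_rightMul_ne_zero hi hi' (left_ne_zero_of_mul h)
    rw [inv_mem_iff] at hwi
    rw [mem_distinguished_stab hm] at hw
    obtain ⟨c, -, hc⟩ := rightMul_basis_of_sorted (F := F) q hi' (i := j)
      (monotone_pairLabel.1 hm).2 hwi fun a b hab h1 h2 => hw a b hab (pairLabel_eq.2 ⟨h1, h2⟩)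
    have h1 := right_ne_zero_of_mul h
    rw [hc, map_smul, LinearMap.smul_apply, form_basis] at h1
    have h2 : j ∘ w = j' := by
      by_contra h2
      simp [h2] at h1
    have h3 : pairLabel i' j ∘ w = pairLabel i' j' := by
      funext p
      rw [Function.comp_apply, pairLabel, pairLabel, hwi p, ← h2]
      rfl
    have h4 : pairLabel i' j = pairLabel i' j ∘ w :=
      Tuple.unique_monotone (f := pairLabel i' j) (σ := 1) (τ := w) hm (h3 ▸ hm')
    have h5 : w ∈ stab (pairLabel i' j) := fun p => (congrFun h4 p).symm
    have h6 : w⁻¹ = 1 := eq_one_of_incrOn hm (inv_mem h5) hw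
    rw [inv_eq_one] at h6
    refine ⟨h6, rfl, ?_⟩
    rw [← h2, h6]
    rfl
  rw [Finset.sum_eq_single (1 : Equiv.Perm (Fin r))]
  · rw [inv_one, heckeT_one, rightMul_one, Module.End.one_apply, Module.End.one_apply, form_basis,
      form_basis]
    by_cases h1 : i = i'
    · subst h1
      simp
    · simp [h1, Ne.symm h1]
  · intro w hw hw1
    rw [Finset.mem_filter_univ] at hw
    by_contra h
    exact hw1 (hterm w hw.1 h).1
  · intro h
    refine absurd ?_ h
    rw [Finset.mem_filter_univ, mem_distinguished_stab hm, inv_one]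
    exact ⟨incrOn_one, trivial⟩

end Coefficients

/-! ### Norms from the prescribed parabolic subgroup lie in the ideal. -/

section NormIdealGE

variable {F : Type*} [Field F] [CharZero F] {m n r l k : ℕ} {q : Fˣ}

/-- For `l > 1`, a rank divisible by `l` needs a class with at least `l` elements. Such a class
fills one of the `k` translated blocks of size `l`, and the position is the last one in it. -/
theorem fullCount_le_of_refines {α : Type*} [LinearOrder α] (hl : 1 < l) (γ : Fin r → α)
    (y : Equiv.Perm (Fin r)) :
    fullCount l (fun p => toLex (γ p, blockFun r (theta l k r) (y⁻¹ p))) ≤ k := by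
  set ρ : Fin r → α ×ₗ ℕ := fun p => toLex (γ p, blockFun r (theta l k r) (y⁻¹ p)) with hρ
  have hρθ {a b : Fin r} (h : ρ a = ρ b) :
      blockFun r (theta l k r) (y⁻¹ a) = blockFun r (theta l k r) (y⁻¹ b) := by
    simp only [hρ, EmbeddingLike.apply_eq_iff_eq, Prod.mk.injEq] at h
    exact h.2
  have hθ (p : Fin r) : blockFun r (theta l k r) p =
      if p.1 < k * l then p.1 / l else k + (p.1 - k * l) := blockIdx_theta p.2
  have hblock (t : ℕ) (ht : t < k) :
      (Finset.univ.filter fun p => blockFun r (theta l k r) (y⁻¹ p) = t).card ≤ l := by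
    refine (Finset.card_le_card_of_injOn (t := Finset.Ico (t * l) (t * l + l))
      (fun p => (y⁻¹ p).1) ?_ ?_).trans_eq (by simp)
    · intro p hp
      simp only [Finset.coe_filter, Finset.mem_univ, true_and, Set.mem_ofPred_eq, hθ] at hp
      rw [Finset.mem_coe, Finset.mem_Ico]
      split_ifs at hp with h
      · subst hp
        refine ⟨Nat.div_mul_le_self _ _, ?_⟩
        have := Nat.div_add_mod' (y⁻¹ p).1 l
        have := Nat.mod_lt (y⁻¹ p).1 (show 0 < l by omega)
        dsimp only
        omega
      · omega
    · intro p _ p' _ h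
      exact y⁻¹.injective (Fin.ext h)
  have hclass (p : Fin r) (hp : l ∣ rank ρ p) : blockFun r (theta l k r) (y⁻¹ p) < k ∧
      (Finset.univ.filter fun i => i ≤ p ∧ ρ i = ρ p) = Finset.univ.filter fun i =>
        blockFun r (theta l k r) (y⁻¹ i) = blockFun r (theta l k r) (y⁻¹ p) := by
    have h1 : l ≤ rank ρ p := Nat.le_of_dvd (rank_pos ρ p) hp
    have hsub : (Finset.univ.filter fun i => i ≤ p ∧ ρ i = ρ p) ⊆ Finset.univ.filter fun i =>
        blockFun r (theta l k r) (y⁻¹ i) = blockFun r (theta l k r) (y⁻¹ p) := by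
      intro i hi
      rw [Finset.mem_filter_univ] at hi ⊢
      exact hρθ hi.2
    have hlt : blockFun r (theta l k r) (y⁻¹ p) < k := by
      by_contra hge
      have h2 : (Finset.univ.filter fun i => i ≤ p ∧ ρ i = ρ p).card ≤ 1 := by
        rw [Finset.card_le_one]
        have h3 (i : Fin r) (hi : blockFun r (theta l k r) (y⁻¹ i) =
            blockFun r (theta l k r) (y⁻¹ p)) : i = p := by
          refine y⁻¹.injective (Fin.ext ?_)
          have hlt' {x : ℕ} (hx : x < k * l) : x / l < k :=
            Nat.div_lt_of_lt_mul (by rwa [mul_comm])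
          rw [hθ (y⁻¹ p)] at hge hi
          rw [hθ] at hi
          split_ifs at hge hi with h4 h5 h5
          · exact absurd (hlt' h4) hge
          · exact absurd (hlt' h4) hge
          · have := hlt' h5
            omega
          · omega
        intro i hi i' hi'
        rw [h3 i (by simpa using hsub hi), h3 i' (by simpa using hsub hi')]
      rw [rank] at h1
      omega
    exact ⟨hlt, Finset.eq_of_subset_of_card_le hsub ((hblock _ hlt).trans h1)⟩
  refine (Finset.card_le_card_of_injOn (t := Finset.range k)
    (fun p => blockFun r (theta l k r) (y⁻¹ p)) ?_ ?_).trans_eq (by simp)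
  · intro p hp
    simp only [Finset.coe_filter, Finset.mem_univ, true_and, Set.mem_ofPred_eq] at hp
    rw [Finset.mem_coe, Finset.mem_range]
    exact (hclass p hp).1
  · have hle (p p' : Fin r) (hp : l ∣ rank ρ p) (h : blockFun r (theta l k r) (y⁻¹ p) =
        blockFun r (theta l k r) (y⁻¹ p')) : p' ≤ p := by
      have h1 : p' ∈ Finset.univ.filter fun i => i ≤ p ∧ ρ i = ρ p := by
        rw [(hclass p hp).2, Finset.mem_filter_univ, h]
      rw [Finset.mem_filter_univ] at h1
      exact h1.1
    intro p hp p' hp' h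
    simp only [Finset.coe_filter, Finset.mem_univ, true_and, Set.mem_ofPred_eq] at hp hp'
    exact le_antisymm (hle p' p hp' h.symm) (hle p p' hp h)

/-- A Mackey-type splitting: within the coset of `y`, being shortest for `θ` becomes a condition on
`u` for the common refinement of `γ` and the translate of `θ` by `y`. -/
theorem incrOn_mul_iff {α α' : Type*} [LinearOrder α] [LinearOrder α'] {γ : Fin r → α}
    {θ : Fin r → α'} (hγ : Monotone γ) {u y : Equiv.Perm (Fin r)} (hu : u ∈ stab γ)
    (hy : IncrOn γ y⁻¹) :
    IncrOn θ (u * y) ↔ IncrOn θ y ∧ IncrOn (fun p => toLex (γ p, θ (y⁻¹ p))) u := by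
  constructor
  · intro h
    constructor
    · intro a b hab hθ
      by_contra hlt
      have h1 : y b < y a := lt_of_le_of_ne (not_lt.1 hlt) fun h2 => hab.ne' (y.injective h2)
      have h2 : u (y a) < u (y b) := h a b hab hθ
      have h3 : γ (y b) = γ (y a) := by
        refine le_antisymm (hγ h1.le) ?_
        rw [← hu (y a), ← hu (y b)]
        exact hγ h2.le
      have h4 := hy _ _ h1 h3
      simp only [Equiv.Perm.coe_inv, Equiv.symm_apply_apply] at h4
      exact h4.not_gt hab
    · intro a b hab h1
      simp only [EmbeddingLike.apply_eq_iff_eq, Prod.mk.injEq] at h1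
      simpa using h _ _ (hy a b hab h1.1) h1.2
  · rintro ⟨h1, h2⟩ a b hab hθ
    have h3 := h1 a b hab hθ
    rcases (hγ h3.le).eq_or_lt with h4 | h4
    · refine h2 _ _ h3 ?_
      simpa using ⟨h4, hθ⟩
    · refine lt_of_not_ge fun h5 => ?_
      have h6 := hγ h5
      rw [Equiv.Perm.mul_apply, Equiv.Perm.mul_apply, hu, hu] at h6
      exact h6.not_gt h4

theorem fullCount_le_of_coefficient_ne_zero (hl : Odd l) (hl1 : 1 < l)
    (hq : IsPrimitiveRoot (q : F) l) {α : Type*} [LinearOrder α] {γ : Fin r → α} (hγ : Monotone γ)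
    {i j : Fin r → Fin (m + n)} (hc : Compatible γ i j) (f : Module.End F (TensorSpace F m n r))
    (h : form F m n r (relNorm q ⊤ (parabolic r (theta l k r)) f (tensorBasis F m n r i))
      (tensorBasis F m n r j) ≠ 0) : fullCount l γ ≤ k := by
  classical
  have hθ := blockFun_mono r (theta l k r)
  set g : Equiv.Perm (Fin r) → F := fun z => form F m n r
    (f (rightMul q (heckeT q z) (tensorBasis F m n r i)))
    (rightMul q (heckeT q z) (tensorBasis F m n r j)) with hg
  -- After moving `T_z` to the other argument of the form, `T_u` acts on `v_i` and `v_j` by the same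
  -- character, so its square factors out.
  have hgmul (u y : Equiv.Perm (Fin r)) (hu : u ∈ stab γ) (hy : y ∈ distinguished (stab γ)) :
      g (u * y) = invProd (fun p => ((q : F) ^ 2) ^ parityExp l i p) u * g y := by
    simp only [hg]
    rw [heckeT_mul_distinguished q hγ hy hu, rightMul_mul, Module.End.mul_apply,
      Module.End.mul_apply, rightMul_basis_of_mem_stab q hγ hc.left hu,
      hc.rightMul_right q hγ hu, ← invProd_mul_self q hl.pos hq.pow_eq_one]
    simp only [map_smul, LinearMap.smul_apply, smul_eq_mul, mul_assoc]
  rw [relNorm_apply, parabolic_eq_stab, LinearMap.sum_apply, map_sum, LinearMap.sum_apply,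
    sum_mem_inv] at h
  simp only [Module.End.mul_apply, form_rightMul, inv_inv, inv_mem_iff, mem_distinguished_stab hθ,
    Subgroup.mem_top, and_true] at h
  have h1 := sum_mul_distinguished hγ (G := ⊤) le_top
    (fun z => if IncrOn (blockFun r (theta l k r)) z then g z else 0)
  rw [← Finset.sum_filter, Finset.filter_filter] at h1
  simp only [Subgroup.mem_top, true_and, and_true] at h1
  rw [h1] at h
  -- Some coset contributes; its contribution is a relative Poincaré scalar times `g y`, so that
  -- scalar is nonzero.
  obtain ⟨y, hy, hne⟩ := Finset.exists_ne_zero_of_sum_ne_zero h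
  rw [Finset.mem_filter_univ] at hy
  have hy' := (mem_distinguished_stab hγ).1 hy
  rw [← Finset.sum_filter, Finset.filter_filter] at hne
  have hyθ : IncrOn (blockFun r (theta l k r)) y := by
    obtain ⟨u, hu, -⟩ := Finset.exists_ne_zero_of_sum_ne_zero hne
    rw [Finset.mem_filter_univ] at hu
    exact ((incrOn_mul_iff hγ hu.1 hy').1 hu.2).1
  set ρ : Fin r → α ×ₗ ℕ := fun p => toLex (γ p, blockFun r (theta l k r) (y⁻¹ p)) with hρ
  have hρm : Monotone ρ := by
    intro a b hab
    refine Prod.Lex.toLex_le_toLex.2 ?_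
    rcases (hγ hab).eq_or_lt with h2 | h2
    · refine Or.inr ⟨h2, hθ ?_⟩
      rcases hab.eq_or_lt with rfl | h3
      · exact le_rfl
      · exact (hy' _ _ h3 h2).le
    · exact Or.inl h2
  have hle : stab ρ ≤ stab γ := stab_le_stab_iff.2 fun a b hab => by
    simp only [hρ, EmbeddingLike.apply_eq_iff_eq, Prod.mk.injEq] at hab
    exact hab.1
  have hsum : ∑ u with u ∈ stab γ ∧ IncrOn (blockFun r (theta l k r)) (u * y), g (u * y) =
      (∑ u with IncrOn ρ u ∧ u ∈ stab γ,
        invProd (fun p => ((q : F) ^ 2) ^ parityExp l i p) u) * g y := by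
    rw [Finset.sum_mul]
    refine Finset.sum_congr ?_ fun u hu => hgmul u y ?_ hy
    · ext u
      simp only [Finset.mem_filter_univ]
      constructor
      · rintro ⟨hu, h2⟩
        exact ⟨((incrOn_mul_iff hγ hu hy').1 h2).2, hu⟩
      · rintro ⟨h2, hu⟩
        exact ⟨hu, (incrOn_mul_iff hγ hu hy').2 ⟨hyθ, h2⟩⟩
    · rw [Finset.mem_filter_univ] at hu
      exact hu.2
  rw [hsum] at hne
  have := (sum_incrOn_ne_zero_iff hγ hρm hle (isPrimitiveRoot_sq hl hq) (ε := parityExp l i)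
    (fun s t h => by simp only [parityExp, hc.left s t h]) (parityExp_pos hl.pos _)
    (parityExp_coprime hl.pos _)).1 (left_ne_zero_of_mul hne)
  rw [this]
  exact fullCount_le_of_refines hl1 γ y

theorem relNorm_matUnit_mem_normIdeal {F : Type*} [Field F] {q : Fˣ} {i j : Fin r → Fin (m + n)} (hm : Monotone (pairLabel i j))
    (hc : Compatible (pairLabel i j) i j) (h : l = 1 ∨ fullCount l (pairLabel i j) ≤ k) :
    relNorm q ⊤ (stab (pairLabel i j)) (matUnit F i j) ∈
      normIdeal m n q l (parabolic r (theta l k r)) := by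
  obtain ⟨hi, hj⟩ := monotone_pairLabel.1 hm
  obtain ⟨b, rfl⟩ := exists_superComp hi
  obtain ⟨i', hi', d, hd, rfl⟩ := exists_sorted j
  obtain ⟨a, rfl⟩ := exists_superComp hi'
  obtain ⟨c, hcr, hcν⟩ := exists_composition hm
  rw [← conjSub_inf_young] at hcν ⊢
  refine Submodule.subset_span ⟨a, b, d, c, ?_, hcr, hcν, ?_, rfl⟩
  · refine mem_doubleDistCirc.2 ⟨⟨?_, ?_⟩, hc.parity⟩
    · rwa [a.young_eq_stab, mem_distinguished_stab hi']
    · rw [b.young_eq_stab, mem_distinguished_stab hi, inv_inv]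
      -- Shortness on the other side holds because the second word is weakly increasing on the
      -- classes of the first.
      intro s t hst hst'
      by_contra hlt
      have h1 : d t < d s := lt_of_le_of_ne (not_lt.1 hlt) fun h2 => hst.ne' (d.injective h2)
      have h2 := hd _ _ h1 (le_antisymm (hi' h1.le) (hj s t hst hst'))
      simp only [Equiv.Perm.coe_inv, Equiv.symm_apply_apply] at h2
      exact h2.not_gt hst
  · rcases h with rfl | h
    · exact conjLE_maxLComp_one hcr _
    · refine conjLE_of_sum_div_le hcr ?_
      rw [conjSub_inf_young, parabolic_eq_stab] at hcν
      rwa [← fullCount_blockFun hcr, fullCount_congr l hcν]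

theorem relNorm_mem_normIdeal (hl : Odd l) (hq : IsPrimitiveRoot (q : F) l)
    {f : Module.End F (TensorSpace F m n r)}
    (hf : f ∈ heckeEnd m n q (parabolic r (theta l k r))) :
    relNorm q ⊤ (parabolic r (theta l k r)) f ∈
      normIdeal m n q l (parabolic r (theta l k r)) := by
  classical
  have htop : ∀ a ∈ heckeSub q (⊤ : Subgroup (Equiv.Perm (Fin r))),
      ∀ b ∈ heckeSub q (⊤ : Subgroup (Equiv.Perm (Fin r))),
        a * b ∈ heckeSub q (⊤ : Subgroup (Equiv.Perm (Fin r))) := by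
    rw [heckeSub_top]
    exact fun _ _ _ _ => trivial
  -- Otherwise `q ^ 2 = -1`, whose `l`-th power is `-1` as `l` is odd, while it must be `1`.
  have hq2 : (q : F) ≠ -(q : F)⁻¹ := by
    intro h
    have h1 : ((q : F) ^ 2) ^ l = -1 := by
      rw [pow_two]
      nth_rewrite 1 [h]
      rw [neg_mul, inv_mul_cancel₀ q.ne_zero, hl.neg_one_pow]
    rw [(isPrimitiveRoot_sq hl hq).pow_eq_one] at h1
    norm_num [eq_neg_iff_add_eq_zero] at h1
  set N := relNorm q ⊤ (parabolic r (theta l k r)) f with hNdef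
  have hN : N ∈ heckeEnd m n q ⊤ :=
    relNorm_mem_heckeEnd q (blockFun_mono r (theta l k r)) le_top htop hf
  set S : Finset ((Fin r → Fin (m + n)) × (Fin r → Fin (m + n))) :=
    Finset.univ.filter fun p => Monotone (pairLabel p.1 p.2) ∧
      Compatible (pairLabel p.1 p.2) p.1 p.2 with hS
  set c : (Fin r → Fin (m + n)) × (Fin r → Fin (m + n)) → F := fun p =>
    form F m n r (N (tensorBasis F m n r p.1)) (tensorBasis F m n r p.2) with hc
  have hsum : N = ∑ p ∈ S, c p • relNorm q ⊤ (stab (pairLabel p.1 p.2)) (matUnit F p.1 p.2) := by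
    rw [← sub_eq_zero]
    have hmem : N - ∑ p ∈ S, c p • relNorm q ⊤ (stab (pairLabel p.1 p.2)) (matUnit F p.1 p.2) ∈
        heckeEnd m n q ⊤ := by
      have h1 : ∑ p ∈ S, c p • relNorm q ⊤ (stab (pairLabel p.1 p.2)) (matUnit F p.1 p.2) ∈
          heckeEnd m n q ⊤ := by
        refine Submodule.sum_mem _ fun p hp => Submodule.smul_mem _ _ ?_
        rw [hS, Finset.mem_filter_univ] at hp
        exact relNorm_mem_heckeEnd q hp.1 le_top htop (hp.2.matUnit_mem q hp.1)
      intro x hx v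
      rw [LinearMap.sub_apply, LinearMap.sub_apply, map_sub, hN x hx v, h1 x hx v]
    -- The difference commutes with the Hecke algebra, so it suffices to compare coefficients at
    -- sorted pairs. Pairs outside `S` have coefficient zero by the parity argument.
    refine end_eq_zero hmem fun i hi => ?_
    refine form_basis_eigen (eigen_of_commutes hmem i) (fun j hj => ?_) hi
    have hm := monotone_pairLabel.2 ⟨hi, hj⟩
    rw [LinearMap.sub_apply, map_sub, LinearMap.sub_apply, LinearMap.sum_apply, map_sum,
      LinearMap.sum_apply, sub_eq_zero]
    have h1 (p) (hp : p ∈ S) : form F m n r ((c p • relNorm q ⊤ (stab (pairLabel p.1 p.2))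
        (matUnit F p.1 p.2)) (tensorBasis F m n r i)) (tensorBasis F m n r j) =
          if p = (i, j) then c p else 0 := by
      rw [hS, Finset.mem_filter_univ] at hp
      rw [LinearMap.smul_apply, map_smul, LinearMap.smul_apply, form_relNorm_matUnit hp.1 hm,
        smul_eq_mul, mul_ite, mul_one, mul_zero]
      simp only [Prod.ext_iff]
    rw [Finset.sum_congr rfl h1, Finset.sum_ite_eq']
    split_ifs with hij
    · rfl
    · by_contra h0
      refine hij ?_
      rw [hS, Finset.mem_filter_univ]
      exact ⟨hm, parity_of_eigen hq2 (eigen_of_commutes hN i) hm h0⟩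
  rw [hsum]
  refine Submodule.sum_mem _ fun p hp => ?_
  by_cases h0 : c p = 0
  · rw [h0, zero_smul]
    exact Submodule.zero_mem _
  rw [hS, Finset.mem_filter_univ] at hp
  refine Submodule.smul_mem _ _ (relNorm_matUnit_mem_normIdeal hp.1 hp.2 ?_)
  rcases (Nat.succ_le_of_lt hl.pos).eq_or_lt with h1 | h1
  · exact Or.inl h1.symm
  · exact Or.inr (fullCount_le_of_coefficient_ne_zero hl h1 hq hp.1 hp.2 f h0)

end NormIdealGE

end QSchurSuper

theorem theorem7p4 {F : Type*} [Field F] [CharZero F] (m n r l k : ℕ) (q : Fˣ) (hl : Odd l)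
    (hq : IsPrimitiveRoot (q : F) l) (hk : k * l ≤ r) :
    QSchurSuper.normIdeal m n q l (QSchurSuper.parabolic r (QSchurSuper.theta l k r)) =
      (QSchurSuper.heckeEnd m n q (QSchurSuper.parabolic r (QSchurSuper.theta l k r))).map
        (QSchurSuper.relNorm q ⊤ (QSchurSuper.parabolic r (QSchurSuper.theta l k r))) := by
  apply le_antisymm
  · refine Submodule.span_le.2 ?_
    rintro _ ⟨a, b, d, c, hd, hc, hcν, hP, rfl⟩
    exact QSchurSuper.normBasis_mem hl hq hd hc hcν hP
  · rintro _ ⟨f, hf, rfl⟩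
    exact QSchurSuper.relNorm_mem_normIdeal hl hq hf
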